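/- **Setting.** Let $N\ge 1$, let $\Omega\subset\mathbb R^N$ be a bounded domain, $T>0$, $Q_T=\Omega\times(0,T)$, $\Sigma_T=\partial\Omega\times(0,T)$. Let $c\in C^1(\overline\Omega;\mathcal M_N(\mathbb R))$ satisfy $(c(x)\xi,\xi)\ge c_0|\xi|^2$ for all $x\in\overline\Omega$, $\xi\in\mathbb R^N$, with some $c_0>0$, and let $d\in L^\infty(Q_T)$. Put $$\mathcal I(y,\mathbf p)=y_t-\nabla\cdot\mathbf p+d\,y,\qquad \mathcal J(y,\mathbf p)=c\nabla y-\mathbf p,\qquad \mathcal I^\star(\varphi,\boldsymbol\sigma)=-\varphi_t-\nabla\cdot\boldsymbol\sigma+d\,\varphi .$$ Let $\omega\subset\Omega$ be open and nonempty and $q_T=\omega\times(0,T)$. For $\rho_\star>0$ let $\mathcal R$ be the set of $w\in C(Q_T)$ with $w\ge\rho_\star$ in $Q_T$ and $w\in L^\infty(\Omega\times(\delta,T))$ for every $\delta>0$. Let $\rho_0\in\mathcal R$, $\rho,\rho_1\in\mathcal R\cap L^\infty(Q_T)$ and $\eta_1,\eta_2>0$. The Hilbert space $\mathcal U$ is the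 (Hausdorff) completion of $\mathcal U_0=\{(y,\mathbf p)\in C^1(\overline{Q_T})\times \mathbf C^1(\overline{Q_T}): y=0\text{ on }\Sigma_T\}$ for the scalar product with associated norm $$\|(y,\mathbf p)\|_{\mathcal U}^2=\|\rho_0^{-1}y\|^2_{L^2(q_T)}+\eta_1\|\rho_1^{-1}\mathcal J(y,\mathbf p)\|^2_{\mathbf L^2(Q_T)}+\eta_2\|\rho^{-1}\mathcal I(y,\mathbf p)\|^2_{L^2(Q_T)};$$ $\rho_0^{-1}y|_{q_T}$, $\rho_1^{-1}\mathcal J(y,\mathbf p)$ and $\rho^{-1}\mathcal I(y,\mathbf p)$ are defined on $\mathcal U$ by continuous extension. The space $\Psi$ consists of the pairs $(\varphi,\boldsymbol\sigma)\in[C^0([0,T];L^2(\Omega))\cap L^2(0,T;H^1_0(\Omega))]\times\mathbf L^2(Q_T)$ with $\rho_0\mathcal I^\star(\varphi,\boldsymbol\sigma)\in L^2(Q_T)$ (where $\mathcal I^\star$ is taken in the sense of distributions) and $\varphi(\cdot,T)=0$, with the scalar product $$\langle(\varphi,\boldsymbol\sigma),(\overline\varphi,\overline{\boldsymbol\sigma})\rangle_\Psi=\iint_{Q_T}\Big(\boldsymbol\sigma\cdot\overline{\boldsymbol\sigma}+\rho^{-2}\nabla\varphi\cdot\nabla\overline\varphi+\rho_0^2\,\mathcal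 I^\star(\varphi,\boldsymbol\sigma)\,\mathcal I^\star(\overline\varphi,\overline{\boldsymbol\sigma})\Big)dx\,dt .$$ For $\alpha_1,\alpha_2\in(0,1)$, $r_1,r_2>0$ and $y_{obs}\in L^2(q_T)$ consider the problem: find $((y,\mathbf p),(\varphi,\boldsymbol\sigma))\in\mathcal U\times\Psi$ such that $$\begin{cases}a_{r,\alpha}((y,\mathbf p),(\overline y,\overline{\mathbf p}))+b_\alpha((\overline y,\overline{\mathbf p}),(\varphi,\boldsymbol\sigma))=l_{1,\alpha}(\overline y,\overline{\mathbf p})&\forall(\overline y,\overline{\mathbf p})\in\mathcal U,\\ b_\alpha((y,\mathbf p),(\overline\varphi,\overline{\boldsymbol\sigma}))-c_\alpha((\varphi,\boldsymbol\sigma),(\overline\varphi,\overline{\boldsymbol\sigma}))=l_{2,\alpha}(\overline\varphi,\overline{\boldsymbol\sigma})&\forall(\overline\varphi,\overline{\boldsymbol\sigma})\in\Psi,\end{cases}\tag{M}$$ where $$a_{r,\alpha}((y,\mathbf p),(\overline y,\overline{\mathbf p}))=(1-\alpha_1)\iint_{q_T}\rho_0^{-2}y\overline y+r_1\iint_{Q_T}\rho_1^{-2}\mathcal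 J(y,\mathbf p)\cdot\mathcal J(\overline y,\overline{\mathbf p})+r_2\iint_{Q_T}\rho^{-2}\mathcal I(y,\mathbf p)\,\mathcal I(\overline y,\overline{\mathbf p}),$$ $$b_\alpha((y,\mathbf p),(\varphi,\boldsymbol\sigma))=\iint_{Q_T}\mathcal J(y,\mathbf p)\cdot\boldsymbol\sigma+\iint_{Q_T}\mathcal I(y,\mathbf p)\,\varphi-\alpha_1\iint_{q_T}\mathcal I^\star(\varphi,\boldsymbol\sigma)\,y,$$ $$c_\alpha((\varphi,\boldsymbol\sigma),(\overline\varphi,\overline{\boldsymbol\sigma}))=\alpha_1\iint_{Q_T}\rho_0^2\,\mathcal I^\star(\varphi,\boldsymbol\sigma)\,\mathcal I^\star(\overline\varphi,\overline{\boldsymbol\sigma})+\alpha_2\iint_{Q_T}\mathcal J(\varphi,\boldsymbol\sigma)\cdot\mathcal J(\overline\varphi,\overline{\boldsymbol\sigma}),$$ $$l_{1,\alpha}(y,\mathbf p)=(1-\alpha_1)\iint_{q_T}\rho_0^{-2}y_{obs}\,y,\qquad l_{2,\alpha}(\varphi,\boldsymbol\sigma)=-\alpha_1\iint_{q_T}y_{obs}\,\mathcal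 I^\star(\varphi,\boldsymbol\sigma).$$ **Proposition.** Problem (M) is well posed: for arbitrary continuous linear forms on $\mathcal U$ and $\Psi$ as right-hand sides, the system has exactly one solution in $\mathcal U\times\Psi$, and the norm of the solution is bounded by a fixed constant (independent of the right-hand sides) times the sum of the norms of the two forms; in particular, for every $y_{obs}\in L^2(q_T)$, (M) has exactly one solution. Moreover, there is a constant $\theta_2>0$ which, for given $\Omega,T,c,d$, depends only on $\alpha_1,\alpha_2$ and $\rho_\star$ (not on $\omega,\rho_0,\rho,\rho_1,\eta_1,\eta_2,r_1,r_2$ or $y_{obs}$) such that the solution satisfies, with $\theta_1=\min\left(1-\alpha_1,\frac{r_1}{\eta_1},\frac{r_2}{\eta_2}\right)$, $$\theta_1\|(y,\mathbf p)\|_{\mathcal U}^2+\theta_2\|(\varphi,\boldsymbol\sigma)\|_\Psi^2\le\left(\frac{(1-\alpha_1)^2}{\theta_1}+\frac{\alpha_1^2}{\theta_2}\right)\|\rho_0^{-1}y_{obs}\|^2_{L^2(q_T)} .$$ -/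

import Mathlib

open MeasureTheory Set Filter Topology
open scoped ENNReal

noncomputable section

namespace MixedHeat

/-- The space `ℝ^N` with its Euclidean norm. -/
abbrev Sp (N : ℕ) : Type := EuclideanSpace ℝ (Fin N)

/-- Space-time `ℝ^N × ℝ`; points are pairs `(x, t)`. -/
abbrev SpT (N : ℕ) : Type := Sp N × ℝ

/-! ### Classical differential operators -/

/-- Partial derivative in time. -/
def dt {N : ℕ} (y : SpT N → ℝ) (z : SpT N) : ℝ := deriv (fun s => y (z.1, s)) z.2

/-- Gradient in the space variable. -/
def gradx {N : ℕ} (y : SpT N → ℝ) (z : SpT N) : Sp N := gradient (fun x => y (x, z.2)) z.1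

/-- Divergence in the space variable. -/
def divx {N : ℕ} (p : SpT N → Sp N) (z : SpT N) : ℝ :=
  ∑ i, fderiv ℝ (fun x => p (x, z.2)) z.1 (EuclideanSpace.single i 1) i

/-- `θ` is a test function on `S`: smooth, with compact support contained in `S`. -/
def IsTest {E : Type*} [NormedAddCommGroup E] [NormedSpace ℝ E] (S : Set E) (θ : E → ℝ) : Prop :=
  ContDiff ℝ ((⊤ : ℕ∞) : WithTop ℕ∞) θ ∧ HasCompactSupport θ ∧ tsupport θ ⊆ S

/-- `u ∈ H¹₀(Ω)` with gradient `v`: the pair `(u, v)` is the limit, in `L²(Ω) × L²(Ω)^N`, of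
pairs `(θ, ∇θ)` with `θ` smooth and compactly supported in `Ω`. -/
def IsH10 {N : ℕ} (Ω : Set (Sp N)) (u : Sp N → ℝ) (v : Sp N → Sp N) : Prop :=
  MemLp u 2 (volume.restrict Ω) ∧ MemLp v 2 (volume.restrict Ω) ∧
  ∃ θ : ℕ → Sp N → ℝ, (∀ n, IsTest Ω (θ n)) ∧
    Tendsto (fun n => eLpNorm (fun x => θ n x - u x) 2 (volume.restrict Ω)) atTop (𝓝 0) ∧
    Tendsto (fun n => eLpNorm (fun x => gradient (θ n) x - v x) 2 (volume.restrict Ω))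
      atTop (𝓝 0)

/-! ### The data of the parabolic equation -/

/-- A bounded domain `Ω ⊂ ℝ^N`, a final time `T > 0`, a uniformly elliptic matrix field
`c ∈ C¹(closure Ω)` (matrices being seen as linear maps of `ℝ^N`; no symmetry is assumed),
and a potential `d ∈ L^∞(Q_T)`. -/
structure ParabolicData (N : ℕ) where
  Ω : Set (Sp N)
  isOpen : IsOpen Ω
  isConnected : IsConnected Ω
  isBounded : Bornology.IsBounded Ω
  T : ℝ
  T_pos : 0 < T
  c : Sp N → Sp N →L[ℝ] Sp N
  c_contDiffOn : ContDiffOn ℝ 1 c (closure Ω)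
  c_elliptic : ∃ c₀ : ℝ, 0 < c₀ ∧ ∀ x ∈ closure Ω, ∀ ξ : Sp N, c₀ * ‖ξ‖ ^ 2 ≤ inner ℝ (c x ξ) ξ
  d : SpT N → ℝ
  d_memLp : MemLp d ⊤ (volume.restrict (Ω ×ˢ Ioo 0 T))

namespace ParabolicData

variable {N : ℕ} (P : ParabolicData N)

/-- The cylinder `Q_T = Ω × (0, T)`. -/
def Q : Set (SpT N) := P.Ω ×ˢ Ioo 0 P.T

/-- Lebesgue measure on `Q_T`. -/
def μQ : Measure (SpT N) := volume.restrict P.Q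

/-- `L²(Q_T)`. -/
abbrev L2 : Type := Lp ℝ 2 P.μQ

/-- `L²(Q_T)^N`. -/
abbrev L2v : Type := Lp (Sp N) 2 P.μQ

/-- `I(y, p) = y_t - div p + d y` for classical `(y, p)`. -/
def opI (y : SpT N → ℝ) (p : SpT N → Sp N) (z : SpT N) : ℝ := dt y z - divx p z + P.d z * y z

/-- `J(y, p) = c ∇y - p` for classical `(y, p)`. -/
def opJ (y : SpT N → ℝ) (p : SpT N → Sp N) (z : SpT N) : Sp N := P.c z.1 (gradx y z) - p z

/-- `𝓤₀`: pairs `(y, p)` of class `C¹` on the closed cylinder with `y = 0` on `∂Ω × (0, T)`.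
(The values outside the closed cylinder are irrelevant: see `preCore` below.) -/
def smoothPairs : Submodule ℝ ((SpT N → ℝ) × (SpT N → Sp N)) where
  carrier := {u | ContDiffOn ℝ 1 u.1 (closure P.Q) ∧ ContDiffOn ℝ 1 u.2 (closure P.Q) ∧
    ∀ x ∈ frontier P.Ω, ∀ t ∈ Ioo 0 P.T, u.1 (x, t) = 0}
  add_mem' := by
    rintro u v ⟨h1, h2, h3⟩ ⟨k1, k2, k3⟩
    refine ⟨h1.add k1, h2.add k2, fun x hx t ht => ?_⟩
    simp [h3 x hx t ht, k3 x hx t ht]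
  zero_mem' := ⟨contDiffOn_const, contDiffOn_const, fun _ _ _ _ => rfl⟩
  smul_mem' := by
    rintro r u ⟨h1, h2, h3⟩
    refine ⟨contDiffOn_const.smul h1, contDiffOn_const.smul h2, fun x hx t ht => ?_⟩
    simp [h3 x hx t ht]

/-! ### Dual variables -/

/-- `φ ∈ L²(0,T; H¹₀(Ω))` with `∇φ = q`, for `φ ∈ L²(Q_T)` and `q ∈ L²(Q_T)^N`. -/
def HasGradient (φ : P.L2) (q : P.L2v) : Prop :=
  ∀ᵐ t ∂(volume.restrict (Ioo 0 P.T)), IsH10 P.Ω (fun x => φ (x, t)) (fun x => q (x, t))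

/-- `φ ∈ C⁰([0,T]; L²(Ω))` and `φ(·, T) = 0`: some curve `Φ` in `L²(Ω)`, continuous on `[0, T]`
and zero at `T`, coincides with `φ`. -/
def IsContinuousVanishingAtEnd (φ : P.L2) : Prop :=
  ∃ Φ : ℝ → Lp ℝ 2 (volume.restrict P.Ω), ContinuousOn Φ (Icc 0 P.T) ∧ Φ P.T = 0 ∧
    ∀ᵐ t ∂(volume.restrict (Ioo 0 P.T)), (fun x => φ (x, t)) =ᵐ[volume.restrict P.Ω] Φ t

/-- `I*(φ, σ) = -φ_t - div σ + d φ = g` in the sense of distributions on `Q_T`. -/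
def HasIstar (φ : P.L2) (σ : P.L2v) (g : P.L2) : Prop :=
  ∀ θ : SpT N → ℝ, IsTest P.Q θ →
    ∫ z, (φ z * dt θ z + inner ℝ (σ z) (gradx θ z) + P.d z * φ z * θ z) ∂P.μQ
      = ∫ z, g z * θ z ∂P.μQ

end ParabolicData

/-! ### Weights -/

/-- The class `𝓡` of weights for the lower bound `ρs > 0`. -/
def IsWeight {N : ℕ} (P : ParabolicData N) (ρs : ℝ) (w : SpT N → ℝ) : Prop :=
  ContinuousOn w P.Q ∧ (0 < ρs ∧ ∀ z ∈ P.Q, ρs ≤ w z) ∧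
    ∀ δ : ℝ, 0 < δ → MemLp w ⊤ (volume.restrict (P.Ω ×ˢ Ioo δ P.T))

/-- A nonempty open observation set `ω ⊂ Ω`, weights `ρ₀ ∈ 𝓡` and `ρ, ρ₁ ∈ 𝓡 ∩ L^∞(Q_T)`, and
positive parameters `η₁, η₂`. -/
structure ObsData {N : ℕ} (P : ParabolicData N) (ρs : ℝ) where
  ω : Set (Sp N)
  ω_open : IsOpen ω
  ω_nonempty : ω.Nonempty
  ω_subset : ω ⊆ P.Ω
  ρ₀ : SpT N → ℝ
  ρ : SpT N → ℝ
  ρ₁ : SpT N → ℝ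
  isWeight₀ : IsWeight P ρs ρ₀
  isWeight : IsWeight P ρs ρ
  isWeight₁ : IsWeight P ρs ρ₁
  bounded : MemLp ρ ⊤ P.μQ
  bounded₁ : MemLp ρ₁ ⊤ P.μQ
  η₁ : ℝ
  η₂ : ℝ
  η₁_pos : 0 < η₁
  η₂_pos : 0 < η₂

/-! ### Integrability of the classical objects -/

section aux

variable {N : ℕ} (P : ParabolicData N)

lemma Q_open : IsOpen P.Q := P.isOpen.prod isOpen_Ioo

lemma Q_bounded : Bornology.IsBounded P.Q := P.isBounded.prod (Metric.isBounded_Ioo 0 P.T)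

instance : IsFiniteMeasure P.μQ :=
  ⟨by rw [ParabolicData.μQ, Measure.restrict_apply_univ]; exact (Q_bounded P).measure_lt_top⟩

lemma memLp_of_bdd {F : Type*} [NormedAddCommGroup F] [SecondCountableTopology F]
    {f : SpT N → F} {p : ℝ≥0∞} (hf : ContinuousOn f P.Q) (C : ℝ) (hC : ∀ z ∈ P.Q, ‖f z‖ ≤ C) :
    MemLp f p P.μQ := by
  borelize F
  refine MemLp.of_bound (hf.aestronglyMeasurable (Q_open P).measurableSet) C ?_
  exact (ae_restrict_iff' (Q_open P).measurableSet).2 (Eventually.of_forall hC)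

lemma fderiv_bdd {F : Type*} [NormedAddCommGroup F] [NormedSpace ℝ F]
    {f : SpT N → F} (hf : ContDiffOn ℝ 1 f (closure P.Q)) :
    ∃ C : ℝ, ∀ z ∈ P.Q, ‖fderiv ℝ f z‖ ≤ C := by
  have hcomp : IsCompact (closure P.Q) := (Q_bounded P).isCompact_closure
  have key : ∀ S : Set (SpT N), S ⊆ closure P.Q → IsCompact S →
      ∃ V ∈ 𝓝ˢ S, ∃ C : ℝ, ∀ z ∈ V ∩ P.Q, ‖fderiv ℝ f z‖ ≤ C := by
    intro S hS hSc
    have hloc : ∀ x ∈ S, ∃ V : Set (SpT N), IsOpen V ∧ x ∈ V ∧ ∃ C : ℝ,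
        ∀ z ∈ V ∩ P.Q, ‖fderiv ℝ f z‖ ≤ C := by
      intro x hx
      have h0 : ContDiffWithinAt ℝ (0 + 1) f (closure P.Q) x := by simpa using hf x (hS hx)
      obtain ⟨u, hu, -, f', hf', hc⟩ :=
        (contDiffWithinAt_succ_iff_hasFDerivWithinAt (by simp)).1 h0
      rw [insert_eq_of_mem (hS hx)] at hu
      have hxu : x ∈ u := mem_of_mem_nhdsWithin (hS hx) hu
      have hcont := hc.continuousWithinAt
      have hb : ∀ᶠ z in 𝓝[u] x, ‖f' z‖ < ‖f' x‖ + 1 :=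
        hcont.norm.eventually_lt_const (by linarith)
      obtain ⟨V1, hV1o, hxV1, hV1⟩ := mem_nhdsWithin.1 hu
      obtain ⟨V2, hV2o, hxV2, hV2⟩ := mem_nhdsWithin.1 hb
      refine ⟨V1 ∩ V2, hV1o.inter hV2o, ⟨hxV1, hxV2⟩, ‖f' x‖ + 1, ?_⟩
      rintro z ⟨⟨hz1, hz2⟩, hzQ⟩
      have hzu : z ∈ u := hV1 ⟨hz1, subset_closure hzQ⟩
      have hun : u ∈ 𝓝 z := by
        refine mem_of_superset ((hV1o.inter (Q_open P)).mem_nhds ⟨hz1, hzQ⟩) ?_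
        exact fun w hw => hV1 ⟨hw.1, subset_closure hw.2⟩
      rw [((hf' z hzu).hasFDerivAt hun).fderiv]
      exact (hV2 ⟨hz2, hzu⟩ : ‖f' z‖ < ‖f' x‖ + 1).le
    choose! V hVo hxV C hC using hloc
    obtain ⟨t, htS, ht⟩ := hSc.elim_nhds_subcover V (fun x hx => (hVo x hx).mem_nhds (hxV x hx))
    refine ⟨⋃ x ∈ t, V x, ?_, ∑ x ∈ t, |C x|, ?_⟩
    · exact (isOpen_biUnion fun x hx => hVo x (htS x hx)).mem_nhdsSet.2 ht
    · rintro z ⟨hz, hzQ⟩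
      simp only [mem_iUnion] at hz
      obtain ⟨x, hx, hzx⟩ := hz
      refine (hC x (htS x hx) z ⟨hzx, hzQ⟩).trans ((le_abs_self _).trans ?_)
      exact Finset.single_le_sum (f := fun x => |C x|) (fun _ _ => abs_nonneg _) hx
  obtain ⟨V, hV, C, hC⟩ := key _ subset_rfl hcomp
  exact ⟨C, fun z hz => hC z ⟨subset_of_mem_nhdsSet hV (subset_closure hz), hz⟩⟩

variable {P}

lemma memLp_C1 {F : Type*} [NormedAddCommGroup F] [NormedSpace ℝ F] [SecondCountableTopology F]
    {f : SpT N → F} {p : ℝ≥0∞} (hf : ContDiffOn ℝ 1 f (closure P.Q)) : MemLp f p P.μQ := by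
  obtain ⟨C, hC⟩ := ((Q_bounded P).isCompact_closure).exists_bound_of_continuousOn hf.continuousOn
  exact memLp_of_bdd P (hf.continuousOn.mono subset_closure) C
    fun z hz => hC z (subset_closure hz)

lemma memLp_fderiv {F : Type*} [NormedAddCommGroup F] [NormedSpace ℝ F] [FiniteDimensional ℝ F]
    {f : SpT N → F} {p : ℝ≥0∞} (hf : ContDiffOn ℝ 1 f (closure P.Q)) :
    MemLp (fderiv ℝ f) p P.μQ := by
  obtain ⟨C, hC⟩ := fderiv_bdd P hf
  have := FiniteDimensional.proper ℝ (SpT N →L[ℝ] F)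
  exact memLp_of_bdd P
    ((hf.mono subset_closure).continuousOn_fderiv_of_isOpen (Q_open P) le_rfl) C hC

lemma diffAt {F : Type*} [NormedAddCommGroup F] [NormedSpace ℝ F]
    {f : SpT N → F} (hf : ContDiffOn ℝ 1 f (closure P.Q)) {z : SpT N} (hz : z ∈ P.Q) :
    DifferentiableAt ℝ f z :=
  ((hf.mono subset_closure).contDiffAt ((Q_open P).mem_nhds hz)).differentiableAt (by simp)

lemma dt_eq {f : SpT N → ℝ} {z : SpT N} (hf : DifferentiableAt ℝ f z) :
    dt f z = fderiv ℝ f z (0, 1) := by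
  have h : HasFDerivAt f (fderiv ℝ f z) (z.1, z.2) := hf.hasFDerivAt
  have h2 := h.comp_hasDerivAt z.2 ((hasDerivAt_const z.2 z.1).prodMk (hasDerivAt_id z.2))
  exact h2.deriv

lemma slice_fderiv {F : Type*} [NormedAddCommGroup F] [NormedSpace ℝ F] {f : SpT N → F}
    {z : SpT N} (hf : DifferentiableAt ℝ f z) :
    HasFDerivAt (fun x => f (x, z.2)) ((fderiv ℝ f z).comp (ContinuousLinearMap.inl ℝ _ _)) z.1 := by
  have h : HasFDerivAt f (fderiv ℝ f z) (z.1, z.2) := hf.hasFDerivAt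
  exact h.comp z.1 (hasFDerivAt_prodMk_left z.1 z.2)

lemma gradx_eq {f : SpT N → ℝ} {z : SpT N} (hf : DifferentiableAt ℝ f z) :
    gradx f z = (InnerProductSpace.toDual ℝ (Sp N)).symm
      ((fderiv ℝ f z).comp (ContinuousLinearMap.inl ℝ _ _)) := by
  rw [gradx, gradient, (slice_fderiv hf).fderiv]

lemma divx_eq {f : SpT N → Sp N} {z : SpT N} (hf : DifferentiableAt ℝ f z) :
    divx f z = ∑ i, fderiv ℝ f z (EuclideanSpace.single i 1, 0) i := by
  rw [divx, (slice_fderiv hf).fderiv]; rfl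

lemma ae_Q {p : SpT N → Prop} (h : ∀ z ∈ P.Q, p z) : ∀ᵐ z ∂P.μQ, p z :=
  (ae_restrict_iff' (Q_open P).measurableSet).2 (Eventually.of_forall h)

lemma memLp_dt {y : SpT N → ℝ} (hy : ContDiffOn ℝ 1 y (closure P.Q)) :
    MemLp (dt y) 2 P.μQ :=
  (memLp_congr_ae (ae_Q fun z hz => dt_eq (diffAt hy hz))).2
    ((ContinuousLinearMap.apply ℝ ℝ ((0, 1) : SpT N)).comp_memLp' (memLp_fderiv hy))

lemma memLp_gradx {y : SpT N → ℝ} (hy : ContDiffOn ℝ 1 y (closure P.Q)) :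
    MemLp (gradx y) 2 P.μQ := by
  refine (memLp_congr_ae (ae_Q fun z hz => gradx_eq (diffAt hy hz))).2 ?_
  have h0 := (ContinuousLinearMap.compL ℝ (Sp N) (SpT N) ℝ |>.flip
    (ContinuousLinearMap.inl ℝ _ _)).comp_memLp' (memLp_fderiv (p := 2) hy)
  refine MemLp.of_le h0
    ((InnerProductSpace.toDual ℝ (Sp N)).symm.continuous.comp_aestronglyMeasurable h0.1)
    (Eventually.of_forall fun _ => ?_)
  exact ((InnerProductSpace.toDual ℝ (Sp N)).symm.norm_map _).le

lemma memLp_opI {y : SpT N → ℝ} {p : SpT N → Sp N} (hy : ContDiffOn ℝ 1 y (closure P.Q))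
    (hp : ContDiffOn ℝ 1 p (closure P.Q)) : MemLp (P.opI y p) 2 P.μQ := by
  have h1 := memLp_dt hy
  have h2 : MemLp (divx p) 2 P.μQ := by
    refine (memLp_congr_ae (ae_Q fun z hz => divx_eq (diffAt hp hz))).2 ?_
    refine memLp_finsetSum _ fun i _ => ?_
    exact ((EuclideanSpace.proj i : Sp N →L[ℝ] ℝ).comp (ContinuousLinearMap.apply ℝ (Sp N)
      ((EuclideanSpace.single i 1, 0) : SpT N))).comp_memLp' (memLp_fderiv hp)
  have h3 : MemLp (fun z => P.d z * y z) 2 P.μQ := (memLp_C1 (p := 2) hy).mul P.d_memLp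
  exact (h1.sub h2).add h3

lemma memLp_opJ {y : SpT N → ℝ} {p : SpT N → Sp N} (hy : ContDiffOn ℝ 1 y (closure P.Q))
    (hp : ContDiffOn ℝ 1 p (closure P.Q)) : MemLp (P.opJ y p) 2 P.μQ := by
  have h1 := memLp_gradx hy
  obtain ⟨C, hC⟩ := P.isBounded.isCompact_closure.exists_bound_of_continuousOn
    P.c_contDiffOn.continuousOn
  have hcm : AEStronglyMeasurable (fun z : SpT N => P.c z.1) P.μQ := by
    have := FiniteDimensional.proper ℝ (Sp N →L[ℝ] Sp N)
    refine ContinuousOn.aestronglyMeasurable ?_ (Q_open P).measurableSet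
    exact P.c_contDiffOn.continuousOn.comp continuous_fst.continuousOn
      fun z hz => subset_closure hz.1
  have h2 : MemLp (fun z => P.c z.1 (gradx y z)) 2 P.μQ := by
    refine MemLp.of_le_mul (c := C) h1 ?_ (ae_Q fun z hz => ?_)
    · exact (ContinuousLinearMap.id ℝ (Sp N →L[ℝ] Sp N)).aestronglyMeasurable_comp₂ hcm h1.1
    · exact (P.c z.1).le_of_opNorm_le (hC z.1 (subset_closure hz.1)) _
  exact h2.sub (memLp_C1 hp)

lemma opI_add {u v : (SpT N → ℝ) × (SpT N → Sp N)} (hu : u ∈ P.smoothPairs)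
    (hv : v ∈ P.smoothPairs) {z : SpT N} (hz : z ∈ P.Q) :
    P.opI (u + v).1 (u + v).2 z = P.opI u.1 u.2 z + P.opI v.1 v.2 z := by
  have a1 := diffAt hu.1 hz
  have a2 := diffAt hu.2.1 hz
  have b1 := diffAt hv.1 hz
  have b2 := diffAt hv.2.1 hz
  simp only [ParabolicData.opI, Prod.fst_add, Prod.snd_add]
  rw [dt_eq a1, dt_eq b1, dt_eq (a1.add b1), divx_eq a2, divx_eq b2, divx_eq (a2.add b2),
    fderiv_add a1 b1, fderiv_add a2 b2]
  simp [Finset.sum_add_distrib]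
  ring

lemma opI_smul (r : ℝ) {u : (SpT N → ℝ) × (SpT N → Sp N)} (hu : u ∈ P.smoothPairs)
    {z : SpT N} (hz : z ∈ P.Q) :
    P.opI (r • u).1 (r • u).2 z = r * P.opI u.1 u.2 z := by
  have a1 := diffAt hu.1 hz
  have a2 := diffAt hu.2.1 hz
  simp only [ParabolicData.opI, Prod.smul_fst, Prod.smul_snd]
  rw [dt_eq a1, dt_eq (a1.const_smul r), divx_eq a2, divx_eq (a2.const_smul r),
    fderiv_const_smul a1, fderiv_const_smul a2]
  simp [← Finset.mul_sum]
  ring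

lemma opJ_add {u v : (SpT N → ℝ) × (SpT N → Sp N)} (hu : u ∈ P.smoothPairs)
    (hv : v ∈ P.smoothPairs) {z : SpT N} (hz : z ∈ P.Q) :
    P.opJ (u + v).1 (u + v).2 z = P.opJ u.1 u.2 z + P.opJ v.1 v.2 z := by
  have a1 := diffAt hu.1 hz
  have b1 := diffAt hv.1 hz
  simp only [ParabolicData.opJ, Prod.fst_add, Prod.snd_add]
  rw [gradx_eq a1, gradx_eq b1, gradx_eq (a1.add b1), fderiv_add a1 b1]
  simp only [ContinuousLinearMap.add_comp, map_add, Pi.add_apply]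
  abel

lemma opJ_smul (r : ℝ) {u : (SpT N → ℝ) × (SpT N → Sp N)} (hu : u ∈ P.smoothPairs)
    {z : SpT N} (hz : z ∈ P.Q) :
    P.opJ (r • u).1 (r • u).2 z = r • P.opJ u.1 u.2 z := by
  have a1 := diffAt hu.1 hz
  simp only [ParabolicData.opJ, Prod.smul_fst, Prod.smul_snd]
  rw [gradx_eq a1, gradx_eq (a1.const_smul r), fderiv_const_smul a1]
  simp [smul_sub]

lemma memLp_inv_weight {ρs : ℝ} {w : SpT N → ℝ} (hw : IsWeight P ρs w) :
    MemLp (fun z => (w z)⁻¹) ⊤ P.μQ := by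
  have hpos : ∀ z ∈ P.Q, 0 < w z := fun z hz => hw.2.1.1.trans_le (hw.2.1.2 z hz)
  refine memLp_of_bdd P (hw.1.inv₀ fun z hz => (hpos z hz).ne') ρs⁻¹ fun z hz => ?_
  rw [norm_inv, Real.norm_of_nonneg (hpos z hz).le]
  exact inv_anti₀ hw.2.1.1 (hw.2.1.2 z hz)

end aux

/-! ### The space `𝓤` -/

namespace ObsData

variable {N : ℕ} {P : ParabolicData N} {ρs : ℝ} (W : ObsData P ρs)

/-- The observation cylinder `q_T = ω × (0, T)`. -/
def q : Set (SpT N) := W.ω ×ˢ Ioo 0 P.T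

/-- Lebesgue measure on `q_T`. -/
def μq : Measure (SpT N) := volume.restrict W.q

/-- `L²(q_T)`. -/
abbrev L2q : Type := Lp ℝ 2 W.μq

lemma μq_le : W.μq ≤ P.μQ := Measure.restrict_mono (prod_mono W.ω_subset subset_rfl) le_rfl

/-- The vector space `𝓤₀`, to be equipped with the scalar product given by `W`. -/
def PreU (_ : ObsData P ρs) : Type := P.smoothPairs

instance : AddCommGroup W.PreU := inferInstanceAs (AddCommGroup P.smoothPairs)

instance : Module ℝ W.PreU := inferInstanceAs (Module ℝ P.smoothPairs)

/-- `(y, p) ↦ ρ₀⁻¹ y` in `L²(q_T)`, for `(y, p) ∈ 𝓤₀`. -/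
def obs₀ : W.PreU →ₗ[ℝ] W.L2q where
  toFun u := MemLp.toLp (fun z => (W.ρ₀ z)⁻¹ * u.1.1 z)
    (((memLp_C1 (p := 2) u.2.1).mul (memLp_inv_weight W.isWeight₀)).mono_measure W.μq_le)
  map_add' u v := by
    rw [← MemLp.toLp_add]
    exact MemLp.toLp_congr _ _ (Eventually.of_forall fun z => mul_add _ (u.1.1 z) (v.1.1 z))
  map_smul' r u := by
    rw [RingHom.id_apply, ← MemLp.toLp_const_smul]
    exact MemLp.toLp_congr _ _
      (Eventually.of_forall fun z => mul_left_comm (W.ρ₀ z)⁻¹ r (u.1.1 z))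

/-- `(y, p) ↦ ρ₁⁻¹ J(y, p)` in `L²(Q_T)^N`, for `(y, p) ∈ 𝓤₀`. -/
def resJ₀ : W.PreU →ₗ[ℝ] P.L2v where
  toFun u := MemLp.toLp (fun z => (W.ρ₁ z)⁻¹ • P.opJ u.1.1 u.1.2 z)
    ((memLp_opJ u.2.1 u.2.2.1).smul (memLp_inv_weight W.isWeight₁))
  map_add' u v := by
    rw [← MemLp.toLp_add]
    refine MemLp.toLp_congr _ _ (ae_Q fun z hz => ?_)
    exact (congrArg _ (opJ_add u.2 v.2 hz)).trans (smul_add _ _ _)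
  map_smul' r u := by
    rw [RingHom.id_apply, ← MemLp.toLp_const_smul]
    refine MemLp.toLp_congr _ _ (ae_Q fun z hz => ?_)
    exact (congrArg _ (opJ_smul r u.2 hz)).trans (smul_comm _ _ _)

/-- `(y, p) ↦ ρ⁻¹ I(y, p)` in `L²(Q_T)`, for `(y, p) ∈ 𝓤₀`. -/
def resI₀ : W.PreU →ₗ[ℝ] P.L2 where
  toFun u := MemLp.toLp (fun z => (W.ρ z)⁻¹ * P.opI u.1.1 u.1.2 z)
    ((memLp_opI u.2.1 u.2.2.1).mul (memLp_inv_weight W.isWeight))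
  map_add' u v := by
    rw [← MemLp.toLp_add]
    refine MemLp.toLp_congr _ _ (ae_Q fun z hz => ?_)
    exact (congrArg _ (opI_add u.2 v.2 hz)).trans (mul_add _ _ _)
  map_smul' r u := by
    rw [RingHom.id_apply, ← MemLp.toLp_const_smul]
    refine MemLp.toLp_congr _ _ (ae_Q fun z hz => ?_)
    exact (congrArg _ (opI_smul r u.2 hz)).trans (mul_left_comm _ _ _)

/-- The scalar product of `𝓤₀`:
`∬_{q_T} ρ₀⁻² y ȳ + η₁ ∬_{Q_T} ρ₁⁻² J(y, p)·J(ȳ, p̄) + η₂ ∬_{Q_T} ρ⁻² I(y, p) I(ȳ, p̄)`. -/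
@[reducible] def preCore : PreInnerProductSpace.Core ℝ W.PreU where
  inner u v := inner ℝ (W.obs₀ u) (W.obs₀ v) + W.η₁ * inner ℝ (W.resJ₀ u) (W.resJ₀ v)
    + W.η₂ * inner ℝ (W.resI₀ u) (W.resI₀ v)
  conj_inner_symm u v := by
    simp [real_inner_comm]
  re_inner_nonneg u := by
    have h1 := W.η₁_pos.le
    have h2 := W.η₂_pos.le
    simp only [real_inner_self_eq_norm_sq, RCLike.re_to_real]
    positivity
  add_left u v w := by
    simp only [map_add, inner_add_left]
    ring
  smul_left u v r := by
    simp only [map_smul, inner_smul_left, RCLike.conj_to_real]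
    ring

instance : SeminormedAddCommGroup W.PreU :=
  @InnerProductSpace.Core.toSeminormedAddCommGroup ℝ W.PreU _ _ _ W.preCore

instance : InnerProductSpace ℝ W.PreU := InnerProductSpace.ofCore W.preCore

/-- `𝓤`: the (Hausdorff) completion of `𝓤₀` for its scalar product, a Hilbert space. -/
abbrev U : Type := UniformSpace.Completion W.PreU

lemma norm_sq_preU (u : W.PreU) :
    ‖u‖ ^ 2 = ‖W.obs₀ u‖ ^ 2 + W.η₁ * ‖W.resJ₀ u‖ ^ 2 + W.η₂ * ‖W.resI₀ u‖ ^ 2 := by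
  rw [← real_inner_self_eq_norm_sq u, ← real_inner_self_eq_norm_sq (W.obs₀ u),
    ← real_inner_self_eq_norm_sq (W.resJ₀ u), ← real_inner_self_eq_norm_sq (W.resI₀ u)]
  rfl

/-- `u ↦ ρ₀⁻¹ y` on `𝓤`, extended from `𝓤₀` by continuity. -/
def obs : W.U →L[ℝ] W.L2q :=
  W.obs₀.extendOfNorm (UniformSpace.Completion.toComplₗᵢ (𝕜 := ℝ) (E := W.PreU)).toLinearMap

/-- `u ↦ ρ₁⁻¹ J(y, p)` on `𝓤`, extended from `𝓤₀` by continuity. -/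
def resJ : W.U →L[ℝ] P.L2v :=
  W.resJ₀.extendOfNorm (UniformSpace.Completion.toComplₗᵢ (𝕜 := ℝ) (E := W.PreU)).toLinearMap

/-- `u ↦ ρ⁻¹ I(y, p)` on `𝓤`, extended from `𝓤₀` by continuity. -/
def resI : W.U →L[ℝ] P.L2 :=
  W.resI₀.extendOfNorm (UniformSpace.Completion.toComplₗᵢ (𝕜 := ℝ) (E := W.PreU)).toLinearMap

/-- The three extensions do extend the classical expressions. -/
lemma extensions_coe (u : W.PreU) :
    W.obs (u : W.U) = W.obs₀ u ∧ W.resJ (u : W.U) = W.resJ₀ u ∧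
      W.resI (u : W.U) = W.resI₀ u := by
  have hd : DenseRange
      (UniformSpace.Completion.toComplₗᵢ (𝕜 := ℝ) (E := W.PreU)).toLinearMap :=
    UniformSpace.Completion.denseRange_coe
  have hn : ∀ v : W.PreU,
      ‖(UniformSpace.Completion.toComplₗᵢ (𝕜 := ℝ) (E := W.PreU)).toLinearMap v‖ = ‖v‖ :=
    fun v => UniformSpace.Completion.norm_coe v
  have h1 := W.η₁_pos
  have h2 := W.η₂_pos
  refine ⟨LinearMap.extendOfNorm_eq hd ⟨1, fun v => ?_⟩ u,
    LinearMap.extendOfNorm_eq hd ⟨√(W.η₁⁻¹), fun v => ?_⟩ u,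
    LinearMap.extendOfNorm_eq hd ⟨√(W.η₂⁻¹), fun v => ?_⟩ u⟩
  · rw [hn, one_mul]
    refine (sq_le_sq₀ (norm_nonneg _) (norm_nonneg _)).1 ?_
    rw [norm_sq_preU]
    have := mul_nonneg h1.le (sq_nonneg ‖W.resJ₀ v‖)
    have := mul_nonneg h2.le (sq_nonneg ‖W.resI₀ v‖)
    linarith
  · rw [hn]
    refine (sq_le_sq₀ (norm_nonneg _) (by positivity)).1 ?_
    rw [mul_pow, Real.sq_sqrt (by positivity), norm_sq_preU, ← div_eq_inv_mul, le_div_iff₀ h1]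
    have := mul_nonneg h2.le (sq_nonneg ‖W.resI₀ v‖)
    nlinarith [sq_nonneg ‖W.obs₀ v‖]
  · rw [hn]
    refine (sq_le_sq₀ (norm_nonneg _) (by positivity)).1 ?_
    rw [mul_pow, Real.sq_sqrt (by positivity), norm_sq_preU, ← div_eq_inv_mul, le_div_iff₀ h2]
    have := mul_nonneg h1.le (sq_nonneg ‖W.resJ₀ v‖)
    nlinarith [sq_nonneg ‖W.obs₀ v‖]

end ObsData

/-! ### Linearity of the notions that define `Ψ` -/

section aux2

variable {N : ℕ} {P : ParabolicData N}

lemma ae_slice {p : SpT N → Prop} (h : ∀ᵐ z ∂P.μQ, p z) :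
    ∀ᵐ t ∂(volume.restrict (Ioo 0 P.T)), ∀ᵐ x ∂(volume.restrict P.Ω), p (x, t) := by
  rw [ParabolicData.μQ, ParabolicData.Q, Measure.volume_eq_prod, ← Measure.prod_restrict] at h
  have h2 := (Measure.measurePreserving_swap (μ := volume.restrict (Ioo 0 P.T))
    (ν := volume.restrict P.Ω)).quasiMeasurePreserving.ae h
  exact Measure.ae_ae_of_ae_prod h2

lemma IsTest.contDiffOn {E : Type*} [NormedAddCommGroup E] [NormedSpace ℝ E] {S A : Set E}
    {θ : E → ℝ} (h : IsTest S θ) : ContDiffOn ℝ 1 θ A :=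
  (h.1.of_le (by exact_mod_cast le_top)).contDiffOn

lemma IsTest.gradient_continuous {S : Set (Sp N)} {θ : Sp N → ℝ} (h : IsTest S θ) :
    Continuous (gradient θ) :=
  (InnerProductSpace.toDual ℝ (Sp N)).symm.continuous.comp
    (h.1.continuous_fderiv (by simp))

lemma IsTest.differentiable {E : Type*} [NormedAddCommGroup E] [NormedSpace ℝ E] {S : Set E}
    {θ : E → ℝ} (h : IsTest S θ) : Differentiable ℝ θ := h.1.differentiable (by simp)

lemma IsTest.add {E : Type*} [NormedAddCommGroup E] [NormedSpace ℝ E] {S : Set E}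
    {θ θ' : E → ℝ} (h : IsTest S θ) (h' : IsTest S θ') : IsTest S (θ + θ') :=
  ⟨h.1.add h'.1, h.2.1.add h'.2.1,
    (tsupport_add θ θ').trans (union_subset h.2.2 h'.2.2)⟩

lemma IsTest.smul {E : Type*} [NormedAddCommGroup E] [NormedSpace ℝ E] {S : Set E}
    {θ : E → ℝ} (r : ℝ) (h : IsTest S θ) : IsTest S (r • θ) :=
  ⟨contDiff_const.smul h.1, h.2.1.smul_left,
    (tsupport_smul_subset_right (fun _ => r) θ).trans h.2.2⟩

lemma IsH10.congr {Ω : Set (Sp N)} {u u' : Sp N → ℝ} {v v' : Sp N → Sp N} (h : IsH10 Ω u v)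
    (hu : u =ᵐ[volume.restrict Ω] u') (hv : v =ᵐ[volume.restrict Ω] v') : IsH10 Ω u' v' := by
  obtain ⟨h1, h2, θ, hθ, h3, h4⟩ := h
  refine ⟨(memLp_congr_ae hu).1 h1, (memLp_congr_ae hv).1 h2, θ, hθ, ?_, ?_⟩
  · refine h3.congr fun n => eLpNorm_congr_ae ?_
    filter_upwards [hu] with x hx
    rw [hx]
  · refine h4.congr fun n => eLpNorm_congr_ae ?_
    filter_upwards [hv] with x hx
    rw [hx]

lemma IsH10.add {Ω : Set (Sp N)} {u u' : Sp N → ℝ} {v v' : Sp N → Sp N} (h : IsH10 Ω u v)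
    (h' : IsH10 Ω u' v') : IsH10 Ω (u + u') (v + v') := by
  obtain ⟨h1, h2, θ, hθ, h3, h4⟩ := h
  obtain ⟨h1', h2', θ', hθ', h3', h4'⟩ := h'
  refine ⟨h1.add h1', h2.add h2', fun n => θ n + θ' n, fun n => (hθ n).add (hθ' n), ?_, ?_⟩
  · refine tendsto_of_tendsto_of_tendsto_of_le_of_le tendsto_const_nhds
      (by simpa using h3.add h3') (fun _ => bot_le) fun n => ?_
    refine le_trans (le_of_eq (congrArg (fun f => eLpNorm f 2 _) ?_)) (eLpNorm_add_le
      ((hθ n).1.continuous.aestronglyMeasurable.sub h1.1)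
      ((hθ' n).1.continuous.aestronglyMeasurable.sub h1'.1) (by norm_num))
    ext x
    simp only [Pi.add_apply]
    ring
  · refine tendsto_of_tendsto_of_tendsto_of_le_of_le tendsto_const_nhds
      (by simpa using h4.add h4') (fun _ => bot_le) fun n => ?_
    refine le_trans (le_of_eq (congrArg (fun f => eLpNorm f 2 _) ?_)) (eLpNorm_add_le
      ((hθ n).gradient_continuous.aestronglyMeasurable.sub h2.1)
      ((hθ' n).gradient_continuous.aestronglyMeasurable.sub h2'.1) (by norm_num))
    ext1 x
    simp only [Pi.add_apply, gradient,
      fderiv_add ((hθ n).differentiable x) ((hθ' n).differentiable x), map_add]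
    abel

lemma IsH10.smul {Ω : Set (Sp N)} {u : Sp N → ℝ} {v : Sp N → Sp N} (r : ℝ) (h : IsH10 Ω u v) :
    IsH10 Ω (r • u) (r • v) := by
  obtain ⟨h1, h2, θ, hθ, h3, h4⟩ := h
  refine ⟨h1.const_smul r, h2.const_smul r, fun n => r • θ n, fun n => (hθ n).smul r, ?_, ?_⟩
  · have h5 := ENNReal.Tendsto.const_mul (a := ‖r‖ₑ) h3 (Or.inr (by simp))
    rw [mul_zero] at h5
    refine h5.congr fun n => ?_
    rw [← eLpNorm_const_smul]
    congr 1
    ext x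
    simp [mul_sub]
  · have h5 := ENNReal.Tendsto.const_mul (a := ‖r‖ₑ) h4 (Or.inr (by simp))
    rw [mul_zero] at h5
    refine h5.congr fun n => ?_
    rw [← eLpNorm_const_smul]
    congr 1
    ext1 x
    simp only [Pi.smul_apply, gradient, fderiv_const_smul ((hθ n).differentiable x), smul_sub,
      map_smulₛₗ]
    rfl

lemma HasGradient.add {φ φ' : P.L2} {q q' : P.L2v} (h : P.HasGradient φ q)
    (h' : P.HasGradient φ' q') : P.HasGradient (φ + φ') (q + q') := by
  filter_upwards [h, h', ae_slice (Lp.coeFn_add φ φ'), ae_slice (Lp.coeFn_add q q')]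
    with t h1 h2 h3 h4
  exact (h1.add h2).congr (h3.mono fun _ h => h.symm) (h4.mono fun _ h => h.symm)

lemma HasGradient.smul {φ : P.L2} {q : P.L2v} (r : ℝ) (h : P.HasGradient φ q) :
    P.HasGradient (r • φ) (r • q) := by
  filter_upwards [h, ae_slice (Lp.coeFn_smul r φ), ae_slice (Lp.coeFn_smul r q)] with t h1 h3 h4
  exact (h1.smul r).congr (h3.mono fun _ h => h.symm) (h4.mono fun _ h => h.symm)

lemma IsContinuousVanishingAtEnd.add {φ φ' : P.L2} (h : P.IsContinuousVanishingAtEnd φ)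
    (h' : P.IsContinuousVanishingAtEnd φ') : P.IsContinuousVanishingAtEnd (φ + φ') := by
  obtain ⟨Φ, h1, h2, h3⟩ := h
  obtain ⟨Φ', h1', h2', h3'⟩ := h'
  refine ⟨Φ + Φ', h1.add h1', by simp [h2, h2'], ?_⟩
  filter_upwards [h3, h3', ae_slice (Lp.coeFn_add φ φ')] with t k1 k2 k3
  filter_upwards [k1, k2, k3, Lp.coeFn_add (Φ t) (Φ' t)] with x l1 l2 l3 l4
  simp only [Pi.add_apply] at l3 l4 ⊢
  rw [l3, l4, l1, l2]

lemma IsContinuousVanishingAtEnd.smul {φ : P.L2} (r : ℝ) (h : P.IsContinuousVanishingAtEnd φ) :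
    P.IsContinuousVanishingAtEnd (r • φ) := by
  obtain ⟨Φ, h1, h2, h3⟩ := h
  refine ⟨r • Φ, h1.const_smul r, by simp [h2], ?_⟩
  filter_upwards [h3, ae_slice (Lp.coeFn_smul r φ)] with t k1 k3
  filter_upwards [k1, k3, Lp.coeFn_smul r (Φ t)] with x l1 l3 l4
  simp only [Pi.smul_apply] at l3 l4 ⊢
  rw [l3, l4, l1]

lemma integrable_pairing (φ : P.L2) (σ : P.L2v) {θ : SpT N → ℝ} (hθ : IsTest P.Q θ) :
    Integrable (fun z => φ z * dt θ z + inner ℝ (σ z) (gradx θ z) + P.d z * φ z * θ z) P.μQ := by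
  have h1 : Integrable (fun z => φ z * dt θ z) P.μQ :=
    (Lp.memLp φ).integrable_mul (memLp_dt hθ.contDiffOn)
  have h2 : Integrable (fun z => inner ℝ (σ z) (gradx θ z)) P.μQ := by
    have hg := memLp_gradx (P := P) hθ.contDiffOn
    refine (L2.integrable_inner (𝕜 := ℝ) σ (hg.toLp _)).congr ?_
    filter_upwards [hg.coeFn_toLp] with z hz
    rw [hz]
  have h3 : MemLp (fun z => P.d z * φ z) 2 P.μQ := (Lp.memLp φ).mul P.d_memLp
  exact (h1.add h2).add (h3.integrable_mul (memLp_C1 (p := 2) hθ.contDiffOn))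

lemma HasIstar.add {φ φ' g g' : P.L2} {σ σ' : P.L2v} (h : P.HasIstar φ σ g)
    (h' : P.HasIstar φ' σ' g') : P.HasIstar (φ + φ') (σ + σ') (g + g') := by
  intro θ hθ
  have e1 : ∫ z, (g + g' : P.L2) z * θ z ∂P.μQ = ∫ z, (g z * θ z + g' z * θ z) ∂P.μQ := by
    refine integral_congr_ae ?_
    filter_upwards [Lp.coeFn_add g g'] with z hz
    rw [hz, Pi.add_apply, add_mul]
  have k : Integrable (fun z => g z * θ z) P.μQ :=
    (Lp.memLp g).integrable_mul (memLp_C1 (p := 2) hθ.contDiffOn)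
  have k' : Integrable (fun z => g' z * θ z) P.μQ :=
    (Lp.memLp g').integrable_mul (memLp_C1 (p := 2) hθ.contDiffOn)
  rw [e1, integral_add k k', ← h θ hθ, ← h' θ hθ,
    ← integral_add (integrable_pairing φ σ hθ) (integrable_pairing φ' σ' hθ)]
  refine integral_congr_ae ?_
  filter_upwards [Lp.coeFn_add φ φ', Lp.coeFn_add σ σ'] with z h1 h2
  rw [h1, h2, Pi.add_apply, Pi.add_apply, inner_add_left]
  ring

lemma HasIstar.smul {φ g : P.L2} {σ : P.L2v} (r : ℝ) (h : P.HasIstar φ σ g) :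
    P.HasIstar (r • φ) (r • σ) (r • g) := by
  intro θ hθ
  have e1 : ∫ z, (r • g : P.L2) z * θ z ∂P.μQ = ∫ z, r * (g z * θ z) ∂P.μQ := by
    refine integral_congr_ae ?_
    filter_upwards [Lp.coeFn_smul r g] with z hz
    rw [hz, Pi.smul_apply, smul_eq_mul, mul_assoc]
  rw [e1, integral_const_mul, ← h θ hθ, ← integral_const_mul]
  refine integral_congr_ae ?_
  filter_upwards [Lp.coeFn_smul r φ, Lp.coeFn_smul r σ] with z h1 h2
  rw [h1, h2, Pi.smul_apply, Pi.smul_apply, inner_smul_left]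
  simp
  ring

end aux2

/-! ### The space `Ψ` -/

namespace ObsData

variable {N : ℕ} {P : ParabolicData N} {ρs : ℝ} (W : ObsData P ρs)

/-- `Ψ`: the pairs `(φ, σ)` with `φ ∈ C⁰([0,T]; L²(Ω)) ∩ L²(0,T; H¹₀(Ω))`, `σ ∈ L²(Q_T)^N`,
`ρ₀ I*(φ, σ) ∈ L²(Q_T)` and `φ(·, T) = 0`. -/
def Psi : Submodule ℝ (P.L2 × P.L2v) where
  carrier := {ψ | P.IsContinuousVanishingAtEnd ψ.1 ∧ (∃ q, P.HasGradient ψ.1 q) ∧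
    ∃ g, P.HasIstar ψ.1 ψ.2 g ∧ MemLp (fun z => W.ρ₀ z * g z) 2 P.μQ}
  add_mem' := by
    rintro ψ ψ' ⟨h1, ⟨q, h2⟩, g, h3, h4⟩ ⟨h1', ⟨q', h2'⟩, g', h3', h4'⟩
    refine ⟨IsContinuousVanishingAtEnd.add h1 h1', ⟨q + q', HasGradient.add h2 h2'⟩, g + g',
      HasIstar.add h3 h3', ?_⟩
    refine (memLp_congr_ae ?_).1 (h4.add h4')
    filter_upwards [Lp.coeFn_add g g'] with z hz
    rw [hz, Pi.add_apply, Pi.add_apply, mul_add]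
  zero_mem' := by
    have a1 : P.IsContinuousVanishingAtEnd (0 : P.L2) := by
      refine ⟨0, continuousOn_const, rfl, ?_⟩
      filter_upwards [ae_slice (Lp.coeFn_zero ℝ 2 P.μQ)] with t k1
      filter_upwards [k1, Lp.coeFn_zero ℝ 2 (volume.restrict P.Ω)] with x l1 l2
      rw [l1, Pi.zero_apply (M := fun _ : ℝ => Lp ℝ 2 (volume.restrict P.Ω)), l2]
      rfl
    have a2 : P.HasGradient 0 0 := by
      have hz : IsH10 P.Ω (0 : Sp N → ℝ) (0 : Sp N → Sp N) := by
        refine ⟨MemLp.zero, MemLp.zero, fun _ => 0, fun _ => ⟨contDiff_const, .zero, ?_⟩, ?_, ?_⟩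
        · simp
        · simp
        · simp [gradient]
      filter_upwards [ae_slice (Lp.coeFn_zero ℝ 2 P.μQ), ae_slice (Lp.coeFn_zero (Sp N) 2 P.μQ)]
        with t k1 k2
      exact hz.congr (k1.mono fun _ h => h.symm) (k2.mono fun _ h => h.symm)
    have a3 : P.HasIstar 0 0 0 := by
      intro θ _
      refine integral_congr_ae ?_
      filter_upwards [Lp.coeFn_zero ℝ 2 P.μQ, Lp.coeFn_zero (Sp N) 2 P.μQ] with z h1 h2
      rw [h1, h2]
      simp
    refine ⟨a1, ⟨0, a2⟩, 0, a3, ?_⟩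
    refine (memLp_congr_ae ?_).1 MemLp.zero
    filter_upwards [Lp.coeFn_zero ℝ 2 P.μQ] with z hz
    rw [hz]
    simp
  smul_mem' := by
    rintro r ψ ⟨h1, ⟨q, h2⟩, g, h3, h4⟩
    refine ⟨IsContinuousVanishingAtEnd.smul r h1, ⟨r • q, HasGradient.smul r h2⟩, r • g,
      HasIstar.smul r h3, ?_⟩
    refine (memLp_congr_ae ?_).1 (h4.const_smul r)
    filter_upwards [Lp.coeFn_smul r g] with z hz
    rw [hz, Pi.smul_apply, Pi.smul_apply, smul_eq_mul, smul_eq_mul, mul_left_comm]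

variable {W}

/-- `φ`, for `(φ, σ) ∈ Ψ`. -/
def Psi.phi (ψ : W.Psi) : P.L2 := ψ.1.1

/-- `σ`, for `(φ, σ) ∈ Ψ`. -/
def Psi.sigma (ψ : W.Psi) : P.L2v := ψ.1.2

/-- `∇φ`, for `(φ, σ) ∈ Ψ`. -/
def Psi.grad (ψ : W.Psi) : P.L2v := ψ.2.2.1.choose

/-- `I*(φ, σ)`, for `(φ, σ) ∈ Ψ`. -/
def Psi.Istar (ψ : W.Psi) : P.L2 := ψ.2.2.2.choose

/-- `J(φ, σ) = c ∇φ - σ`, for `(φ, σ) ∈ Ψ`. -/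
def Psi.J (ψ : W.Psi) (z : SpT N) : Sp N := P.c z.1 (Psi.grad ψ z) - Psi.sigma ψ z

/-- The scalar product of `Ψ`. -/
def Psi.scalar (ψ χ : W.Psi) : ℝ :=
  ∫ z, (inner ℝ (Psi.sigma ψ z) (Psi.sigma χ z)
    + (W.ρ z ^ 2)⁻¹ * inner ℝ (Psi.grad ψ z) (Psi.grad χ z)
    + W.ρ₀ z ^ 2 * (Psi.Istar ψ z * Psi.Istar χ z)) ∂P.μQ

/-- The norm of `Ψ`. -/
def Psi.nrm (ψ : W.Psi) : ℝ := √(Psi.scalar ψ ψ)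

variable (W)

/-! ### The mixed formulation -/

/-- `y` on `q_T`, for `u = (y, p) ∈ 𝓤`. -/
def y (u : W.U) (z : SpT N) : ℝ := W.ρ₀ z * W.obs u z

/-- `J(y, p)` on `Q_T`, for `u = (y, p) ∈ 𝓤`. -/
def J (u : W.U) (z : SpT N) : Sp N := W.ρ₁ z • W.resJ u z

/-- `I(y, p)` on `Q_T`, for `u = (y, p) ∈ 𝓤`. -/
def I (u : W.U) (z : SpT N) : ℝ := W.ρ z * W.resI u z

/-- The form `a_{r,α}` on `𝓤 × 𝓤`. -/
def formA (α₁ r₁ r₂ : ℝ) (u v : W.U) : ℝ :=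
  (1 - α₁) * ∫ z, (W.ρ₀ z ^ 2)⁻¹ * (W.y u z * W.y v z) ∂W.μq
    + r₁ * ∫ z, (W.ρ₁ z ^ 2)⁻¹ * inner ℝ (W.J u z) (W.J v z) ∂P.μQ
    + r₂ * ∫ z, (W.ρ z ^ 2)⁻¹ * (W.I u z * W.I v z) ∂P.μQ

/-- The form `b_α` on `𝓤 × Ψ`. -/
def formB (α₁ : ℝ) (u : W.U) (ψ : W.Psi) : ℝ :=
  ∫ z, inner ℝ (W.J u z) (Psi.sigma ψ z) ∂P.μQ + ∫ z, W.I u z * Psi.phi ψ z ∂P.μQ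
    - α₁ * ∫ z, Psi.Istar ψ z * W.y u z ∂W.μq

/-- The form `c_α` on `Ψ × Ψ`. -/
def formC (α₁ α₂ : ℝ) (ψ χ : W.Psi) : ℝ :=
  α₁ * ∫ z, W.ρ₀ z ^ 2 * (Psi.Istar ψ z * Psi.Istar χ z) ∂P.μQ
    + α₂ * ∫ z, inner ℝ (Psi.J ψ z) (Psi.J χ z) ∂P.μQ

/-- The form `l_{1,α}` on `𝓤`, for the observation `yobs ∈ L²(q_T)`. -/
def formL1 (α₁ : ℝ) (yobs : W.L2q) (u : W.U) : ℝ :=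
  (1 - α₁) * ∫ z, (W.ρ₀ z ^ 2)⁻¹ * (yobs z * W.y u z) ∂W.μq

/-- The form `l_{2,α}` on `Ψ`. -/
def formL2 (α₁ : ℝ) (yobs : W.L2q) (ψ : W.Psi) : ℝ :=
  -α₁ * ∫ z, yobs z * Psi.Istar ψ z ∂W.μq

/-- `x = (u, ψ) ∈ 𝓤 × Ψ` solves the mixed system with right-hand sides `F` and `G`. -/
def IsMixedSol (α₁ α₂ r₁ r₂ : ℝ) (F : W.U → ℝ) (G : W.Psi → ℝ) (x : W.U × W.Psi) : Prop :=
  (∀ v : W.U, W.formA α₁ r₁ r₂ x.1 v + W.formB α₁ v x.2 = F v) ∧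
    ∀ χ : W.Psi, W.formB α₁ x.1 χ - W.formC α₁ α₂ x.2 χ = G χ

/-- Well-posedness of the mixed system in `𝓤 × Ψ`: for all continuous linear forms `F` on `𝓤` and
`G` on `Ψ` there is a unique solution, and it is bounded by `K (‖F‖ + ‖G‖)` with a fixed `K`.
The bound `|G χ| ≤ M ‖χ‖` expresses that `G` is continuous of norm at most `M`. -/
def WellPosed (α₁ α₂ r₁ r₂ : ℝ) : Prop :=
  ∃ K : ℝ, ∀ (F : W.U →L[ℝ] ℝ) (G : W.Psi →ₗ[ℝ] ℝ) (M : ℝ), 0 ≤ M →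
    (∀ χ, |G χ| ≤ M * Psi.nrm χ) →
      ∃ x : W.U × W.Psi, W.IsMixedSol α₁ α₂ r₁ r₂ F G x ∧
        (∀ x', W.IsMixedSol α₁ α₂ r₁ r₂ F G x' → x' = x) ∧
        ‖x.1‖ + Psi.nrm x.2 ≤ K * (‖F‖ + M)

end ObsData

end MixedHeat

end

namespace MixedHeat

/-! ### Weak derivatives on an interval -/

/-! Both diagonal forms of (M) are coercive, so no inf-sup condition on `b_α` is needed. The form
`a(u,v) + b(v,ψ) - b(u,χ) + c(ψ,χ)` on `𝓤 × Ψ` loses its `b`-terms on the diagonal, and Lax–Milgram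
gives existence (`exists_mixed_solution`). The same cancellation, with the solution as test element,
gives uniqueness and the bounds (`IsMixedSol.energy_le`); Young's inequality produces the constants
of the final estimate.

Coercivity of `a_{r,α}` can be read off the norm of `𝓤` (`le_formA`). The analysis lies in the
coercivity of `c_α` (`exists_coercive_formC`). With `g = I*(φ,σ)` and `J = c∇φ - σ`, the function
`φ` solves `-φ_t - div(c∇φ) + dφ = g - div J` with zero final value. The energy estimate bounds `φ`
and `∇φ` by `g` and `J` (`exists_energy_bound`), and then `σ = c∇φ - J` is bounded too. The weights
enter only through `ρ⁻¹, ρ₀⁻¹ ≤ ρs⁻¹`, so `θ₂` depends on nothing else about them.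

Since `φ_t` is only a distribution, the equation cannot be multiplied by `φ` directly. Instead
`Φ(s+k) - Φ(s)` is tested with `Φ(s)`, which lies in `H¹₀(Ω)` for almost every `s`; the elementary
bound `(Φ(s), Φ(s+k) - Φ(s)) ≤ (‖Φ(s+k)‖² - ‖Φ(s)‖²)/2` is integrated in `s`, where it telescopes,
and `k → 0` gives the energy inequality (`energy_le`). Only this inequality is needed, not the
equality.

The energy estimate has two further uses. Applied to differences, it makes `Ψ` complete
(`IsAdjointState.exists_limit`, `isClosed_range_embed`). It also bounds `φ`, which is absent from
the norm of `Ψ`, and so makes `b_α` continuous (`exists_norm_phiL_le`). -/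

lemma deriv_smoothTransition_eq_zero {r : ℝ} (hr : r ∉ Icc (0 : ℝ) 1) :
    deriv Real.smoothTransition r = 0 := by
  rw [mem_Icc, not_and_or, not_le, not_le] at hr
  rcases hr with hr | hr
  · have : Real.smoothTransition =ᶠ[𝓝 r] fun _ => 0 := by
      filter_upwards [Iio_mem_nhds hr] with x hx
      exact Real.smoothTransition.zero_of_nonpos (le_of_lt hx)
    rw [this.deriv_eq, deriv_const]
  · have : Real.smoothTransition =ᶠ[𝓝 r] fun _ => 1 := by
      filter_upwards [Ioi_mem_nhds hr] with x hx
      exact Real.smoothTransition.one_of_one_le (le_of_lt hx)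
    rw [this.deriv_eq, deriv_const]

lemma smoothTransition_hasDerivAt (r : ℝ) :
    HasDerivAt Real.smoothTransition (deriv Real.smoothTransition r) r :=
  ((Real.smoothTransition.contDiff (n := 1)).differentiable (by simp) r).hasDerivAt

lemma continuous_deriv_smoothTransition : Continuous (deriv Real.smoothTransition) :=
  (Real.smoothTransition.contDiff (n := 1)).continuous_deriv le_rfl

/-- A change of variable moves `ε` from the approximate identity into the argument of `m`, so that
the limit `ε → 0` becomes continuity of an integral with a parameter. -/
lemma integral_deriv_smoothTransition_scaled {m : ℝ → ℝ} {a ε : ℝ}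
    (hε : 0 < ε) : ∫ τ, (ε⁻¹ * deriv Real.smoothTransition ((τ - a) / ε)) * m τ
      = ∫ r in Icc (0 : ℝ) 1, deriv Real.smoothTransition r * m (a + r * ε) := by
  rw [setIntegral_eq_integral_of_forall_compl_eq_zero
    (fun r hr => by rw [deriv_smoothTransition_eq_zero hr, zero_mul])]
  have h1 : ∀ τ, (ε⁻¹ * deriv Real.smoothTransition ((τ - a) / ε)) * m τ
      = (fun x => ε⁻¹ * (deriv Real.smoothTransition (x / ε) * m (a + (x / ε) * ε))) (τ - a) := by
    intro τ
    simp only [div_mul_cancel₀ _ hε.ne', add_sub_cancel, mul_assoc]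
  simp_rw [h1]
  rw [integral_sub_right_eq_self
    (fun x => ε⁻¹ * (deriv Real.smoothTransition (x / ε) * m (a + (x / ε) * ε))) a,
    integral_const_mul,
    Measure.integral_comp_div (fun r => deriv Real.smoothTransition r * m (a + r * ε)) ε,
    smul_eq_mul, abs_of_pos hε, inv_mul_cancel_left₀ hε.ne']

lemma integral_deriv_smoothTransition :
    ∫ r in Icc (0 : ℝ) 1, deriv Real.smoothTransition r = 1 := by
  rw [integral_Icc_eq_integral_Ioc, ← intervalIntegral.integral_of_le zero_le_one,
    intervalIntegral.integral_eq_sub_of_hasDerivAt (fun r _ => smoothTransition_hasDerivAt r)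
      (continuous_deriv_smoothTransition.intervalIntegrable _ _)]
  simp

lemma tendsto_integral_deriv_smoothTransition {m : ℝ → ℝ} (hm : Continuous m) (a : ℝ) :
    Tendsto (fun ε : ℝ => ∫ r in Icc (0 : ℝ) 1, deriv Real.smoothTransition r * m (a + r * ε))
      (𝓝[>] 0) (𝓝 (m a)) := by
  have hc : Continuous fun ε : ℝ =>
      ∫ r in Icc (0 : ℝ) 1, deriv Real.smoothTransition r * m (a + r * ε) := by
    refine continuous_parametric_integral_of_continuous ?_ isCompact_Icc
    have := continuous_deriv_smoothTransition
    fun_prop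
  have h0 := (hc.tendsto 0).mono_left (nhdsWithin_le_nhds (s := Ioi 0))
  simpa [integral_mul_const, integral_deriv_smoothTransition] using h0

/-- The test function is a smoothed indicator of `(s, t]`, namely `S((τ - s)/ε) - S((τ - t)/ε)`,
with support in `[s, t + ε]`; this lies in `(0, T)` for `ε < T - t`. Its derivative is an
approximate identity at `s` minus one at `t`, while the function itself tends to the indicator. -/
lemma sub_eq_integral_of_weak_deriv_aux {T : ℝ} {m n : ℝ → ℝ} (hm : Continuous m)
    (hn : Integrable n)
    (h : ∀ η : ℝ → ℝ, IsTest (Ioo 0 T) η → ∫ τ, (deriv η τ * m τ + η τ * n τ) = 0)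
    {s t : ℝ} (hs : 0 < s) (hst : s ≤ t) (ht : t < T) : m t - m s = ∫ τ in s..t, n τ := by
  set S := Real.smoothTransition with hS
  have key : ∀ ε ∈ Ioo 0 (T - t),
      (∫ r in Icc (0 : ℝ) 1, deriv S r * m (s + r * ε))
        - (∫ r in Icc (0 : ℝ) 1, deriv S r * m (t + r * ε))
        + ∫ τ, (S ((τ - s) / ε) - S ((τ - t) / ε)) * n τ = 0 := by
    intro ε hε
    have hd : ∀ a τ, HasDerivAt (fun τ => S ((τ - a) / ε)) (ε⁻¹ * deriv S ((τ - a) / ε)) τ := by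
      intro a τ
      have := (smoothTransition_hasDerivAt ((τ - a) / ε)).comp τ
        (((hasDerivAt_id τ).sub_const a).div_const ε)
      rwa [one_div, mul_comm] at this
    have hsm : ∀ a, ContDiff ℝ ((⊤ : ℕ∞) : WithTop ℕ∞) (fun τ => S ((τ - a) / ε)) := fun a =>
      Real.smoothTransition.contDiff.comp ((contDiff_id.sub contDiff_const).div_const ε)
    have hz : ∀ τ, τ ∉ Icc s (t + ε) → S ((τ - s) / ε) - S ((τ - t) / ε) = 0 := by
      intro τ hτ
      rw [mem_Icc, not_and_or, not_le, not_le] at hτ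
      rcases hτ with hτ | hτ
      · rw [hS, Real.smoothTransition.zero_of_nonpos (div_nonpos_of_nonpos_of_nonneg (by linarith) hε.1.le),
          Real.smoothTransition.zero_of_nonpos (div_nonpos_of_nonpos_of_nonneg (by linarith) hε.1.le),
          sub_zero]
      · rw [hS, Real.smoothTransition.one_of_one_le ((one_le_div hε.1).2 (by linarith)),
          Real.smoothTransition.one_of_one_le ((one_le_div hε.1).2 (by linarith)), sub_self]
    have hts : tsupport (fun τ => S ((τ - s) / ε) - S ((τ - t) / ε)) ⊆ Icc s (t + ε) := by
      refine closure_minimal (fun τ hτ => ?_) isClosed_Icc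
      by_contra hcon
      exact hτ (hz τ hcon)
    have htest : IsTest (Ioo 0 T) fun τ => S ((τ - s) / ε) - S ((τ - t) / ε) := by
      refine ⟨(hsm s).sub (hsm t), isCompact_Icc.of_isClosed_subset (isClosed_tsupport _) hts,
        hts.trans fun τ hτ => ⟨hs.trans_le hτ.1, hτ.2.trans_lt (by linarith [hε.2])⟩⟩
    have hI : ∀ a, Integrable fun τ => (ε⁻¹ * deriv S ((τ - a) / ε)) * m τ := by
      intro a
      have hc : Continuous fun τ => (ε⁻¹ * deriv S ((τ - a) / ε)) * m τ := by
        have := continuous_deriv_smoothTransition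
        fun_prop
      refine hc.integrable_of_hasCompactSupport
        (HasCompactSupport.intro (isCompact_Icc (a := a) (b := a + ε)) fun τ hτ => ?_)
      rw [deriv_smoothTransition_eq_zero, mul_zero, zero_mul]
      rintro ⟨h1, h2⟩
      rw [le_div_iff₀ hε.1] at h1
      rw [div_le_one hε.1] at h2
      exact hτ ⟨by linarith, by linarith⟩
    have hb : ∀ τ, |S ((τ - s) / ε) - S ((τ - t) / ε)| ≤ 1 := fun τ => abs_sub_le_of_nonneg_of_le
      (Real.smoothTransition.nonneg _) (Real.smoothTransition.le_one _)
      (Real.smoothTransition.nonneg _) (Real.smoothTransition.le_one _)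
    have hJ : Integrable fun τ => (S ((τ - s) / ε) - S ((τ - t) / ε)) * n τ :=
      hn.bdd_mul (c := 1) htest.1.continuous.aestronglyMeasurable (Eventually.of_forall hb)
    rw [← integral_deriv_smoothTransition_scaled hε.1,
      ← integral_deriv_smoothTransition_scaled hε.1, ← integral_sub (hI s) (hI t),
      ← integral_add (f := fun τ => ε⁻¹ * deriv S ((τ - s) / ε) * m τ
        - ε⁻¹ * deriv S ((τ - t) / ε) * m τ) ((hI s).sub (hI t)) hJ, ← h _ htest]
    refine integral_congr_ae (Eventually.of_forall fun τ => ?_)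
    simp only [((hd s τ).fun_sub (hd t τ)).deriv]
    ring
  have hlim : Tendsto (fun ε : ℝ => ∫ τ, (S ((τ - s) / ε) - S ((τ - t) / ε)) * n τ) (𝓝[>] 0)
      (𝓝 (∫ τ, (Ioc s t).indicator n τ)) := by
    refine tendsto_integral_filter_of_dominated_convergence (fun τ => ‖n τ‖) ?_ ?_ hn.norm ?_
    · refine Eventually.of_forall fun ε => AEStronglyMeasurable.mul ?_ hn.1
      exact ((Real.smoothTransition.continuous.comp (by fun_prop)).sub
        (Real.smoothTransition.continuous.comp (by fun_prop))).aestronglyMeasurable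
    · refine Eventually.of_forall fun ε => Eventually.of_forall fun τ => ?_
      rw [norm_mul]
      exact mul_le_of_le_one_left (norm_nonneg _) (abs_sub_le_of_nonneg_of_le
        (Real.smoothTransition.nonneg _) (Real.smoothTransition.le_one _)
        (Real.smoothTransition.nonneg _) (Real.smoothTransition.le_one _))
    · refine Eventually.of_forall fun τ => ?_
      have e1 : ∀ a, a < τ → ∀ᶠ ε : ℝ in 𝓝[>] 0, S ((τ - a) / ε) = 1 := by
        intro a ha
        filter_upwards [Ioo_mem_nhdsGT (sub_pos.2 ha)] with ε hε
        exact Real.smoothTransition.one_of_one_le ((one_le_div hε.1).2 hε.2.le)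
      have e0 : ∀ a, τ ≤ a → ∀ᶠ ε : ℝ in 𝓝[>] 0, S ((τ - a) / ε) = 0 := by
        intro a ha
        filter_upwards [self_mem_nhdsWithin] with ε hε
        exact Real.smoothTransition.zero_of_nonpos
          (div_nonpos_of_nonpos_of_nonneg (by linarith) (le_of_lt hε))
      refine tendsto_const_nhds.congr' ?_
      by_cases h1 : s < τ
      · by_cases h2 : t < τ
        · filter_upwards [e1 s h1, e1 t h2] with ε k1 k2
          rw [k1, k2, indicator_of_notMem (fun hh => absurd hh.2 (not_le.2 h2))]
          ring
        · filter_upwards [e1 s h1, e0 t (not_lt.1 h2)] with ε k1 k2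
          rw [k1, k2, indicator_of_mem (show τ ∈ Ioc s t from ⟨h1, not_lt.1 h2⟩)]
          ring
      · filter_upwards [e0 s (not_lt.1 h1), e0 t ((not_lt.1 h1).trans hst)] with ε k1 k2
        rw [k1, k2, indicator_of_notMem (fun hh => h1 hh.1)]
        ring
  have hfin := ((tendsto_integral_deriv_smoothTransition hm s).sub
    (tendsto_integral_deriv_smoothTransition hm t)).add hlim
  have hzero : Tendsto (fun _ : ℝ => (0 : ℝ)) (𝓝[>] 0)
      (𝓝 (m s - m t + ∫ τ, (Ioc s t).indicator n τ)) := by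
    refine hfin.congr' ?_
    filter_upwards [Ioo_mem_nhdsGT (sub_pos.2 ht)] with ε hε
    exact key ε hε
  have := tendsto_nhds_unique hzero tendsto_const_nhds
  rw [intervalIntegral.integral_of_le hst, ← integral_indicator measurableSet_Ioc]
  linarith

/-- A continuous function whose weak derivative on `(0, T)` is an integrable function is a
primitive of it on `[0, T]`. -/
lemma sub_eq_integral_of_weak_deriv {T : ℝ} (hT : 0 < T) {m n : ℝ → ℝ} (hm : Continuous m)
    (hn : Integrable n)
    (h : ∀ η : ℝ → ℝ, IsTest (Ioo 0 T) η → ∫ τ, (deriv η τ * m τ + η τ * n τ) = 0)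
    {s t : ℝ} (hs : s ∈ Icc 0 T) (ht : t ∈ Icc 0 T) : m t - m s = ∫ τ in s..t, n τ := by
  have hcont : Continuous fun τ => m τ - ∫ r in (0 : ℝ)..τ, n r :=
    hm.sub (intervalIntegral.continuous_primitive (fun _ _ => hn.intervalIntegrable) 0)
  have hmid : T / 2 ∈ Ioo 0 T := ⟨by linarith, by linarith⟩
  have hii : ∀ a b, IntervalIntegrable n volume a b := fun _ _ => hn.intervalIntegrable
  have hint : EqOn (fun τ => m τ - ∫ r in (0 : ℝ)..τ, n r)
      (fun _ => m (T / 2) - ∫ r in (0 : ℝ)..(T / 2), n r) (Ioo 0 T) := by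
    intro τ hτ
    have e : m (T / 2) - m τ = ∫ r in τ..(T / 2), n r := by
      rcases le_total τ (T / 2) with hle | hle
      · exact sub_eq_integral_of_weak_deriv_aux hm hn h hτ.1 hle hmid.2
      · rw [intervalIntegral.integral_symm,
          ← sub_eq_integral_of_weak_deriv_aux hm hn h hmid.1 hle hτ.2]
        ring
    have e2 := intervalIntegral.integral_add_adjacent_intervals (hii 0 τ) (hii τ (T / 2))
    simp only
    linarith
  -- `m` minus a primitive of `n` is constant on the open interval, and by continuity on its
  -- closure; this recovers the endpoints `0` and `T`.
  have hcl := hint.closure hcont continuous_const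
  rw [closure_Ioo hT.ne] at hcl
  have h1 := hcl hs
  have h2 := hcl ht
  have e2 := intervalIntegral.integral_add_adjacent_intervals (hii 0 s) (hii s t)
  simp only at h1 h2
  linarith

/-! ### Scalar products of square integrable functions -/

section L2

variable {α E : Type*} [MeasurableSpace α] [NormedAddCommGroup E] [InnerProductSpace ℝ E]
  {μ : Measure α}

lemma inner_toLp {f g : α → E} (hf : MemLp f 2 μ) (hg : MemLp g 2 μ) :
    inner ℝ (hf.toLp f) (hg.toLp g) = ∫ x, inner ℝ (f x) (g x) ∂μ := by
  rw [L2.inner_def]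
  refine integral_congr_ae ?_
  filter_upwards [hf.coeFn_toLp, hg.coeFn_toLp] with x h1 h2
  rw [h1, h2]

lemma integrable_inner_of_memLp {f g : α → E} (hf : MemLp f 2 μ) (hg : MemLp g 2 μ) :
    Integrable (fun x => inner ℝ (f x) (g x)) μ := by
  refine (L2.integrable_inner (𝕜 := ℝ) (hf.toLp f) (hg.toLp g)).congr ?_
  filter_upwards [hf.coeFn_toLp, hg.coeFn_toLp] with x h1 h2
  rw [h1, h2]

lemma tendsto_integral_inner {f g' : α → E} {g : ℕ → α → E} (hf : MemLp f 2 μ)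
    (hg : ∀ n, MemLp (g n) 2 μ) (hg' : MemLp g' 2 μ)
    (h : Tendsto (fun n => eLpNorm (fun x => g n x - g' x) 2 μ) atTop (𝓝 0)) :
    Tendsto (fun n => ∫ x, inner ℝ (f x) (g n x) ∂μ) atTop (𝓝 (∫ x, inner ℝ (f x) (g' x) ∂μ)) := by
  simp_rw [← inner_toLp hf (hg _), ← inner_toLp hf hg']
  exact tendsto_const_nhds.inner ((Lp.tendsto_Lp_iff_tendsto_eLpNorm'' g hg g' hg').2 h)

end L2

lemma IsTest.memLp_fst {N : ℕ} {S : Set (Sp N)} {ξ : Sp N → ℝ} (h : IsTest S ξ)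
    (μ : Measure (Sp N)) [IsFiniteMeasureOnCompacts μ] : MemLp ξ 2 μ :=
  h.1.continuous.memLp_of_hasCompactSupport h.2.1

lemma IsTest.hasCompactSupport_gradient {N : ℕ} {S : Set (Sp N)} {ξ : Sp N → ℝ}
    (h : IsTest S ξ) : HasCompactSupport (gradient ξ) :=
  (h.2.1.fderiv ℝ).comp_left (g := (InnerProductSpace.toDual ℝ (Sp N)).symm) (map_zero _)

lemma IsTest.memLp_gradient {N : ℕ} {S : Set (Sp N)} {ξ : Sp N → ℝ} (h : IsTest S ξ)
    (μ : Measure (Sp N)) [IsFiniteMeasureOnCompacts μ] : MemLp (gradient ξ) 2 μ :=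
  h.gradient_continuous.memLp_of_hasCompactSupport h.hasCompactSupport_gradient

/-! ### Products of test functions in space and in time -/

section tensor

variable {N : ℕ} {Ω : Set (Sp N)} {I : Set ℝ} {ξ : Sp N → ℝ} {η : ℝ → ℝ}

/-- Such products turn the distributional equation on `Q_T` into a statement on the weak derivative
of `t ↦ ∫ φ(t) ξ`. -/
lemma IsTest.tensor (hξ : IsTest Ω ξ) (hη : IsTest I η) :
    IsTest (Ω ×ˢ I) (fun z : SpT N => ξ z.1 * η z.2) := by
  have hts : tsupport (fun z : SpT N => ξ z.1 * η z.2) ⊆ tsupport ξ ×ˢ tsupport η := by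
    refine closure_minimal (fun z hz => ?_) ((isClosed_tsupport _).prod (isClosed_tsupport _))
    have := mul_ne_zero_iff.1 hz
    exact ⟨subset_tsupport _ this.1, subset_tsupport _ this.2⟩
  refine ⟨(hξ.1.comp contDiff_fst).mul (hη.1.comp contDiff_snd),
    (hξ.2.1.prod hη.2.1).of_isClosed_subset (isClosed_tsupport _) hts,
    hts.trans (prod_mono hξ.2.2 hη.2.2)⟩

lemma dt_tensor (z : SpT N) :
    dt (fun z : SpT N => ξ z.1 * η z.2) z = ξ z.1 * deriv η z.2 := by
  simp [dt, deriv_const_mul_field]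

lemma gradx_tensor (hξ : IsTest Ω ξ) (z : SpT N) :
    gradx (fun z : SpT N => ξ z.1 * η z.2) z = η z.2 • gradient ξ z.1 := by
  simp only [gradx, gradient]
  rw [fderiv_mul_const (hξ.differentiable z.1), map_smulₛₗ]
  rfl

end tensor

/-! ### Weak solutions and their slices -/

variable {N : ℕ} {P : ParabolicData N}

namespace ParabolicData

/-- `φ ∈ C([0, T]; L²(Ω)) ∩ L²(0, T; H¹₀(Ω))`, with `∇φ = q` and continuous representative `Φ`
(extended to a curve on the whole line, vanishing after `T`), solves `-φ_t - div σ = f`. -/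
structure IsWeakSolution (P : ParabolicData N) (φ f : P.L2) (σ q : P.L2v)
    (Φ : ℝ → Lp ℝ 2 (volume.restrict P.Ω)) : Prop where
  cont : Continuous Φ
  zero : ∀ t, P.T ≤ t → Φ t = 0
  slice : ∀ᵐ t ∂(volume.restrict (Ioo 0 P.T)), (fun x => φ (x, t)) =ᵐ[volume.restrict P.Ω] Φ t
  grad : P.HasGradient φ q
  eqn : ∀ θ : SpT N → ℝ, IsTest P.Q θ →
    ∫ z, (φ z * dt θ z + inner ℝ (σ z) (gradx θ z)) ∂P.μQ = ∫ z, f z * θ z ∂P.μQ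

end ParabolicData

/-! ### Fubini on the cylinder -/

lemma μQ_eq_prod (P : ParabolicData N) :
    P.μQ = (volume.restrict P.Ω).prod (volume.restrict (Ioo 0 P.T)) := by
  rw [ParabolicData.μQ, ParabolicData.Q, Measure.volume_eq_prod, ← Measure.prod_restrict]

lemma integral_μQ {F : SpT N → ℝ} (hF : Integrable F P.μQ) :
    ∫ z, F z ∂P.μQ = ∫ t in Ioo 0 P.T, ∫ x in P.Ω, F (x, t) := by
  rw [μQ_eq_prod] at hF ⊢
  exact integral_prod_symm _ hF

lemma integrable_slice {F : SpT N → ℝ} (hF : Integrable F P.μQ) :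
    ∀ᵐ t ∂(volume.restrict (Ioo 0 P.T)), Integrable (fun x => F (x, t)) (volume.restrict P.Ω) := by
  rw [μQ_eq_prod] at hF
  exact hF.prod_left_ae

/-- A function of the first variable has its norm multiplied by `ν(univ)^{1/2}`. Approximations on
`Ω` thus remain approximations on `Ω × (0, k]`. -/
lemma tendsto_eLpNorm_comp_fst {α β F : Type*} [MeasurableSpace α] [MeasurableSpace β]
    [NormedAddCommGroup F] {μ : Measure α} {ν : Measure β} [SFinite μ] [IsFiniteMeasure ν]
    {w : ℕ → α → F} (hwm : ∀ n, AEStronglyMeasurable (w n) μ)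
    (hw : Tendsto (fun n => eLpNorm (w n) 2 μ) atTop (𝓝 0)) :
    Tendsto (fun n => eLpNorm (fun y : α × β => w n y.1) 2 (μ.prod ν)) atTop (𝓝 0) := by
  have e : ∀ n, eLpNorm (fun y : α × β => w n y.1) 2 (μ.prod ν)
      = ν univ ^ (1 / (2 : ℝ≥0∞)).toReal * eLpNorm (w n) 2 μ := by
    intro n
    have h2 := eLpNorm_map_measure (p := 2) (μ := μ.prod ν) (f := Prod.fst) (g := w n)
      (by rw [Measure.map_fst_prod]; exact (hwm n).smul_measure _) measurable_fst.aemeasurable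
    rw [Measure.map_fst_prod, eLpNorm_smul_measure_of_ne_top (by simp)] at h2
    exact h2.symm
  simp_rw [e]
  have := ENNReal.Tendsto.const_mul (a := ν univ ^ (1 / (2 : ℝ≥0∞)).toReal) hw
    (Or.inr (ENNReal.rpow_ne_top_of_nonneg (by positivity) (measure_ne_top _ _)))
  rwa [mul_zero] at this

/-! ### Extension by zero and time shifts -/

section ext

variable {E : Type*} [NormedAddCommGroup E]

lemma memLp_indicator_Q (f : Lp E 2 P.μQ) : MemLp (P.Q.indicator f) 2 volume :=
  (memLp_indicator_iff_restrict (Q_open P).measurableSet).2 (Lp.memLp f)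

lemma memLp_indicator_Q_shift (f : Lp E 2 P.μQ) (s h : ℝ) :
    MemLp (fun y : SpT N => P.Q.indicator f (y.1, s + y.2)) 2
      ((volume.restrict P.Ω).prod (volume.restrict (Ioc 0 h))) := by
  have h1 : MeasurePreserving (Prod.map id (s + ·)) (volume : Measure (SpT N)) volume :=
    (MeasurePreserving.id (volume : Measure (Sp N))).prod (measurePreserving_add_left volume s)
  have h2 := (memLp_indicator_Q f).comp_measurePreserving h1
  rw [Measure.prod_restrict]
  exact h2.restrict _

end ext

namespace ParabolicData.IsWeakSolution

variable {φ f : P.L2} {σ q : P.L2v} {Φ : ℝ → Lp ℝ 2 (volume.restrict P.Ω)}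

/-- The time derivative of `t ↦ ∫ φ(t) ξ`. -/
noncomputable def rate (f : P.L2) (σ : P.L2v) (ξ : Sp N → ℝ) (t : ℝ) : ℝ :=
  ∫ x in P.Ω, (inner ℝ (P.Q.indicator σ (x, t)) (gradient ξ x) - P.Q.indicator f (x, t) * ξ x)

lemma integrable_rate_integrand (f : P.L2) (σ : P.L2v) {ξ : Sp N → ℝ} (hξ : IsTest P.Ω ξ) :
    Integrable (fun z : SpT N => inner ℝ (σ z) (gradient ξ z.1) - f z * ξ z.1) P.μQ := by
  have h1 : MemLp (fun z : SpT N => gradient ξ z.1) 2 P.μQ := by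
    rw [μQ_eq_prod]
    exact (hξ.memLp_gradient _).comp_fst _
  have h2 : MemLp (fun z : SpT N => ξ z.1) 2 P.μQ := by
    rw [μQ_eq_prod]
    exact (hξ.memLp_fst _).comp_fst _
  exact (integrable_inner_of_memLp (Lp.memLp σ) h1).sub ((Lp.memLp f).integrable_mul h2)

lemma indicator_rate_integrand (f : P.L2) (σ : P.L2v) (ξ : Sp N → ℝ) (z : SpT N) :
    inner ℝ (P.Q.indicator σ z) (gradient ξ z.1) - P.Q.indicator f z * ξ z.1
      = P.Q.indicator (fun z : SpT N => inner ℝ (σ z) (gradient ξ z.1) - f z * ξ z.1) z := by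
  by_cases hz : z ∈ P.Q <;> simp [hz]

lemma integrable_rate (f : P.L2) (σ : P.L2v) {ξ : Sp N → ℝ} (hξ : IsTest P.Ω ξ) :
    Integrable (rate f σ ξ) := by
  have h1 : Integrable (P.Q.indicator
      (fun z : SpT N => inner ℝ (σ z) (gradient ξ z.1) - f z * ξ z.1)) volume :=
    (integrable_indicator_iff (Q_open P).measurableSet).2 (integrable_rate_integrand f σ hξ)
  have h2 : Integrable (P.Q.indicator
      (fun z : SpT N => inner ℝ (σ z) (gradient ξ z.1) - f z * ξ z.1))
      ((volume.restrict P.Ω).prod volume) := by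
    refine h1.mono_measure ?_
    rw [Measure.volume_eq_prod]
    exact Measure.prod_mono Measure.restrict_le_self le_rfl
  refine h2.integral_prod_right.congr (Eventually.of_forall fun t => ?_)
  exact integral_congr_ae (Eventually.of_forall fun x =>
    (indicator_rate_integrand f σ ξ (x, t)).symm)

lemma rate_eq_zero (f : P.L2) (σ : P.L2v) (ξ : Sp N → ℝ) {t : ℝ} (ht : t ∉ Ioo 0 P.T) :
    rate f σ ξ t = 0 := by
  have : ∀ x, (x, t) ∉ P.Q := fun x hx => ht hx.2
  simp [rate, this]

/-- The equation tested with `ξ(x) η(t)` says that `rate` is the weak derivative of `τ ↦ (ξ, Φ(τ))`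
on `(0, T)`. Only `s` has to lie in `[0, T]`: past `T` both `Φ` and the data extended by zero
vanish. -/
lemma sub_eq_integral_rate (h : P.IsWeakSolution φ f σ q Φ) {ξ : Sp N → ℝ} (hξ : IsTest P.Ω ξ)
    {s k : ℝ} (hs : s ∈ Icc 0 P.T) (hk : 0 ≤ k) :
    inner ℝ ((hξ.memLp_fst (volume.restrict P.Ω)).toLp ξ) (Φ (s + k) - Φ s)
      = ∫ τ in s..(s + k), rate f σ ξ τ := by
  set Ξ := (hξ.memLp_fst (volume.restrict P.Ω)).toLp ξ with hΞ
  have hw : ∀ η : ℝ → ℝ, IsTest (Ioo 0 P.T) η →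
      ∫ τ, (deriv η τ * inner ℝ Ξ (Φ τ) + η τ * rate f σ ξ τ) = 0 := by
    intro η hη
    have hz : ∀ τ, τ ∉ Ioo 0 P.T → η τ = 0 ∧ deriv η τ = 0 := by
      intro τ hτ
      have h1 : τ ∉ tsupport η := fun hh => hτ (hη.2.2 hh)
      exact ⟨image_eq_zero_of_notMem_tsupport h1,
        image_eq_zero_of_notMem_tsupport fun hh => h1 (tsupport_deriv_subset hh)⟩
    rw [← setIntegral_eq_integral_of_forall_compl_eq_zero (s := Ioo 0 P.T)
      (fun τ hτ => by rw [(hz τ hτ).1, (hz τ hτ).2]; ring)]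
    have ha : Integrable (fun z : SpT N => φ z * ξ z.1) P.μQ := by
      have h2 : MemLp (fun z : SpT N => ξ z.1) 2 P.μQ := by
        rw [μQ_eq_prod]
        exact (hξ.memLp_fst _).comp_fst _
      exact (Lp.memLp φ).integrable_mul h2
    have hb := integrable_rate_integrand f σ hξ
    have hd : Continuous (deriv η) := hη.1.continuous_deriv (by simp)
    obtain ⟨C, hC⟩ := hd.bounded_above_of_compact_support hη.2.1.deriv
    obtain ⟨C', hC'⟩ := hη.1.continuous.bounded_above_of_compact_support hη.2.1
    have ha' : Integrable (fun z : SpT N => deriv η z.2 * (φ z * ξ z.1)) P.μQ :=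
      ha.bdd_mul (c := C) (hd.comp continuous_snd).aestronglyMeasurable
        (Eventually.of_forall fun z => hC z.2)
    have hb' : Integrable (fun z : SpT N => η z.2 *
        (inner ℝ (σ z) (gradient ξ z.1) - f z * ξ z.1)) P.μQ :=
      hb.bdd_mul (c := C') (hη.1.continuous.comp continuous_snd).aestronglyMeasurable
        (Eventually.of_forall fun z => hC' z.2)
    have key : ∫ z, (deriv η z.2 * (φ z * ξ z.1)
        + η z.2 * (inner ℝ (σ z) (gradient ξ z.1) - f z * ξ z.1)) ∂P.μQ = 0 := by
      have htens := hξ.tensor hη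
      have e := h.eqn _ htens
      have i1 : Integrable (fun z => φ z * dt (fun z : SpT N => ξ z.1 * η z.2) z
          + inner ℝ (σ z) (gradx (fun z : SpT N => ξ z.1 * η z.2) z)) P.μQ :=
        ((Lp.memLp φ).integrable_mul (memLp_dt htens.contDiffOn)).add
          (integrable_inner_of_memLp (Lp.memLp σ) (memLp_gradx htens.contDiffOn))
      have i2 : Integrable (fun z => f z * (ξ z.1 * η z.2)) P.μQ :=
        (Lp.memLp f).integrable_mul (memLp_C1 (p := 2) htens.contDiffOn)
      rw [← sub_eq_zero, ← integral_sub i1 i2] at e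
      rw [← e]
      refine integral_congr_ae (Eventually.of_forall fun z => ?_)
      simp only [dt_tensor, gradx_tensor hξ, inner_smul_right]
      ring
    have hadd := ha'.add hb'
    have key2 := (integral_μQ hadd).symm.trans key
    refine Eq.trans (integral_congr_ae ?_) key2
    filter_upwards [integrable_slice ha, integrable_slice hb, h.slice,
      ae_restrict_mem measurableSet_Ioo] with t h1 h2 h3 h4
    refine Eq.trans ?_ (integral_add (h1.const_mul (deriv η t)) (h2.const_mul (η t))).symm
    rw [integral_const_mul, integral_const_mul]
    congr 2
    · rw [L2.inner_def]
      refine integral_congr_ae ?_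
      filter_upwards [h3, (hξ.memLp_fst (volume.restrict P.Ω)).coeFn_toLp] with x k1 k2
      rw [hΞ, k2, ← k1]
      rfl
    · refine setIntegral_congr_fun P.isOpen.measurableSet fun x hx => ?_
      have hQ : (x, t) ∈ P.Q := ⟨hx, h4⟩
      simp [hQ]
  have hm : Continuous fun τ => inner ℝ Ξ (Φ τ) := continuous_const.inner h.cont
  have hn := integrable_rate f σ hξ
  rw [inner_sub_right]
  rcases le_total (s + k) P.T with hle | hle
  · exact sub_eq_integral_of_weak_deriv P.T_pos hm hn hw hs ⟨by linarith [hs.1], hle⟩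
  · have e1 := sub_eq_integral_of_weak_deriv P.T_pos hm hn hw hs (right_mem_Icc.2 P.T_pos.le)
    have e2 := intervalIntegral.integral_add_adjacent_intervals (μ := volume)
      (hn.intervalIntegrable (a := s) (b := P.T)) (hn.intervalIntegrable (a := P.T) (b := s + k))
    have e3 : ∫ τ in P.T..(s + k), rate f σ ξ τ = 0 := by
      rw [intervalIntegral.integral_of_le hle]
      refine setIntegral_eq_zero_of_forall_eq_zero fun τ hτ => rate_eq_zero _ _ _ fun hh => ?_
      exact absurd hτ.1 (not_lt.2 hh.2.le)
    rw [h.zero _ hle, ← h.zero P.T le_rfl, e1, ← e2, e3, add_zero]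

/-- The increments of a weak solution, tested with an element of `H¹₀(Ω)`. -/
lemma inner_sub_eq (h : P.IsWeakSolution φ f σ q Φ) {u : Sp N → ℝ} {v : Sp N → Sp N}
    (huv : IsH10 P.Ω u v) {s k : ℝ} (hs : s ∈ Icc 0 P.T) (hk : 0 ≤ k) :
    inner ℝ (huv.1.toLp u) (Φ (s + k) - Φ s)
      = ∫ y : SpT N, (inner ℝ (P.Q.indicator σ (y.1, s + y.2)) (v y.1)
          - P.Q.indicator f (y.1, s + y.2) * u y.1)
        ∂((volume.restrict P.Ω).prod (volume.restrict (Ioc 0 k))) := by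
  obtain ⟨θ, hθ, hθu, hθv⟩ := huv.2.2
  have hu := huv.1
  have hv := huv.2.1
  set ν := (volume.restrict P.Ω).prod (volume.restrict (Ioc 0 k)) with hν
  have hσ : MemLp (fun y : SpT N => P.Q.indicator σ (y.1, s + y.2)) 2 ν :=
    memLp_indicator_Q_shift σ s k
  have hf : MemLp (fun y : SpT N => P.Q.indicator f (y.1, s + y.2)) 2 ν :=
    memLp_indicator_Q_shift f s k
  have hθ1 : ∀ n, MemLp (fun y : SpT N => θ n y.1) 2 ν := fun n =>
    ((hθ n).memLp_fst _).comp_fst _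
  have hθ2 : ∀ n, MemLp (fun y : SpT N => gradient (θ n) y.1) 2 ν := fun n =>
    ((hθ n).memLp_gradient _).comp_fst _
  have hu1 : MemLp (fun y : SpT N => u y.1) 2 ν := hu.comp_fst _
  have hv1 : MemLp (fun y : SpT N => v y.1) 2 ν := hv.comp_fst _
  have c1 := tendsto_eLpNorm_comp_fst (ν := volume.restrict (Ioc 0 k))
    (w := fun n x => gradient (θ n) x - v x)
    (fun n => (hθ n).gradient_continuous.aestronglyMeasurable.sub hv.1) hθv
  have c2 := tendsto_eLpNorm_comp_fst (ν := volume.restrict (Ioc 0 k))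
    (w := fun n x => θ n x - u x)
    (fun n => (hθ n).1.continuous.aestronglyMeasurable.sub hu.1) hθu
  have t1 := tendsto_integral_inner hσ hθ2 hv1 c1
  have t2 := tendsto_integral_inner hf hθ1 hu1 c2
  have t0 : Tendsto (fun n => ((hθ n).memLp_fst (volume.restrict P.Ω)).toLp (θ n)) atTop
      (𝓝 (hu.toLp u)) :=
    (Lp.tendsto_Lp_iff_tendsto_eLpNorm'' θ (fun n => (hθ n).memLp_fst _) u hu).2 hθu
  have t3 : Tendsto (fun n => inner ℝ (((hθ n).memLp_fst (volume.restrict P.Ω)).toLp (θ n))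
      (Φ (s + k) - Φ s)) atTop (𝓝 (inner ℝ (hu.toLp u) (Φ (s + k) - Φ s))) :=
    t0.inner tendsto_const_nhds
  have hsub : ∀ {a : Sp N → ℝ} {b : Sp N → Sp N}, MemLp (fun y : SpT N => a y.1) 2 ν →
      MemLp (fun y : SpT N => b y.1) 2 ν →
      ∫ y : SpT N, (inner ℝ (P.Q.indicator σ (y.1, s + y.2)) (b y.1)
          - P.Q.indicator f (y.1, s + y.2) * a y.1) ∂ν
        = ∫ y : SpT N, inner ℝ (P.Q.indicator σ (y.1, s + y.2)) (b y.1) ∂ν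
          - ∫ y : SpT N, inner ℝ (P.Q.indicator f (y.1, s + y.2)) (a y.1) ∂ν := by
    intro a b ha hb
    rw [← integral_sub (integrable_inner_of_memLp hσ hb) (integrable_inner_of_memLp hf ha)]
    refine integral_congr_ae (Eventually.of_forall fun y => ?_)
    simp [mul_comm]
  rw [hsub hu1 hv1]
  -- Both sides are continuous in `(u, v)` for the norm of `L² × L²`, so the identity for test
  -- functions passes to `H¹₀(Ω)`.
  refine tendsto_nhds_unique t3 ((t1.sub t2).congr fun n => ?_)
  rw [h.sub_eq_integral_rate (hθ n) hs hk, ← hsub (hθ1 n) (hθ2 n), hν, integral_prod_symm]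
  · rw [← intervalIntegral.integral_of_le hk]
    have := intervalIntegral.integral_comp_add_left (a := 0) (b := k) (rate f σ (θ n)) s
    rw [add_zero] at this
    exact this
  · exact (integrable_inner_of_memLp hσ (hθ2 n)).sub (hf.integrable_mul (hθ1 n))

end ParabolicData.IsWeakSolution

variable {N : ℕ} {P : ParabolicData N}

/-! ### The energy inequality -/

section translation

variable {E : Type*} [NormedAddCommGroup E] [InnerProductSpace ℝ E]

/-- Continuity of time translations in `L²`. -/
lemma continuous_integral_inner_shift {F w : SpT N → E} (hF : MemLp F 2 volume)
    (hw : MemLp w 2 volume) :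
    Continuous fun k : ℝ => ∫ z : SpT N, inner ℝ (F (z.1, z.2 + k)) (w z) := by
  have : (volume : Measure (SpT N)).IsAddLeftInvariant := by
    rw [Measure.volume_eq_prod]
    infer_instance
  have : (volume : Measure (SpT N)).InnerRegularCompactLTTop := by
    rw [Measure.volume_eq_prod]
    infer_instance
  have : IsLocallyFiniteMeasure (volume : Measure (SpT N)) := by
    rw [Measure.volume_eq_prod]
    infer_instance
  have : Fact ((2 : ℝ≥0∞) ≠ ∞) := ⟨ENNReal.ofNat_ne_top⟩
  have : VAddInvariantMeasure (SpT N) (SpT N) volume :=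
    ⟨fun c _ hs => (measurePreserving_add_left volume c).measure_preimage hs.nullMeasurableSet⟩
  have hmk : Continuous fun k : ℝ => DomAddAct.mk ((0, k) : SpT N) :=
    DomAddAct.continuous_mk.comp (by fun_prop)
  -- Space-time acts continuously on `L²` by translations; the action is restricted to the time
  -- direction and paired with `w`.
  have hc : Continuous fun k : ℝ =>
      inner ℝ (DomAddAct.mk ((0, k) : SpT N) +ᵥ hF.toLp F : Lp E 2 volume) (hw.toLp w) :=
    (hmk.vadd continuous_const).inner continuous_const
  refine hc.congr fun k => ?_
  rw [L2.inner_def]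
  refine integral_congr_ae ?_
  have hq : MeasurePreserving (fun z : SpT N => ((0, k) : SpT N) + z) volume volume :=
    measurePreserving_add_left volume _
  filter_upwards [hw.coeFn_toLp, DomAddAct.vadd_Lp_ae_eq (DomAddAct.mk ((0, k) : SpT N)) (hF.toLp F),
    hq.quasiMeasurePreserving.ae hF.coeFn_toLp] with z h1 h2 h3
  rw [h1, h2]
  simp only [DomAddAct.mk, vadd_eq_add] at h3 ⊢
  congr 1
  refine h3.trans (congrArg F ?_)
  ext1 <;> simp [add_comm]

-- Each time shift preserves the measure, hence so does the skew product over the shifts. This gives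
-- square integrability jointly in the point and the shift, as Fubini requires.
omit [InnerProductSpace ℝ E] in
lemma memLp_shift_prod {F : SpT N → E} (hF : MemLp F 2 volume) (h : ℝ) :
    MemLp (fun y : SpT N × ℝ => F (y.1.1, y.1.2 + y.2)) 2
      ((volume : Measure (SpT N)).prod (volume.restrict (Ioc 0 h))) := by
  have h1 : MeasurePreserving (fun p : ℝ × SpT N => (p.1, ((p.2.1, p.2.2 + p.1) : SpT N)))
      ((volume.restrict (Ioc 0 h)).prod volume) ((volume.restrict (Ioc 0 h)).prod volume) := by
    refine MeasurePreserving.skew_product (g := fun k (z : SpT N) => ((z.1, z.2 + k) : SpT N))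
      (MeasurePreserving.id _) (by fun_prop) ?_
    refine Eventually.of_forall fun k => ?_
    exact ((MeasurePreserving.id (volume : Measure (Sp N))).prod
      (measurePreserving_add_right volume k)).map_eq
  exact (hF.comp_snd _).comp_measurePreserving (h1.comp Measure.measurePreserving_swap)

end translation

namespace ParabolicData.IsWeakSolution

variable {φ f : P.L2} {σ q : P.L2v} {Φ : ℝ → Lp ℝ 2 (volume.restrict P.Ω)}

/-- The increment is tested with `Φ(s)` itself, admissible because almost every slice of `φ` lies in
`H¹₀(Ω)`; the discarded term is `‖Φ(s+k) - Φ(s)‖²/2`. This takes the place of the product rule for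
`φ_t φ`. -/
lemma ae_inner_slice_le (h : P.IsWeakSolution φ f σ q Φ) {k : ℝ} (hk : 0 ≤ k) :
    ∀ᵐ s ∂(volume.restrict (Ioo 0 P.T)),
      ∫ y : SpT N, (inner ℝ (P.Q.indicator σ (y.1, s + y.2)) (q (y.1, s))
          - P.Q.indicator f (y.1, s + y.2) * φ (y.1, s))
        ∂((volume.restrict P.Ω).prod (volume.restrict (Ioc 0 k)))
      ≤ (‖Φ (s + k)‖ ^ 2 - ‖Φ s‖ ^ 2) / 2 := by
  filter_upwards [h.slice, h.grad, ae_restrict_mem measurableSet_Ioo] with s h1 h2 h3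
  rw [← h.inner_sub_eq h2 (Ioo_subset_Icc_self h3) hk]
  have e : h2.1.toLp (fun x => φ (x, s)) = Φ s := Lp.ext (h2.1.coeFn_toLp.trans h1)
  rw [e, inner_sub_right, real_inner_self_eq_norm_sq]
  have := norm_sub_sq_real (Φ s) (Φ (s + k))
  nlinarith [sq_nonneg ‖Φ s - Φ (s + k)‖]

/-- The shifted and unshifted integrals differ only by pieces of length `k` at the two ends, and the
piece beyond `T` is zero. -/
lemma integral_norm_sq_shift (h : P.IsWeakSolution φ f σ q Φ) {a k : ℝ} (ha : a ≤ P.T)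
    (hk : 0 ≤ k) :
    ∫ s in Ioo a P.T, (‖Φ (s + k)‖ ^ 2 - ‖Φ s‖ ^ 2) / 2 = - (∫ s in a..(a + k), ‖Φ s‖ ^ 2) / 2 := by
  have hc : Continuous fun s => ‖Φ s‖ ^ 2 := h.cont.norm.pow 2
  have hi : ∀ b c, IntervalIntegrable (fun s => ‖Φ s‖ ^ 2) volume b c :=
    fun b c => hc.intervalIntegrable b c
  have hck : Continuous fun s => ‖Φ (s + k)‖ ^ 2 :=
    hc.comp (continuous_id.add continuous_const)
  rw [← integral_Ioc_eq_integral_Ioo, ← intervalIntegral.integral_of_le ha,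
    intervalIntegral.integral_div, intervalIntegral.integral_sub
      (hck.intervalIntegrable _ _) (hi _ _),
    intervalIntegral.integral_comp_add_right (fun s => ‖Φ s‖ ^ 2)]
  have e1 := intervalIntegral.integral_add_adjacent_intervals (hi a (a + k)) (hi (a + k) (P.T + k))
  have e2 := intervalIntegral.integral_add_adjacent_intervals (hi a P.T) (hi P.T (P.T + k))
  have e3 : ∫ s in P.T..(P.T + k), ‖Φ s‖ ^ 2 = 0 := by
    rw [intervalIntegral.integral_of_le (by linarith)]
    refine setIntegral_eq_zero_of_forall_eq_zero fun τ hτ => ?_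
    rw [h.zero τ hτ.1.le]
    simp
  rw [e3] at e2
  congr 1
  linarith

/-- This is the slice inequality integrated over `s ∈ (a, T)`. The order of integration puts the
shift `r` outermost, so that both sides can be differentiated in `k` at `0`. -/
lemma integral_shift_le (h : P.IsWeakSolution φ f σ q Φ) {a k : ℝ} (ha : a ∈ Icc 0 P.T)
    (hk : 0 ≤ k) :
    ∫ r in Ioc 0 k, (∫ z in P.Ω ×ˢ Ioo a P.T,
      (inner ℝ (P.Q.indicator σ (z.1, z.2 + r)) (q z)
        - P.Q.indicator f (z.1, z.2 + r) * φ z)) ≤ - (∫ s in a..(a + k), ‖Φ s‖ ^ 2) / 2 := by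
  have hsub : P.Ω ×ˢ Ioo a P.T ⊆ P.Q := prod_mono le_rfl (Ioo_subset_Ioo_left ha.1)
  have hIoo : Ioo a P.T ⊆ Ioo 0 P.T := Ioo_subset_Ioo_left ha.1
  set μa : Measure (SpT N) := volume.restrict (P.Ω ×ˢ Ioo a P.T) with hμa
  have hμprod : μa = (volume.restrict P.Ω).prod (volume.restrict (Ioo a P.T)) := by
    rw [hμa, Measure.volume_eq_prod, Measure.prod_restrict]
  have hle : μa ≤ P.μQ := Measure.restrict_mono hsub le_rfl
  have hfin : IsFiniteMeasure μa := isFiniteMeasure_of_le _ hle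
  have s1 : MemLp (fun y : SpT N × ℝ => P.Q.indicator σ (y.1.1, y.1.2 + y.2)) 2
      (μa.prod (volume.restrict (Ioc 0 k))) :=
    (memLp_shift_prod (memLp_indicator_Q σ) k).mono_measure
      (Measure.prod_mono Measure.restrict_le_self le_rfl)
  have s2 : MemLp (fun y : SpT N × ℝ => P.Q.indicator f (y.1.1, y.1.2 + y.2)) 2
      (μa.prod (volume.restrict (Ioc 0 k))) :=
    (memLp_shift_prod (memLp_indicator_Q f) k).mono_measure
      (Measure.prod_mono Measure.restrict_le_self le_rfl)
  have s3 : MemLp (fun y : SpT N × ℝ => q y.1) 2 (μa.prod (volume.restrict (Ioc 0 k))) :=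
    ((Lp.memLp q).mono_measure hle).comp_fst _
  have s4 : MemLp (fun y : SpT N × ℝ => φ y.1) 2 (μa.prod (volume.restrict (Ioc 0 k))) :=
    ((Lp.memLp φ).mono_measure hle).comp_fst _
  have hZ : Integrable (fun y : SpT N × ℝ => inner ℝ (P.Q.indicator σ (y.1.1, y.1.2 + y.2)) (q y.1)
      - P.Q.indicator f (y.1.1, y.1.2 + y.2) * φ y.1) (μa.prod (volume.restrict (Ioc 0 k))) :=
    (integrable_inner_of_memLp s1 s3).sub (s2.integrable_mul s4)
  have hZ1 := hZ.integral_prod_left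
  rw [← integral_prod_symm _ hZ, integral_prod _ hZ]
  rw [hμprod] at hZ1 ⊢
  rw [integral_prod_symm _ hZ1, ← h.integral_norm_sq_shift ha.2 hk]
  refine integral_mono_ae hZ1.integral_prod_right ?_ ?_
  · have hc : Continuous fun s => (‖Φ (s + k)‖ ^ 2 - ‖Φ s‖ ^ 2) / 2 := by
      have := h.cont
      fun_prop
    exact (hc.integrableOn_Icc (a := a) (b := P.T)).mono_set Ioo_subset_Icc_self
  · have hq : ∀ᵐ s ∂(volume.restrict (Ioo 0 P.T)),
        MemLp (fun x => q (x, s)) 2 (volume.restrict P.Ω) := h.grad.mono fun s hs => hs.2.1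
    have hφ : ∀ᵐ s ∂(volume.restrict (Ioo 0 P.T)),
        MemLp (fun x => φ (x, s)) 2 (volume.restrict P.Ω) := h.grad.mono fun s hs => hs.1
    have := hq.and (hφ.and (h.ae_inner_slice_le hk))
    filter_upwards [ae_mono (Measure.restrict_mono hIoo le_rfl) this] with s hs
    refine le_trans (le_of_eq ?_) hs.2.2
    refine (integral_prod (fun y : SpT N => inner ℝ (P.Q.indicator σ (y.1, s + y.2)) (q (y.1, s))
          - P.Q.indicator f (y.1, s + y.2) * φ (y.1, s)) ?_).symm
    exact (integrable_inner_of_memLp (memLp_indicator_Q_shift σ s k) (hs.1.comp_fst _)).sub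
      ((memLp_indicator_Q_shift f s k).integrable_mul (hs.2.1.comp_fst _))

lemma continuous_integral_shift (φ f : P.L2) (σ q : P.L2v) {a : ℝ} (ha : 0 ≤ a) :
    Continuous fun r => ∫ z in P.Ω ×ˢ Ioo a P.T,
      (inner ℝ (P.Q.indicator σ (z.1, z.2 + r)) (q z)
        - P.Q.indicator f (z.1, z.2 + r) * φ z) := by
  have hR : MeasurableSet (P.Ω ×ˢ Ioo a P.T) := P.isOpen.measurableSet.prod measurableSet_Ioo
  have hsub : P.Ω ×ˢ Ioo a P.T ⊆ P.Q := prod_mono le_rfl (Ioo_subset_Ioo_left ha)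
  have hle : volume.restrict (P.Ω ×ˢ Ioo a P.T) ≤ P.μQ := Measure.restrict_mono hsub le_rfl
  have hq := (memLp_indicator_iff_restrict hR).2 ((Lp.memLp q).mono_measure hle)
  have hφ := (memLp_indicator_iff_restrict hR).2 ((Lp.memLp φ).mono_measure hle)
  have c1 := continuous_integral_inner_shift (memLp_indicator_Q σ) hq
  have c2 := continuous_integral_inner_shift (memLp_indicator_Q f) hφ
  refine (c1.sub c2).congr fun r => ?_
  have hmp : MeasurePreserving (fun z : SpT N => ((z.1, z.2 + r) : SpT N)) volume volume :=
    (MeasurePreserving.id (volume : Measure (Sp N))).prod (measurePreserving_add_right volume r)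
  refine (integral_sub
    (integrable_inner_of_memLp ((memLp_indicator_Q σ).comp_measurePreserving hmp) hq)
    (integrable_inner_of_memLp ((memLp_indicator_Q f).comp_measurePreserving hmp) hφ)).symm.trans ?_
  rw [← integral_indicator hR]
  refine integral_congr_ae (Eventually.of_forall fun z => ?_)
  by_cases hz : z ∈ P.Ω ×ˢ Ioo a P.T <;> simp only [indicator_of_mem, indicator_of_notMem, hz,
    not_false_eq_true, inner_zero_right, sub_zero, Function.comp_apply, Real.inner_apply] 

/-- The energy inequality for weak solutions. -/
theorem energy_le (h : P.IsWeakSolution φ f σ q Φ) {a : ℝ} (ha : a ∈ Icc 0 P.T) :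
    ‖Φ a‖ ^ 2 ≤ 2 * ∫ z in P.Ω ×ˢ Ioo a P.T, (f z * φ z - inner ℝ (σ z) (q z)) := by
  have hsub : P.Ω ×ˢ Ioo a P.T ⊆ P.Q := prod_mono le_rfl (Ioo_subset_Ioo_left ha.1)
  have hR : MeasurableSet (P.Ω ×ˢ Ioo a P.T) := P.isOpen.measurableSet.prod measurableSet_Ioo
  set G : ℝ → ℝ := fun r => ∫ z in P.Ω ×ˢ Ioo a P.T,
      (inner ℝ (P.Q.indicator σ (z.1, z.2 + r)) (q z)
        - P.Q.indicator f (z.1, z.2 + r) * φ z) with hG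
  have hGc : Continuous G := continuous_integral_shift φ f σ q ha.1
  have hG0 : G 0 = - ∫ z in P.Ω ×ˢ Ioo a P.T, (f z * φ z - inner ℝ (σ z) (q z)) := by
    rw [hG, ← integral_neg]
    refine setIntegral_congr_fun hR fun z hz => ?_
    have hzQ : z ∈ P.Q := hsub hz
    simp [hzQ]
  have hec : Continuous fun s => ‖Φ s‖ ^ 2 := h.cont.norm.pow 2
  have d1 : HasDerivAt (fun k => ∫ s in a..(a + k), ‖Φ s‖ ^ 2) (‖Φ a‖ ^ 2) 0 := by
    have h0 : HasDerivAt (fun u => ∫ s in a..u, ‖Φ s‖ ^ 2) (‖Φ a‖ ^ 2) (a + 0) := by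
      rw [add_zero]
      exact intervalIntegral.integral_hasDerivAt_right (hec.intervalIntegrable _ _)
        (hec.stronglyMeasurableAtFilter _ _) hec.continuousAt
    exact h0.comp_const_add a 0
  have d2 : HasDerivAt (fun k => ∫ r in (0 : ℝ)..k, G r) (G 0) 0 :=
    intervalIntegral.integral_hasDerivAt_right (hGc.intervalIntegrable _ _)
      (hGc.stronglyMeasurableAtFilter _ _) hGc.continuousAt
  -- The function `½ ∫_a^{a+k} ‖Φ‖² + ∫_0^k G` vanishes at `k = 0` and is nonpositive for `k > 0`,
  -- so its right derivative `½ ‖Φ(a)‖² + G(0)` is nonpositive.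
  have d3 := (d1.div_const 2).add d2
  have hlim := d3.tendsto_slope_zero_right
  have hle : ‖Φ a‖ ^ 2 / 2 + G 0 ≤ 0 := by
    refine le_of_tendsto hlim ?_
    filter_upwards [self_mem_nhdsWithin] with k hk
    have hk' : (0 : ℝ) < k := hk
    have e := h.integral_shift_le ha hk'.le
    rw [← intervalIntegral.integral_of_le hk'.le] at e
    simp only [Pi.add_apply, zero_add, add_zero, intervalIntegral.integral_same, zero_div, sub_zero,
      smul_eq_mul]
    refine mul_nonpos_of_nonneg_of_nonpos (inv_nonneg.2 hk'.le) ?_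
    linarith
  rw [hG0] at hle
  linarith

end ParabolicData.IsWeakSolution

/-! ### Multiplication operators -/

section mul

variable {α E : Type*} [MeasurableSpace α] [NormedAddCommGroup E] [InnerProductSpace ℝ E]
  {μ : Measure α}

/-- Multiplication by an essentially bounded function, as an operator on `L²`. -/
noncomputable def mulL {w : α → ℝ} (hw : MemLp w ⊤ μ) : Lp E 2 μ →L[ℝ] Lp E 2 μ :=
  (ContinuousLinearMap.lsmul ℝ ℝ : ℝ →L[ℝ] E →L[ℝ] E).holderL μ ⊤ 2 2 (hw.toLp w)

lemma coeFn_mulL {w : α → ℝ} (hw : MemLp w ⊤ μ) (f : Lp E 2 μ) :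
    mulL hw f =ᵐ[μ] fun z => w z • f z := by
  filter_upwards [ContinuousLinearMap.coeFn_holder (r := 2)
    (ContinuousLinearMap.lsmul ℝ ℝ : ℝ →L[ℝ] E →L[ℝ] E) (hw.toLp w) f, hw.coeFn_toLp] with z h1 h2
  refine h1.trans ?_
  rw [h2]
  rfl

lemma norm_sq_eq_integral (f : Lp E 2 μ) : ‖f‖ ^ 2 = ∫ z, ‖f z‖ ^ 2 ∂μ := by
  rw [← real_inner_self_eq_norm_sq, L2.inner_def]
  simp_rw [real_inner_self_eq_norm_sq]

omit [InnerProductSpace ℝ E] in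
lemma integrable_norm_sq (f : Lp E 2 μ) : Integrable (fun z => ‖f z‖ ^ 2) μ :=
  (memLp_two_iff_integrable_sq_norm (Lp.memLp f).1).1 (Lp.memLp f)

end mul

variable {N : ℕ}

namespace ParabolicData

lemma memLp_c (P : ParabolicData N) : MemLp (fun z : SpT N => P.c z.1) ⊤ P.μQ := by
  obtain ⟨C, hC⟩ := P.isBounded.isCompact_closure.exists_bound_of_continuousOn
    P.c_contDiffOn.continuousOn
  have := FiniteDimensional.proper ℝ (Sp N →L[ℝ] Sp N)
  refine memLp_of_bdd P ?_ C fun z hz => hC z.1 (subset_closure hz.1)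
  exact P.c_contDiffOn.continuousOn.comp continuous_fst.continuousOn
    fun z hz => subset_closure hz.1

/-- The operator `q ↦ c q` on `L²(Q_T)^N`. -/
noncomputable def cL (P : ParabolicData N) : P.L2v →L[ℝ] P.L2v :=
  (ContinuousLinearMap.id ℝ (Sp N →L[ℝ] Sp N)).holderL P.μQ ⊤ 2 2 (P.memLp_c.toLp _)

lemma coeFn_cL (P : ParabolicData N) (q : P.L2v) : P.cL q =ᵐ[P.μQ] fun z => P.c z.1 (q z) := by
  filter_upwards [ContinuousLinearMap.coeFn_holder (r := 2)
    (ContinuousLinearMap.id ℝ (Sp N →L[ℝ] Sp N)) (P.memLp_c.toLp _) q, P.memLp_c.coeFn_toLp]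
    with z h1 h2
  refine h1.trans ?_
  rw [h2]
  rfl

/-- The operator `φ ↦ d φ` on `L²(Q_T)`. -/
noncomputable def dL (P : ParabolicData N) : P.L2 →L[ℝ] P.L2 := mulL P.d_memLp

lemma coeFn_dL (P : ParabolicData N) (φ : P.L2) : P.dL φ =ᵐ[P.μQ] fun z => P.d z * φ z :=
  coeFn_mulL P.d_memLp φ

end ParabolicData

/-! ### The energy estimate -/

/-- A backward Gronwall lemma. -/
lemma add_mul_integral_le_of_le {e : ℝ → ℝ} {A K T : ℝ} (he : Continuous e) (hK : 0 < K)
    (hA : 0 ≤ A) (h : ∀ a ∈ Icc 0 T, e a ≤ A + K * ∫ t in a..T, e t) {a : ℝ} (ha : a ∈ Icc 0 T) :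
    A + K * ∫ t in a..T, e t ≤ A * Real.exp (K * T) := by
  -- By hypothesis this derivative is nonnegative on `[0, T]`, so the function is at most its value
  -- `A exp(KT)` at `T`.
  have hd : ∀ x, HasDerivAt (fun x => Real.exp (K * x) * (A + K * ∫ t in x..T, e t))
      (Real.exp (K * x) * K * (A + K * (∫ t in x..T, e t) - e x)) x := by
    intro x
    have d1 : HasDerivAt (fun x => ∫ t in x..T, e t) (-e x) x :=
      intervalIntegral.integral_hasDerivAt_left (he.intervalIntegrable _ _)
        (he.stronglyMeasurableAtFilter _ _) he.continuousAt
    have d2 : HasDerivAt (fun x => Real.exp (K * x)) (Real.exp (K * x) * K) x := by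
      simpa using ((hasDerivAt_id x).const_mul K).exp
    refine (d2.fun_mul ((d1.const_mul K).const_add A)).congr_deriv ?_
    ring
  have hmono : MonotoneOn (fun x => Real.exp (K * x) * (A + K * ∫ t in x..T, e t)) (Icc 0 T) := by
    refine monotoneOn_of_deriv_nonneg (convex_Icc _ _)
      (fun x _ => (hd x).continuousAt.continuousWithinAt)
      (fun x _ => (hd x).differentiableAt.differentiableWithinAt) fun x hx => ?_
    rw [interior_Icc] at hx
    rw [(hd x).deriv]
    exact mul_nonneg (by positivity) (sub_nonneg.2 (h x (Ioo_subset_Icc_self hx)))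
  have hT : T ∈ Icc 0 T := right_mem_Icc.2 (ha.1.trans ha.2)
  have hle := hmono ha hT ha.2
  simp only [intervalIntegral.integral_same, mul_zero, add_zero] at hle
  rw [mul_comm A]
  -- The factor `exp(Ka) ≥ 1` may be dropped only from a nonnegative quantity; a negative one
  -- satisfies the bound trivially.
  by_cases hs : 0 ≤ A + K * ∫ t in a..T, e t
  · refine le_trans ?_ hle
    exact le_mul_of_one_le_left hs (Real.one_le_exp (mul_nonneg hK.le ha.1))
  · exact (not_le.1 hs).le.trans (by positivity)

variable {P : ParabolicData N}

/-- The term `dφ` moves to the right-hand side. Freezing `Φ` outside `[0, T]` makes it continuous on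
the line and, because `Φ(T) = 0`, zero after `T`. -/
lemma HasIstar.isWeakSolution {φ g : P.L2} {σ q : P.L2v} {Φ : ℝ → Lp ℝ 2 (volume.restrict P.Ω)}
    (hΦ : ContinuousOn Φ (Icc 0 P.T)) (hT : Φ P.T = 0)
    (hs : ∀ᵐ t ∂(volume.restrict (Ioo 0 P.T)),
      (fun x => φ (x, t)) =ᵐ[volume.restrict P.Ω] Φ t)
    (hq : P.HasGradient φ q) (hg : P.HasIstar φ σ g) :
    P.IsWeakSolution φ (g - P.dL φ) σ q (fun t => Φ (projIcc 0 P.T P.T_pos.le t)) := by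
  refine ⟨?_, ?_, ?_, hq, ?_⟩
  · exact (continuousOn_iff_continuous_domRestrict.1 hΦ).comp continuous_projIcc
  · intro t ht
    rw [projIcc_of_right_le _ ht, hT]
  · filter_upwards [hs, ae_restrict_mem measurableSet_Ioo] with t h1 h2
    rwa [projIcc_of_mem _ (Ioo_subset_Icc_self h2)]
  · intro θ hθ
    have e := hg θ hθ
    have hθm : MemLp θ 2 P.μQ := memLp_C1 hθ.contDiffOn
    have i1 := integrable_pairing φ σ hθ
    have i2 : Integrable (fun z => P.dL φ z * θ z) P.μQ := (Lp.memLp _).integrable_mul hθm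
    have i3 : Integrable (fun z => g z * θ z) P.μQ := (Lp.memLp _).integrable_mul hθm
    have e1 : ∫ z, (φ z * dt θ z + inner ℝ (σ z) (gradx θ z)) ∂P.μQ
        = ∫ z, ((φ z * dt θ z + inner ℝ (σ z) (gradx θ z) + P.d z * φ z * θ z)
          - P.dL φ z * θ z) ∂P.μQ := by
      refine integral_congr_ae ?_
      filter_upwards [P.coeFn_dL φ] with z hz
      rw [hz]
      ring
    have e2 : ∫ z, (g - P.dL φ : P.L2) z * θ z ∂P.μQ
        = ∫ z, (g z * θ z - P.dL φ z * θ z) ∂P.μQ := by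
      refine integral_congr_ae ?_
      filter_upwards [Lp.coeFn_sub g (P.dL φ)] with z hz
      rw [hz, Pi.sub_apply, sub_mul]
    rw [e1, e2, integral_sub i1 i2, integral_sub i3 i2, e]

lemma setIntegral_norm_sq_eq {φ : P.L2} {Φ : ℝ → Lp ℝ 2 (volume.restrict P.Ω)}
    (hs : ∀ᵐ t ∂(volume.restrict (Ioo 0 P.T)),
      (fun x => φ (x, t)) =ᵐ[volume.restrict P.Ω] Φ t) {a : ℝ} (ha : a ∈ Icc 0 P.T) :
    ∫ z in P.Ω ×ˢ Ioo a P.T, ‖φ z‖ ^ 2 = ∫ t in a..P.T, ‖Φ t‖ ^ 2 := by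
  have hsub : P.Ω ×ˢ Ioo a P.T ⊆ P.Q := prod_mono le_rfl (Ioo_subset_Ioo_left ha.1)
  have hi : Integrable (fun z => ‖φ z‖ ^ 2) (volume.restrict (P.Ω ×ˢ Ioo a P.T)) :=
    (integrable_norm_sq φ).mono_measure (Measure.restrict_mono hsub le_rfl)
  rw [intervalIntegral.integral_of_le ha.2, integral_Ioc_eq_integral_Ioo]
  rw [Measure.volume_eq_prod, ← Measure.prod_restrict] at hi ⊢
  rw [integral_prod_symm _ hi]
  refine integral_congr_ae ?_
  filter_upwards [ae_mono (Measure.restrict_mono (Ioo_subset_Ioo_left ha.1) le_rfl) hs] with t ht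
  rw [norm_sq_eq_integral]
  refine integral_congr_ae ?_
  filter_upwards [ht] with x hx
  rw [← hx]

/-- The energy estimate for the backward equation `-φ_t - div (c ∇φ) + d φ = g - div J` with
`φ(·, T) = 0`, in terms of `σ = c ∇φ - J`. -/
theorem exists_energy_bound (P : ParabolicData N) : ∃ C : ℝ, 0 < C ∧
    ∀ (φ g : P.L2) (σ q : P.L2v) (Φ : ℝ → Lp ℝ 2 (volume.restrict P.Ω)),
      ContinuousOn Φ (Icc 0 P.T) → Φ P.T = 0 →
      (∀ᵐ t ∂(volume.restrict (Ioo 0 P.T)), (fun x => φ (x, t)) =ᵐ[volume.restrict P.Ω] Φ t) →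
      P.HasGradient φ q → P.HasIstar φ σ g →
      (∀ t ∈ Icc 0 P.T, ‖Φ t‖ ^ 2 ≤ C * (‖g‖ ^ 2 + ‖P.cL q - σ‖ ^ 2)) ∧
      ‖q‖ ^ 2 ≤ C * (‖g‖ ^ 2 + ‖P.cL q - σ‖ ^ 2) ∧
      ‖φ‖ ^ 2 ≤ C * (‖g‖ ^ 2 + ‖P.cL q - σ‖ ^ 2) := by
  obtain ⟨c₀, hc₀, hc⟩ := P.c_elliptic
  obtain ⟨D, hD0, hD⟩ : ∃ D : ℝ, 0 ≤ D ∧ ∀ᵐ z ∂P.μQ, |P.d z| ≤ D := by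
    refine ⟨(eLpNorm P.d ⊤ P.μQ).toReal, ENNReal.toReal_nonneg, ?_⟩
    have hfin : eLpNorm P.d ⊤ P.μQ ≠ ⊤ := P.d_memLp.2.ne
    filter_upwards [ae_le_eLpNormEssSup (f := P.d) (μ := P.μQ)] with z hz
    rw [← eLpNorm_exponent_top] at hz
    rw [← Real.norm_eq_abs, ← toReal_enorm]
    exact ENNReal.toReal_mono hfin hz
  have hT := P.T_pos
  -- In `K`, the `1` comes from `2gφ ≤ g² + φ²` and `2D` from the potential. `C₁` is the Gronwall
  -- factor times the constant in `A ≤ (1 + c₀⁻¹) S`. In the final constant the summands `1`, `c₀⁻¹`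
  -- and `T` serve the bounds on `Φ(t)`, on `q`, and on `φ` after integration in time.
  set K := 1 + 2 * D with hK
  set C₁ := Real.exp (K * P.T) * (1 + c₀⁻¹) with hC₁
  have hC₁pos : 0 < C₁ := by positivity
  refine ⟨C₁ * (1 + c₀⁻¹ + P.T), by positivity, ?_⟩
  intro φ g σ q Φ hΦ hΦT hs hq hg
  have hw := HasIstar.isWeakSolution hΦ hΦT hs hq hg
  set Ψ : ℝ → Lp ℝ 2 (volume.restrict P.Ω) := fun t => Φ (projIcc 0 P.T P.T_pos.le t) with hΨ
  set J := P.cL q - σ with hJ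
  set S := ‖g‖ ^ 2 + ‖J‖ ^ 2 with hS
  have hS0 : 0 ≤ S := by positivity
  set A := ‖g‖ ^ 2 + c₀⁻¹ * ‖J‖ ^ 2 with hA
  have hA0 : 0 ≤ A := by positivity
  have hAS : A ≤ (1 + c₀⁻¹) * S := by
    have h1 : 0 ≤ c₀⁻¹ * ‖g‖ ^ 2 := by positivity
    have h2 : 0 ≤ ‖J‖ ^ 2 := by positivity
    rw [hA, hS]
    linarith
  -- With `σ = c q - J`, ellipticity gives `-2c₀|q|²`, and Young's inequality for `2 J·q` uses up
  -- half of it.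
  have hpt : ∀ᵐ z ∂P.μQ, 2 * ((g - P.dL φ : P.L2) z * φ z - inner ℝ (σ z) (q z))
      ≤ (‖g z‖ ^ 2 + c₀⁻¹ * ‖J z‖ ^ 2) + K * ‖φ z‖ ^ 2 - c₀ * ‖q z‖ ^ 2 := by
    filter_upwards [hD, Lp.coeFn_sub g (P.dL φ), P.coeFn_dL φ, P.coeFn_cL q,
      Lp.coeFn_sub (P.cL q) σ, ae_Q (P := P) (p := fun z => z ∈ P.Q) fun _ h => h]
      with z h1 h2 h3 h4 h5 h6
    have h7 : σ z = P.c z.1 (q z) - J z := by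
      rw [hJ, h5, Pi.sub_apply, h4]
      abel
    rw [h2, Pi.sub_apply, h3, h7, inner_sub_left]
    have h8 := hc z.1 (subset_closure h6.1) (q z)
    have h9 : inner ℝ (J z) (q z) ≤ ‖J z‖ * ‖q z‖ := real_inner_le_norm _ _
    have h10 : 2 * (‖J z‖ * ‖q z‖) ≤ c₀⁻¹ * ‖J z‖ ^ 2 + c₀ * ‖q z‖ ^ 2 := by
      have : 0 ≤ c₀⁻¹ * (‖J z‖ - c₀ * ‖q z‖) ^ 2 := by positivity
      have e : c₀⁻¹ * (‖J z‖ - c₀ * ‖q z‖) ^ 2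
          = c₀⁻¹ * ‖J z‖ ^ 2 - 2 * (‖J z‖ * ‖q z‖) + c₀ * ‖q z‖ ^ 2 := by
        field_simp
        ring
      linarith
    have h11 : -(P.d z * φ z * φ z) ≤ D * φ z ^ 2 := by
      have := (abs_le.1 h1).1
      nlinarith [sq_nonneg (φ z)]
    have h12 : 2 * (g z * φ z) ≤ g z ^ 2 + φ z ^ 2 := by nlinarith [sq_nonneg (g z - φ z)]
    simp only [Real.norm_eq_abs (φ z), Real.norm_eq_abs (g z), sq_abs, hK]
    nlinarith
  have hineq : ∀ a ∈ Icc 0 P.T, ‖Ψ a‖ ^ 2 + c₀ * ∫ z in P.Ω ×ˢ Ioo a P.T, ‖q z‖ ^ 2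
      ≤ A + K * ∫ t in a..P.T, ‖Ψ t‖ ^ 2 := by
    intro a ha
    have hsub : P.Ω ×ˢ Ioo a P.T ⊆ P.Q := prod_mono le_rfl (Ioo_subset_Ioo_left ha.1)
    have hle : volume.restrict (P.Ω ×ˢ Ioo a P.T) ≤ P.μQ := Measure.restrict_mono hsub le_rfl
    have i1 : Integrable (fun z => ‖g z‖ ^ 2 + c₀⁻¹ * ‖J z‖ ^ 2) P.μQ :=
      (integrable_norm_sq g).add ((integrable_norm_sq J).const_mul _)
    have i2 : Integrable (fun z => K * ‖φ z‖ ^ 2) P.μQ := (integrable_norm_sq φ).const_mul _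
    have i3 : Integrable (fun z => c₀ * ‖q z‖ ^ 2) P.μQ := (integrable_norm_sq q).const_mul _
    have i4 : Integrable (fun z => 2 * ((g - P.dL φ : P.L2) z * φ z - inner ℝ (σ z) (q z))) P.μQ :=
      (((Lp.memLp _).integrable_mul (Lp.memLp φ)).sub
        (integrable_inner_of_memLp (Lp.memLp σ) (Lp.memLp q))).const_mul 2
    have e1 := hw.energy_le ha
    rw [← integral_const_mul] at e1
    have e2 := integral_mono_ae (i4.mono_measure hle)
      (((i1.add i2).sub i3).mono_measure hle) (ae_mono hle hpt)
    have e3 : ∫ z in P.Ω ×ˢ Ioo a P.T,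
        ((fun z => ‖g z‖ ^ 2 + c₀⁻¹ * ‖J z‖ ^ 2) + (fun z => K * ‖φ z‖ ^ 2)
          - fun z => c₀ * ‖q z‖ ^ 2) z
        = (∫ z in P.Ω ×ˢ Ioo a P.T, (‖g z‖ ^ 2 + c₀⁻¹ * ‖J z‖ ^ 2))
          + (K * ∫ z in P.Ω ×ˢ Ioo a P.T, ‖φ z‖ ^ 2)
          - c₀ * ∫ z in P.Ω ×ˢ Ioo a P.T, ‖q z‖ ^ 2 := by
      rw [← integral_const_mul, ← integral_const_mul]
      refine (integral_sub ((i1.add i2).mono_measure hle) (i3.mono_measure hle)).trans ?_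
      exact congrArg (· - _) (integral_add (i1.mono_measure hle) (i2.mono_measure hle))
    have e4 : ∫ z in P.Ω ×ˢ Ioo a P.T, (‖g z‖ ^ 2 + c₀⁻¹ * ‖J z‖ ^ 2) ≤ A := by
      rw [hA, norm_sq_eq_integral, norm_sq_eq_integral, ← integral_const_mul,
        ← integral_add (integrable_norm_sq g) ((integrable_norm_sq J).const_mul _)]
      exact integral_mono_measure hle (Eventually.of_forall fun z => by positivity) i1
    rw [setIntegral_norm_sq_eq hw.slice ha] at e3
    linarith
  have hcont : Continuous fun t => ‖Ψ t‖ ^ 2 := hw.cont.norm.pow 2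
  have hnn : ∀ a, 0 ≤ c₀ * ∫ z in P.Ω ×ˢ Ioo a P.T, ‖q z‖ ^ 2 := fun a =>
    mul_nonneg hc₀.le (integral_nonneg fun z => by positivity)
  -- Gronwall is applied to `‖Ψ‖²` alone. Its conclusion bounds the right-hand side of `hineq`,
  -- which still controls the gradient term.
  have hgr : ∀ a ∈ Icc 0 P.T,
      ‖Ψ a‖ ^ 2 + c₀ * ∫ z in P.Ω ×ˢ Ioo a P.T, ‖q z‖ ^ 2 ≤ C₁ * S := by
    intro a ha
    refine (hineq a ha).trans ((add_mul_integral_le_of_le hcont (by positivity) hA0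
      (fun b hb => by linarith [hineq b hb, hnn b]) ha).trans ?_)
    rw [hC₁, mul_comm A, mul_assoc]
    exact mul_le_mul_of_nonneg_left hAS (by positivity)
  have hΨb : ∀ t ∈ Icc 0 P.T, ‖Ψ t‖ ^ 2 ≤ C₁ * S := fun t ht => by linarith [hgr t ht, hnn t]
  have h0 : (0 : ℝ) ∈ Icc 0 P.T := left_mem_Icc.2 hT.le
  have hCS : 0 ≤ C₁ * S := by positivity
  have b1 : 0 ≤ C₁ * S * c₀⁻¹ := by positivity
  have b2 : 0 ≤ C₁ * S * P.T := by positivity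
  refine ⟨fun t ht => ?_, ?_, ?_⟩
  · have := hΨb t ht
    rw [hΨ] at this
    simp only [projIcc_of_mem _ ht] at this
    linarith
  · have h1 := hgr 0 h0
    have h2 : ∫ z in P.Ω ×ˢ Ioo 0 P.T, ‖q z‖ ^ 2 = ‖q‖ ^ 2 := (norm_sq_eq_integral q).symm
    rw [h2] at h1
    have h3 : c₀ * ‖q‖ ^ 2 ≤ C₁ * S := by nlinarith [sq_nonneg ‖Ψ 0‖]
    have h4 : ‖q‖ ^ 2 ≤ C₁ * S * c₀⁻¹ := by
      rw [← div_eq_mul_inv, le_div_iff₀ hc₀]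
      linarith
    linarith
  · have h2 : ∫ z in P.Ω ×ˢ Ioo 0 P.T, ‖φ z‖ ^ 2 = ‖φ‖ ^ 2 := (norm_sq_eq_integral φ).symm
    rw [← h2, setIntegral_norm_sq_eq hw.slice h0]
    have h3 : ∫ t in (0 : ℝ)..P.T, ‖Ψ t‖ ^ 2 ≤ ∫ _ in (0 : ℝ)..P.T, C₁ * S :=
      intervalIntegral.integral_mono_on hT.le (hcont.intervalIntegrable _ _) (by simp) hΨb
    rw [intervalIntegral.integral_const, sub_zero, smul_eq_mul] at h3
    linarith

/-! ### Uniqueness of weak derivatives -/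

lemma ae_eq_zero_of_forall_test {E F : Type*} [NormedAddCommGroup E] [NormedSpace ℝ E]
    [FiniteDimensional ℝ E] [MeasurableSpace E] [BorelSpace E] [NormedAddCommGroup F]
    [NormedSpace ℝ F] [CompleteSpace F] {μ : Measure E} {U : Set E} (hU : IsOpen U) {f : E → F}
    (hf : IntegrableOn f U μ)
    (h : ∀ χ : E → ℝ, IsTest U χ → ∫ x in U, χ x • f x ∂μ = 0) : f =ᵐ[μ.restrict U] 0 := by
  refine (ae_restrict_iff' hU.measurableSet).2
    (hU.ae_eq_zero_of_integral_contDiff_smul_eq_zero hf.locallyIntegrableOn ?_)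
  intro χ h1 h2 h3
  rw [← h χ ⟨h1, h2, h3⟩]
  refine (setIntegral_eq_integral_of_forall_compl_eq_zero fun x hx => ?_).symm
  rw [image_eq_zero_of_notMem_tsupport fun hh => hx (h3 hh), zero_smul]

/-! ### Integration by parts, uniqueness of gradients and closedness in `H¹₀(Ω)` -/

section H10

variable {N : ℕ} {Ω : Set (Sp N)}

lemma IsTest.memLp_fderiv_apply {χ : Sp N → ℝ} (hχ : IsTest Ω χ) (e : Sp N)
    (μ : Measure (Sp N)) [IsFiniteMeasureOnCompacts μ] :
    MemLp (fun x => fderiv ℝ χ x e) 2 μ :=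
  ((hχ.1.continuous_fderiv (by simp)).clm_apply continuous_const).memLp_of_hasCompactSupport
    (hχ.2.1.fderiv_apply ℝ e)

lemma inner_gradient (θ : Sp N → ℝ) (x e : Sp N) :
    inner ℝ e (gradient θ x) = fderiv ℝ θ x e := by
  rw [real_inner_comm, gradient, InnerProductSpace.toDual_symm_apply]

/-- Integration by parts in `H¹₀(Ω)`. -/
lemma IsH10.setIntegral_inner_eq {u : Sp N → ℝ} {v : Sp N → Sp N} (h : IsH10 Ω u v)
    {χ : Sp N → ℝ} (hχ : IsTest Ω χ) (e : Sp N) :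
    ∫ x in Ω, inner ℝ (χ x • e) (v x) = - ∫ x in Ω, inner ℝ (fderiv ℝ χ x e) (u x) := by
  obtain ⟨hu, hv, θ, hθ, h1, h2⟩ := h
  have hχe : MemLp (fun x => χ x • e) 2 (volume.restrict Ω) :=
    (hχ.1.continuous.smul continuous_const).memLp_of_hasCompactSupport hχ.2.1.smul_right
  have t1 := tendsto_integral_inner hχe (fun n => (hθ n).memLp_gradient _) hv h2
  have t2 := tendsto_integral_inner (hχ.memLp_fderiv_apply e (volume.restrict Ω))
    (fun n => (hθ n).memLp_fst _) hu h1
  refine tendsto_nhds_unique t1 (t2.neg.congr fun n => ?_)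
  have hz : ∀ x, x ∉ Ω → χ x = 0 ∧ fderiv ℝ χ x = 0 := fun x hx =>
    ⟨image_eq_zero_of_notMem_tsupport fun hh => hx (hχ.2.2 hh),
      image_eq_zero_of_notMem_tsupport fun hh => hx (hχ.2.2 (tsupport_fderiv_subset ℝ hh))⟩
  rw [setIntegral_eq_integral_of_forall_compl_eq_zero fun x hx => by simp [(hz x hx).2],
    setIntegral_eq_integral_of_forall_compl_eq_zero fun x hx => by simp [(hz x hx).1]]
  have e1 := integral_mul_fderiv_eq_neg_fderiv_mul_of_integrable (μ := volume) (f := χ)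
    (g := θ n) (v := e)
    ((hχ.memLp_fderiv_apply e volume).integrable_mul ((hθ n).memLp_fst _))
    ((hχ.memLp_fst volume).integrable_mul ((hθ n).memLp_fderiv_apply e volume))
    ((hχ.memLp_fst volume).integrable_mul ((hθ n).memLp_fst _))
    (fun x _ => hχ.differentiable x) (fun x _ => (hθ n).differentiable x)
  simp only [inner_smul_left, inner_gradient, Real.inner_apply, RCLike.conj_to_real]
  rw [e1]

/-- Integration by parts expresses every `∫ χ e·v` through `u`. Together with `HasIstar.unique`,
this makes the `∇φ` and `I*(φ, σ)` selected by choice linear on `Ψ`. -/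
lemma IsH10.ae_eq (hΩ : IsOpen Ω) (hb : Bornology.IsBounded Ω) {u : Sp N → ℝ}
    {v v' : Sp N → Sp N} (h : IsH10 Ω u v) (h' : IsH10 Ω u v') : v =ᵐ[volume.restrict Ω] v' := by
  have hfin : IsFiniteMeasure (volume.restrict Ω) :=
    ⟨by rw [Measure.restrict_apply_univ]; exact hb.measure_lt_top⟩
  have hv := h.2.1
  have hv' := h'.2.1
  have hi : IntegrableOn (fun x => v x - v' x) Ω :=
    (hv.integrable one_le_two).sub (hv'.integrable one_le_two)
  have key := ae_eq_zero_of_forall_test hΩ hi fun χ hχ => ?_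
  · filter_upwards [key] with x hx
    exact sub_eq_zero.1 hx
  · refine ext_inner_left ℝ fun e => ?_
    have hχe : MemLp (fun x => χ x • e) 2 (volume.restrict Ω) :=
      (hχ.1.continuous.smul continuous_const).memLp_of_hasCompactSupport hχ.2.1.smul_right
    have hχi : IntegrableOn (fun x => χ x • (v x - v' x)) Ω := by
      obtain ⟨C, hC⟩ := hχ.1.continuous.bounded_above_of_compact_support hχ.2.1
      exact hi.bdd_smul C hχ.1.continuous.aestronglyMeasurable (Eventually.of_forall hC)
    rw [inner_zero_right, ← integral_inner hχi]
    have e1 := h.setIntegral_inner_eq hχ e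
    rw [← h'.setIntegral_inner_eq hχ e, ← sub_eq_zero,
      ← integral_sub (integrable_inner_of_memLp hχe hv) (integrable_inner_of_memLp hχe hv')] at e1
    rw [← e1]
    refine integral_congr_ae (Eventually.of_forall fun x => ?_)
    simp only [inner_smul_left, inner_smul_right, inner_sub_right, RCLike.conj_to_real]
    ring

/-- `H¹₀(Ω)` is closed in `L²(Ω) × L²(Ω)^N`. -/
lemma IsH10.of_tendsto {u : ℕ → Sp N → ℝ} {v : ℕ → Sp N → Sp N} {u' : Sp N → ℝ}
    {v' : Sp N → Sp N} (h : ∀ n, IsH10 Ω (u n) (v n))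
    (hu'm : AEStronglyMeasurable u' (volume.restrict Ω))
    (hv'm : AEStronglyMeasurable v' (volume.restrict Ω))
    (hu : Tendsto (fun n => eLpNorm (fun x => u n x - u' x) 2 (volume.restrict Ω)) atTop (𝓝 0))
    (hv : Tendsto (fun n => eLpNorm (fun x => v n x - v' x) 2 (volume.restrict Ω)) atTop (𝓝 0)) :
    IsH10 Ω u' v' := by
  have hmem : ∀ {F : Type} [NormedAddCommGroup F] {w : ℕ → Sp N → F} {w' : Sp N → F},
      (∀ n, MemLp (w n) 2 (volume.restrict Ω)) → AEStronglyMeasurable w' (volume.restrict Ω) →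
      Tendsto (fun n => eLpNorm (fun x => w n x - w' x) 2 (volume.restrict Ω)) atTop (𝓝 0) →
      MemLp w' 2 (volume.restrict Ω) := by
    intro F _ w w' hw hw' hlim
    obtain ⟨n, hn⟩ := (hlim.eventually_lt_const ENNReal.zero_lt_top).exists
    have h1 : MemLp (fun x => w n x - w' x) 2 (volume.restrict Ω) := ⟨(hw n).1.sub hw', hn⟩
    refine (memLp_congr_ae (Eventually.of_forall fun x => ?_)).1 ((hw n).sub h1)
    simp
  have hu' := hmem (fun n => (h n).1) hu'm hu
  have hv' := hmem (fun n => (h n).2.1) hv'm hv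
  -- A diagonal choice: half of the error `1/m` is spent on reaching some `u n`, half on a test
  -- function near it. For `m = 0` the bound is `∞`, which is harmless.
  have happ : ∀ m : ℕ, ∃ θ : Sp N → ℝ, IsTest Ω θ ∧
      eLpNorm (fun x => θ x - u' x) 2 (volume.restrict Ω) ≤ (m : ℝ≥0∞)⁻¹ ∧
      eLpNorm (fun x => gradient θ x - v' x) 2 (volume.restrict Ω) ≤ (m : ℝ≥0∞)⁻¹ := by
    intro m
    have hpos : (0 : ℝ≥0∞) < (m : ℝ≥0∞)⁻¹ / 2 :=
      ENNReal.half_pos (ENNReal.inv_ne_zero.2 (ENNReal.natCast_ne_top m))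
    obtain ⟨n, hn1, hn2⟩ := ((hu.eventually_lt_const hpos).and (hv.eventually_lt_const hpos)).exists
    obtain ⟨-, -, θ, hθ, k1, k2⟩ := h n
    obtain ⟨j, hj1, hj2⟩ := ((k1.eventually_lt_const hpos).and (k2.eventually_lt_const hpos)).exists
    refine ⟨θ j, hθ j, ?_, ?_⟩
    · have e := eLpNorm_add_le (p := 2) ((hθ j).1.continuous.aestronglyMeasurable.sub (h n).1.1)
        ((h n).1.1.sub hu'm) one_le_two
      rw [sub_add_sub_cancel] at e
      exact e.trans ((add_le_add hj1.le hn1.le).trans (ENNReal.add_halves _).le)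
    · have e := eLpNorm_add_le (p := 2) ((hθ j).gradient_continuous.aestronglyMeasurable.sub
        (h n).2.1.1) ((h n).2.1.1.sub hv'm) one_le_two
      rw [sub_add_sub_cancel] at e
      exact e.trans ((add_le_add hj2.le hn2.le).trans (ENNReal.add_halves _).le)
  choose θ hθ h1 h2 using happ
  exact ⟨hu', hv', θ, hθ,
    tendsto_of_tendsto_of_tendsto_of_le_of_le tendsto_const_nhds
      ENNReal.tendsto_inv_nat_nhds_zero (fun _ => bot_le) h1,
    tendsto_of_tendsto_of_tendsto_of_le_of_le tendsto_const_nhds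
      ENNReal.tendsto_inv_nat_nhds_zero (fun _ => bot_le) h2⟩

end H10

variable {N : ℕ} {P : ParabolicData N}

/-- Unlike its converse `ae_slice`, this direction of Fubini needs a measurable set. -/
lemma ae_of_ae_slice {p : SpT N → Prop} (hp : MeasurableSet {z | p z})
    (h : ∀ᵐ t ∂(volume.restrict (Ioo 0 P.T)), ∀ᵐ x ∂(volume.restrict P.Ω), p (x, t)) :
    ∀ᵐ z ∂P.μQ, p z := by
  rw [μQ_eq_prod, ← Measure.prod_swap, ae_map_iff measurable_swap.aemeasurable hp]
  exact (Measure.ae_prod_iff_ae_ae (p := fun z : ℝ × Sp N => p z.swap) (measurable_swap hp)).2 h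

lemma HasGradient.unique {φ : P.L2} {q q' : P.L2v} (h : P.HasGradient φ q)
    (h' : P.HasGradient φ q') : q = q' := by
  refine Lp.ext (ae_of_ae_slice (measurableSet_eq_fun (Lp.stronglyMeasurable q).measurable
    (Lp.stronglyMeasurable q').measurable) ?_)
  filter_upwards [h, h'] with t h1 h2
  exact h1.ae_eq P.isOpen P.isBounded h2

lemma HasIstar.unique {φ g g' : P.L2} {σ : P.L2v} (h : P.HasIstar φ σ g)
    (h' : P.HasIstar φ σ g') : g = g' := by
  have hi : IntegrableOn (fun z => g z - g' z) P.Q :=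
    (Lp.memLp g).integrable one_le_two |>.sub ((Lp.memLp g').integrable one_le_two)
  have key := ae_eq_zero_of_forall_test (Q_open P) hi fun θ hθ => ?_
  · refine Lp.ext ?_
    filter_upwards [key] with z hz
    exact sub_eq_zero.1 hz
  · have hθm : MemLp θ 2 P.μQ := memLp_C1 hθ.contDiffOn
    have e := (h θ hθ).symm.trans (h' θ hθ)
    have i1 : Integrable (fun z => g z * θ z) P.μQ := (Lp.memLp g).integrable_mul hθm
    have i2 : Integrable (fun z => g' z * θ z) P.μQ := (Lp.memLp g').integrable_mul hθm
    rw [← sub_eq_zero, ← integral_sub i1 i2] at e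
    rw [← e]
    refine integral_congr_ae (Eventually.of_forall fun z => ?_)
    simp only [smul_eq_mul]
    ring

variable {N : ℕ} {P : ParabolicData N}

/-! ### Completeness of the space of adjoint states -/

lemma lintegral_μQ {F : SpT N → ℝ≥0∞} (hF : Measurable F) :
    ∫⁻ z, F z ∂P.μQ = ∫⁻ t in Ioo 0 P.T, ∫⁻ x in P.Ω, F (x, t) := by
  rw [μQ_eq_prod]
  exact lintegral_prod_symm' _ hF

/-- By Fubini the squared norms of the slices integrate to the squared norm on `Q_T`. Along a
subsequence where the latter is below `2⁻ᵏ`, the former are summable for almost every `t`, hence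
tend to zero. -/
lemma exists_subseq_tendsto_slice {E : Type*} [NormedAddCommGroup E] {f : ℕ → Lp E 2 P.μQ}
    {f' : Lp E 2 P.μQ} (h : Tendsto f atTop (𝓝 f')) :
    ∃ ns : ℕ → ℕ, StrictMono ns ∧ ∀ᵐ t ∂(volume.restrict (Ioo 0 P.T)),
      Tendsto (fun k => eLpNorm (fun x => f (ns k) (x, t) - f' (x, t)) 2 (volume.restrict P.Ω))
        atTop (𝓝 0) := by
  have h0 : Tendsto (fun n => eLpNorm (fun z => f n z - f' z) 2 P.μQ ^ (2 : ℝ)) atTop (𝓝 0) := by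
    have h1 := (Lp.tendsto_Lp_iff_tendsto_eLpNorm' f f').1 h
    have h2 := (ENNReal.continuous_rpow_const (y := 2)).tendsto 0 |>.comp h1
    rw [ENNReal.zero_rpow_of_pos two_pos] at h2
    exact h2
  obtain ⟨ns, hns, hle⟩ := extraction_forall_of_eventually
    (P := fun k n => eLpNorm (fun z => f n z - f' z) 2 P.μQ ^ (2 : ℝ) < (2⁻¹ : ℝ≥0∞) ^ k)
    fun k => h0.eventually_lt_const (ENNReal.pow_pos (ENNReal.inv_pos.2 ENNReal.ofNat_ne_top) k)
  refine ⟨ns, hns, ?_⟩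
  have hsm : ∀ k, StronglyMeasurable fun z => f (ns k) z - f' z := fun k =>
    (Lp.stronglyMeasurable _).sub (Lp.stronglyMeasurable _)
  have hms : ∀ k, Measurable fun z => ‖f (ns k) z - f' z‖ₑ ^ (2 : ℝ) := fun k =>
    (hsm k).enorm.pow_const _
  have hsq : ∀ {α : Type} [MeasurableSpace α] (μ : Measure α) (w : α → E),
      eLpNorm w 2 μ ^ (2 : ℝ) = ∫⁻ x, ‖w x‖ₑ ^ (2 : ℝ) ∂μ := by
    intro α _ μ w
    have := eLpNorm_nnreal_pow_eq_lintegral (μ := μ) (f := w) (p := 2) two_ne_zero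
    simpa using this
  have hfub : ∀ k, ∫⁻ t in Ioo 0 P.T, ∫⁻ x in P.Ω, ‖f (ns k) (x, t) - f' (x, t)‖ₑ ^ (2 : ℝ)
      ≤ (2⁻¹ : ℝ≥0∞) ^ k := by
    intro k
    refine le_trans (le_of_eq ?_) (hle k).le
    rw [hsq, lintegral_μQ (hms k)]
  have hmeas : ∀ k, Measurable fun t => ∫⁻ x in P.Ω, ‖f (ns k) (x, t) - f' (x, t)‖ₑ ^ (2 : ℝ) :=
    fun k => (hms k).lintegral_prod_left'
  have hsum : ∫⁻ t in Ioo 0 P.T, ∑' k, ∫⁻ x in P.Ω, ‖f (ns k) (x, t) - f' (x, t)‖ₑ ^ (2 : ℝ)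
      ≠ ∞ := by
    rw [lintegral_tsum fun k => (hmeas k).aemeasurable]
    refine ne_top_of_le_ne_top ?_ (ENNReal.tsum_le_tsum hfub)
    rw [ENNReal.tsum_geometric]
    simp
  filter_upwards [ae_lt_top (Measurable.tsum hmeas) hsum] with t ht
  have h1 := ENNReal.tendsto_atTop_zero_of_tsum_ne_top ht.ne
  have h2 := (ENNReal.continuous_rpow_const (y := 2⁻¹)).tendsto 0 |>.comp h1
  rw [ENNReal.zero_rpow_of_pos (by norm_num)] at h2
  refine h2.congr fun k => ?_
  simp only [Function.comp_apply]
  rw [← hsq (volume.restrict P.Ω) (fun x => f (ns k) (x, t) - f' (x, t)), ← ENNReal.rpow_mul]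
  norm_num

lemma HasGradient.of_tendsto {φ : ℕ → P.L2} {q : ℕ → P.L2v} {φ' : P.L2} {q' : P.L2v}
    (h : ∀ n, P.HasGradient (φ n) (q n)) (hφ : Tendsto φ atTop (𝓝 φ'))
    (hq : Tendsto q atTop (𝓝 q')) : P.HasGradient φ' q' := by
  obtain ⟨ns, hns, h1⟩ := exists_subseq_tendsto_slice hφ
  -- The second extraction is made inside the first, so that one subsequence serves both `φ` and
  -- `q`.
  obtain ⟨ms, hms, h2⟩ := exists_subseq_tendsto_slice (hq.comp hns.tendsto_atTop)
  filter_upwards [h1, h2, ae_all_iff.2 h] with t k1 k2 k3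
  exact IsH10.of_tendsto (fun n => k3 (ns (ms n)))
    ((Lp.stronglyMeasurable φ').comp_measurable measurable_prodMk_right).aestronglyMeasurable
    ((Lp.stronglyMeasurable q').comp_measurable measurable_prodMk_right).aestronglyMeasurable
    (k1.comp hms.tendsto_atTop) k2

/-- As a family of identities between scalar products in `L²`, the equation is visibly stable under
limits. -/
lemma hasIstar_iff {φ g : P.L2} {σ : P.L2v} : P.HasIstar φ σ g ↔
    ∀ (θ : SpT N → ℝ) (hθ : IsTest P.Q θ),
      inner ℝ φ ((memLp_dt (P := P) hθ.contDiffOn).toLp (dt θ))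
        + inner ℝ σ ((memLp_gradx (P := P) hθ.contDiffOn).toLp (gradx θ))
        + inner ℝ (P.dL φ) ((memLp_C1 (P := P) (p := 2) hθ.contDiffOn).toLp θ)
      = inner ℝ g ((memLp_C1 (P := P) (p := 2) hθ.contDiffOn).toLp θ) := by
  refine forall₂_congr fun θ hθ => ?_
  have m1 := memLp_dt (P := P) (y := θ) hθ.contDiffOn
  have m2 := memLp_gradx (P := P) (y := θ) hθ.contDiffOn
  have m3 := memLp_C1 (P := P) (p := 2) (f := θ) hθ.contDiffOn
  have e1 : inner ℝ φ (m1.toLp (dt θ)) + inner ℝ σ (m2.toLp (gradx θ))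
      + inner ℝ (P.dL φ) (m3.toLp θ)
      = ∫ z, (φ z * dt θ z + inner ℝ (σ z) (gradx θ z) + P.d z * φ z * θ z) ∂P.μQ := by
    rw [L2.inner_def, L2.inner_def, L2.inner_def,
      ← integral_add (L2.integrable_inner _ _) (L2.integrable_inner _ _),
      ← integral_add ((L2.integrable_inner _ _).add (L2.integrable_inner _ _))
        (L2.integrable_inner _ _)]
    refine integral_congr_ae ?_
    filter_upwards [m1.coeFn_toLp, m2.coeFn_toLp, m3.coeFn_toLp, P.coeFn_dL φ] with z h1 h2 h3 h4
    rw [h1, h2, h3, h4, Real.inner_apply, Real.inner_apply]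
  have e2 : inner ℝ g (m3.toLp θ) = ∫ z, g z * θ z ∂P.μQ := by
    rw [L2.inner_def]
    refine integral_congr_ae ?_
    filter_upwards [m3.coeFn_toLp] with z h1
    rw [h1, Real.inner_apply]
  rw [e1, e2]

lemma HasIstar.of_tendsto {φ g : ℕ → P.L2} {σ : ℕ → P.L2v} {φ' g' : P.L2} {σ' : P.L2v}
    (h : ∀ n, P.HasIstar (φ n) (σ n) (g n)) (hφ : Tendsto φ atTop (𝓝 φ'))
    (hσ : Tendsto σ atTop (𝓝 σ')) (hg : Tendsto g atTop (𝓝 g')) : P.HasIstar φ' σ' g' := by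
  refine hasIstar_iff.2 fun θ hθ => ?_
  have hd : Tendsto (fun n => P.dL (φ n)) atTop (𝓝 (P.dL φ')) :=
    (P.dL.continuous.tendsto _).comp hφ
  refine tendsto_nhds_unique ((((hφ.inner tendsto_const_nhds).add (hσ.inner tendsto_const_nhds)).add
    (hd.inner tendsto_const_nhds)).congr fun n => ?_) (hg.inner tendsto_const_nhds)
  exact hasIstar_iff.1 (h n) θ hθ

namespace ParabolicData

/-- `(φ, σ)` satisfies the conditions that define `Ψ`, apart from the weighted one, with
continuous representative `Φ`, gradient `q` and `I*(φ, σ) = g`. -/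
structure IsAdjointState (P : ParabolicData N) (φ g : P.L2) (σ q : P.L2v)
    (Φ : ℝ → Lp ℝ 2 (volume.restrict P.Ω)) : Prop where
  cont : ContinuousOn Φ (Icc 0 P.T)
  zero : Φ P.T = 0
  slice : ∀ᵐ t ∂(volume.restrict (Ioo 0 P.T)), (fun x => φ (x, t)) =ᵐ[volume.restrict P.Ω] Φ t
  grad : P.HasGradient φ q
  istar : P.HasIstar φ σ g

lemma IsAdjointState.sub {φ φ' g g' : P.L2} {σ σ' q q' : P.L2v}
    {Φ Φ' : ℝ → Lp ℝ 2 (volume.restrict P.Ω)} (h : P.IsAdjointState φ g σ q Φ)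
    (h' : P.IsAdjointState φ' g' σ' q' Φ') :
    P.IsAdjointState (φ - φ') (g - g') (σ - σ') (q - q') (fun t => Φ t - Φ' t) := by
  refine ⟨h.cont.sub h'.cont, by simp [h.zero, h'.zero], ?_, ?_, ?_⟩
  · filter_upwards [h.slice, h'.slice, ae_slice (Lp.coeFn_sub φ φ')] with t k1 k2 k3
    filter_upwards [k1, k2, k3, Lp.coeFn_sub (Φ t) (Φ' t)] with x l1 l2 l3 l4
    rw [l3, l4, Pi.sub_apply, Pi.sub_apply, l1, l2]
  · have := HasGradient.add h.grad (HasGradient.smul (-1) h'.grad)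
    rwa [neg_one_smul, neg_one_smul, ← sub_eq_add_neg, ← sub_eq_add_neg] at this
  · have := HasIstar.add h.istar (HasIstar.smul (-1) h'.istar)
    rwa [neg_one_smul, neg_one_smul, neg_one_smul, ← sub_eq_add_neg, ← sub_eq_add_neg,
      ← sub_eq_add_neg] at this

/-- The space of adjoint states is complete. -/
theorem IsAdjointState.exists_limit {φ g : ℕ → P.L2} {σ q : ℕ → P.L2v}
    {Φ : ℕ → ℝ → Lp ℝ 2 (volume.restrict P.Ω)} {g' : P.L2} {σ' q' : P.L2v}
    (h : ∀ n, P.IsAdjointState (φ n) (g n) (σ n) (q n) (Φ n)) (hg : Tendsto g atTop (𝓝 g'))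
    (hσ : Tendsto σ atTop (𝓝 σ')) (hq : Tendsto q atTop (𝓝 q')) :
    ∃ φ' Φ', P.IsAdjointState φ' g' σ' q' Φ' := by
  obtain ⟨C, hC, hb⟩ := exists_energy_bound P
  set J : ℕ → P.L2v := fun n => P.cL (q n) - σ n with hJ
  have hJlim : Tendsto J atTop (𝓝 (P.cL q' - σ')) := ((P.cL.continuous.tendsto _).comp hq).sub hσ
  -- The energy estimate for differences: the Cauchy property of `g n` and `J n` passes to `φ n` in
  -- `L²(Q_T)` and, uniformly on `[0, T]`, to `Φ n`. No convergence of `φ n` is assumed.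
  have hbd : ∀ n m, (∀ t ∈ Icc 0 P.T, dist (Φ n t) (Φ m t)
        ≤ √C * (dist (g n) (g m) + dist (J n) (J m))) ∧
      dist (φ n) (φ m) ≤ √C * (dist (g n) (g m) + dist (J n) (J m)) := by
    intro n m
    have hs := (h n).sub (h m)
    obtain ⟨b1, -, b3⟩ := hb _ _ _ _ _ hs.cont hs.zero hs.slice hs.grad hs.istar
    have eJ : P.cL (q n - q m) - (σ n - σ m) = J n - J m := by
      simp only [hJ, map_sub]
      exact sub_sub_sub_comm _ _ _ _
    rw [eJ] at b1 b3
    have hroot : ∀ r : ℝ, r ^ 2 ≤ C * (‖g n - g m‖ ^ 2 + ‖J n - J m‖ ^ 2) →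
        r ≤ √C * (dist (g n) (g m) + dist (J n) (J m)) := by
      intro r hr
      refine le_of_sq_le_sq (hr.trans ?_) (by positivity)
      rw [mul_pow, Real.sq_sqrt hC.le, dist_eq_norm, dist_eq_norm]
      refine mul_le_mul_of_nonneg_left ?_ hC.le
      nlinarith [norm_nonneg (g n - g m), norm_nonneg (J n - J m)]
    refine ⟨fun t ht => hroot _ ?_, hroot _ ?_⟩
    · rw [dist_eq_norm]
      exact b1 t ht
    · rw [dist_eq_norm]
      exact b3
  have hsmall : ∀ ε > 0, ∃ n₀, ∀ n ≥ n₀, ∀ m ≥ n₀,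
      √C * (dist (g n) (g m) + dist (J n) (J m)) < ε := by
    intro ε hε
    have hC' : 0 < √C := Real.sqrt_pos.2 hC
    have hδ : 0 < ε / (2 * √C) := by positivity
    obtain ⟨n₁, h1⟩ := Metric.cauchySeq_iff.1 hg.cauchySeq _ hδ
    obtain ⟨n₂, h2⟩ := Metric.cauchySeq_iff.1 hJlim.cauchySeq _ hδ
    refine ⟨max n₁ n₂, fun n hn m hm => ?_⟩
    have k1 := h1 n (le_of_max_le_left hn) m (le_of_max_le_left hm)
    have k2 := h2 n (le_of_max_le_right hn) m (le_of_max_le_right hm)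
    have k3 : √C * (dist (g n) (g m) + dist (J n) (J m))
        < √C * (ε / (2 * √C) + ε / (2 * √C)) := mul_lt_mul_of_pos_left (add_lt_add k1 k2) hC'
    refine k3.trans_le (le_of_eq ?_)
    field_simp
    ring
  have hφc : CauchySeq φ := by
    refine Metric.cauchySeq_iff.2 fun ε hε => ?_
    obtain ⟨n₀, hn₀⟩ := hsmall ε hε
    exact ⟨n₀, fun m hm n hn => (hbd m n).2.trans_lt (hn₀ m hm n hn)⟩
  have hΦc : UniformCauchySeqOn Φ atTop (Icc 0 P.T) := by
    refine Metric.uniformCauchySeqOn_iff.2 fun ε hε => ?_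
    obtain ⟨n₀, hn₀⟩ := hsmall ε hε
    exact ⟨n₀, fun m hm n hn t ht => ((hbd m n).1 t ht).trans_lt (hn₀ m hm n hn)⟩
  obtain ⟨φ', hφ'⟩ := cauchySeq_tendsto_of_complete hφc
  have hpt : ∀ t ∈ Icc 0 P.T, ∃ l, Tendsto (fun n => Φ n t) atTop (𝓝 l) := fun t ht =>
    cauchySeq_tendsto_of_complete (hΦc.cauchySeq ht)
  choose! Φ' hΦ' using hpt
  have hunif := hΦc.tendstoUniformlyOn_of_tendsto hΦ'
  refine ⟨φ', Φ', hunif.continuousOn (Frequently.of_forall fun n => (h n).cont), ?_, ?_,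
    HasGradient.of_tendsto (fun n => (h n).grad) hφ' hq,
    HasIstar.of_tendsto (fun n => (h n).istar) hφ' hσ hg⟩
  · have hT := hΦ' P.T (right_mem_Icc.2 P.T_pos.le)
    simp only [(h _).zero] at hT
    exact tendsto_nhds_unique hT tendsto_const_nhds
  · obtain ⟨ns, hns, h1⟩ := exists_subseq_tendsto_slice hφ'
    filter_upwards [h1, ae_all_iff.2 fun n => (h n).slice, ae_restrict_mem measurableSet_Ioo]
      with t k1 k2 k3
    have k4 := (Lp.tendsto_Lp_iff_tendsto_eLpNorm' _ _).1
      ((hΦ' t (Ioo_subset_Icc_self k3)).comp hns.tendsto_atTop)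
    have hm : AEStronglyMeasurable (fun x => φ' (x, t)) (volume.restrict P.Ω) :=
      ((Lp.stronglyMeasurable φ').comp_measurable measurable_prodMk_right).aestronglyMeasurable
    have hm' := (Lp.stronglyMeasurable (Φ' t)).aestronglyMeasurable (μ := volume.restrict P.Ω)
    -- The slices of `φ (ns k)` at `t` agree with `Φ (ns k) t`; they tend to the slice of `φ'` and
    -- to `Φ' t`, which must therefore coincide.
    have hzero : eLpNorm (fun x => φ' (x, t) - Φ' t x) 2 (volume.restrict P.Ω) = 0 := by
      refine le_antisymm ?_ bot_le
      have hsum := k1.add k4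
      rw [add_zero] at hsum
      refine ge_of_tendsto hsum (Eventually.of_forall fun k => ?_)
      have hmk : AEStronglyMeasurable (fun x => φ (ns k) (x, t)) (volume.restrict P.Ω) :=
        ((Lp.stronglyMeasurable _).comp_measurable measurable_prodMk_right).aestronglyMeasurable
      have hmk' := (Lp.stronglyMeasurable (Φ (ns k) t)).aestronglyMeasurable
        (μ := volume.restrict P.Ω)
      have e := eLpNorm_sub_le (p := 2) (hmk'.sub hm') (hmk.sub hm) one_le_two
      rw [add_comm]
      refine le_trans (le_of_eq (eLpNorm_congr_ae ?_)) e
      filter_upwards [k2 (ns k)] with x hx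
      simp only [Pi.sub_apply, hx]
      ring
    have := (eLpNorm_eq_zero_iff (hm.sub hm') two_ne_zero).1 hzero
    filter_upwards [this] with x hx
    exact sub_eq_zero.1 hx

end ParabolicData

/-! ### More multiplication operators -/

section mul

variable {α E : Type*} [MeasurableSpace α] [NormedAddCommGroup E] [InnerProductSpace ℝ E]
  {μ : Measure α}

lemma norm_mulL_le {w : α → ℝ} (hw : MemLp w ⊤ μ) {C : ℝ} (hC : ∀ᵐ z ∂μ, |w z| ≤ C)
    (f : Lp E 2 μ) : ‖mulL hw f‖ ≤ C * ‖f‖ := by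
  refine Lp.norm_le_mul_norm_of_ae_le_mul ?_
  filter_upwards [coeFn_mulL hw f, hC] with z h1 h2
  rw [h1, norm_smul]
  exact mul_le_mul_of_nonneg_right h2 (norm_nonneg _)

lemma mulL_mulL_eq {w w' : α → ℝ} (hw : MemLp w ⊤ μ) (hw' : MemLp w' ⊤ μ)
    (h : ∀ᵐ z ∂μ, w z * w' z = 1) (f : Lp E 2 μ) : mulL hw (mulL hw' f) = f := by
  refine Lp.ext ?_
  filter_upwards [coeFn_mulL hw (mulL hw' f), coeFn_mulL hw' f, h] with z h1 h2 h3
  rw [h1, h2, smul_smul, h3, one_smul]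

omit [InnerProductSpace ℝ E] in
lemma norm_toLp_mono_measure_le {μ ν : Measure α} (h : ν ≤ μ) (f : Lp E 2 μ) :
    ‖((Lp.memLp f).mono_measure h).toLp f‖ ≤ ‖f‖ := by
  rw [Lp.norm_toLp, Lp.norm_def]
  exact ENNReal.toReal_mono (Lp.eLpNorm_ne_top f) (eLpNorm_mono_measure _ h)

/-- Restriction to a smaller measure, as an operator on `L²`. -/
noncomputable def restrictL {μ ν : Measure α} (h : ν ≤ μ) : Lp E 2 μ →L[ℝ] Lp E 2 ν :=
  LinearMap.mkContinuous
    { toFun := fun f => ((Lp.memLp f).mono_measure h).toLp f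
      map_add' := fun f g => by
        rw [← MemLp.toLp_add]
        exact MemLp.toLp_congr _ _ (ae_mono h (Lp.coeFn_add f g))
      map_smul' := fun r f => by
        rw [RingHom.id_apply, ← MemLp.toLp_const_smul]
        exact MemLp.toLp_congr _ _ (ae_mono h (Lp.coeFn_smul r f)) } 1 fun f => by
    rw [one_mul]
    exact norm_toLp_mono_measure_le h f

lemma coeFn_restrictL {μ ν : Measure α} (h : ν ≤ μ) (f : Lp E 2 μ) : restrictL h f =ᵐ[ν] f :=
  ((Lp.memLp f).mono_measure h).coeFn_toLp

lemma norm_restrictL_le {μ ν : Measure α} (h : ν ≤ μ) (f : Lp E 2 μ) : ‖restrictL h f‖ ≤ ‖f‖ :=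
  norm_toLp_mono_measure_le h f

end mul

/-! ### The space `Ψ` as a Hilbert space -/

namespace ObsData

variable {N : ℕ} {P : ParabolicData N} {ρs : ℝ} (W : ObsData P ρs)

lemma weight_pos {w : SpT N → ℝ} (hw : IsWeight P ρs w) {z : SpT N} (hz : z ∈ P.Q) : 0 < w z :=
  hw.2.1.1.trans_le (hw.2.1.2 z hz)

lemma abs_inv_weight_le {w : SpT N → ℝ} (hw : IsWeight P ρs w) :
    ∀ᵐ z ∂P.μQ, |(w z)⁻¹| ≤ ρs⁻¹ := by
  refine ae_Q fun z hz => ?_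
  rw [abs_of_pos (inv_pos.2 (weight_pos hw hz))]
  exact inv_anti₀ hw.2.1.1 (hw.2.1.2 z hz)

variable {W}

lemma Psi.hasGradient (ψ : W.Psi) : P.HasGradient (Psi.phi ψ) (Psi.grad ψ) :=
  ψ.2.2.1.choose_spec

lemma Psi.hasIstar (ψ : W.Psi) : P.HasIstar (Psi.phi ψ) (Psi.sigma ψ) (Psi.Istar ψ) :=
  ψ.2.2.2.choose_spec.1

lemma Psi.memLp_weighted (ψ : W.Psi) : MemLp (fun z => W.ρ₀ z * Psi.Istar ψ z) 2 P.μQ :=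
  ψ.2.2.2.choose_spec.2

lemma Psi.exists_isAdjointState (ψ : W.Psi) :
    ∃ Φ, P.IsAdjointState (Psi.phi ψ) (Psi.Istar ψ) (Psi.sigma ψ) (Psi.grad ψ) Φ := by
  obtain ⟨Φ, h1, h2, h3⟩ := ψ.2.1
  exact ⟨Φ, h1, h2, h3, Psi.hasGradient ψ, Psi.hasIstar ψ⟩

lemma Psi.grad_add (ψ χ : W.Psi) : Psi.grad (ψ + χ) = Psi.grad ψ + Psi.grad χ :=
  HasGradient.unique (Psi.hasGradient (ψ + χ)) (HasGradient.add (Psi.hasGradient ψ) (Psi.hasGradient χ))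

lemma Psi.grad_smul (r : ℝ) (ψ : W.Psi) : Psi.grad (r • ψ) = r • Psi.grad ψ :=
  HasGradient.unique (Psi.hasGradient (r • ψ)) (HasGradient.smul r (Psi.hasGradient ψ))

lemma Psi.Istar_add (ψ χ : W.Psi) : Psi.Istar (ψ + χ) = Psi.Istar ψ + Psi.Istar χ :=
  HasIstar.unique (Psi.hasIstar (ψ + χ)) (HasIstar.add (Psi.hasIstar ψ) (Psi.hasIstar χ))

lemma Psi.Istar_smul (r : ℝ) (ψ : W.Psi) : Psi.Istar (r • ψ) = r • Psi.Istar ψ :=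
  HasIstar.unique (Psi.hasIstar (r • ψ)) (HasIstar.smul r (Psi.hasIstar ψ))

variable (W)

/-- `(φ, σ) ↦ φ`. -/
noncomputable def phiL : W.Psi →ₗ[ℝ] P.L2 := LinearMap.fst ℝ P.L2 P.L2v ∘ₗ W.Psi.subtype

/-- `(φ, σ) ↦ σ`. -/
noncomputable def sigmaL : W.Psi →ₗ[ℝ] P.L2v := LinearMap.snd ℝ P.L2 P.L2v ∘ₗ W.Psi.subtype

/-- `(φ, σ) ↦ ∇φ`. -/
noncomputable def gradL : W.Psi →ₗ[ℝ] P.L2v where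
  toFun := Psi.grad
  map_add' := Psi.grad_add
  map_smul' := Psi.grad_smul

/-- `(φ, σ) ↦ ρ₀ I*(φ, σ)`. -/
noncomputable def istarL : W.Psi →ₗ[ℝ] P.L2 where
  toFun ψ := (Psi.memLp_weighted ψ).toLp _
  map_add' ψ χ := by
    rw [← MemLp.toLp_add]
    refine MemLp.toLp_congr _ _ ?_
    rw [Psi.Istar_add]
    filter_upwards [Lp.coeFn_add (Psi.Istar ψ) (Psi.Istar χ)] with z hz
    rw [hz, Pi.add_apply, Pi.add_apply, mul_add]
  map_smul' r ψ := by
    rw [RingHom.id_apply, ← MemLp.toLp_const_smul]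
    refine MemLp.toLp_congr _ _ ?_
    rw [Psi.Istar_smul]
    filter_upwards [Lp.coeFn_smul r (Psi.Istar ψ)] with z hz
    rw [hz, Pi.smul_apply, Pi.smul_apply, smul_eq_mul, smul_eq_mul, mul_left_comm]

variable {W}

lemma coeFn_istarL (ψ : W.Psi) : W.istarL ψ =ᵐ[P.μQ] fun z => W.ρ₀ z * Psi.Istar ψ z :=
  (Psi.memLp_weighted ψ).coeFn_toLp

lemma mulL_istarL (ψ : W.Psi) : mulL (memLp_inv_weight W.isWeight₀) (W.istarL ψ) = Psi.Istar ψ := by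
  refine Lp.ext ?_
  filter_upwards [coeFn_mulL (memLp_inv_weight W.isWeight₀) (W.istarL ψ), coeFn_istarL ψ,
    ae_Q (P := P) (p := fun z => z ∈ P.Q) fun _ h => h] with z h1 h2 h3
  rw [h1, h2, smul_eq_mul, inv_mul_cancel_left₀ (weight_pos W.isWeight₀ h3).ne']

lemma mulL_inv_grad (q : P.L2v) :
    mulL W.bounded (mulL (memLp_inv_weight W.isWeight) q) = q :=
  mulL_mulL_eq _ _ (ae_Q fun _ hz => mul_inv_cancel₀ (weight_pos W.isWeight hz).ne') q

variable (W)

/-- The Hilbert space `L²(Q_T)^N × L²(Q_T)^N × L²(Q_T)`. -/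
abbrev L2sum (_ : ObsData P ρs) : Type := WithLp 2 (P.L2v × WithLp 2 (P.L2v × P.L2))

/-- The isometric embedding `(φ, σ) ↦ (σ, ρ⁻¹ ∇φ, ρ₀ I*(φ, σ))` of `Ψ`. -/
noncomputable def embed : W.Psi →ₗ[ℝ] W.L2sum :=
  (WithLp.linearEquiv 2 ℝ _).symm.toLinearMap ∘ₗ (W.sigmaL.prod
    ((WithLp.linearEquiv 2 ℝ _).symm.toLinearMap ∘ₗ
      (((mulL (memLp_inv_weight W.isWeight)).toLinearMap ∘ₗ W.gradL).prod W.istarL)))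

variable {W}

lemma norm_sq_embed (ψ : W.Psi) : ‖W.embed ψ‖ ^ 2 = ‖W.sigmaL ψ‖ ^ 2
    + ‖mulL (memLp_inv_weight W.isWeight) (W.gradL ψ)‖ ^ 2 + ‖W.istarL ψ‖ ^ 2 := by
  rw [WithLp.prod_norm_sq_eq_of_L2, WithLp.prod_norm_sq_eq_of_L2, ← add_assoc]
  rfl

lemma nrm_eq (ψ : W.Psi) : Psi.nrm ψ = ‖W.embed ψ‖ := by
  rw [Psi.nrm, ← Real.sqrt_sq (norm_nonneg (W.embed ψ)), norm_sq_embed]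
  congr 1
  simp_rw [norm_sq_eq_integral]
  rw [← integral_add (integrable_norm_sq _) (integrable_norm_sq _),
    ← integral_add (f := fun z => ‖W.sigmaL ψ z‖ ^ 2
        + ‖mulL (memLp_inv_weight W.isWeight) (W.gradL ψ) z‖ ^ 2)
      ((integrable_norm_sq _).add (integrable_norm_sq _)) (integrable_norm_sq _)]
  refine integral_congr_ae ?_
  filter_upwards [coeFn_istarL ψ, coeFn_mulL (memLp_inv_weight W.isWeight) (W.gradL ψ)]
    with z h1 h2
  rw [h1, h2, norm_smul, mul_pow, Real.norm_eq_abs, Real.norm_eq_abs, sq_abs, sq_abs,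
    real_inner_self_eq_norm_sq, real_inner_self_eq_norm_sq, mul_pow, inv_pow, sq (Psi.Istar ψ z)]
  rfl

/-- The energy estimate in `Ψ`. -/
lemma exists_energy_bound_Psi (P : ParabolicData N) : ∃ C : ℝ, 0 < C ∧ ∀ {ρs : ℝ}
    (W : ObsData P ρs) (ψ : W.Psi),
    ‖W.gradL ψ‖ ^ 2 ≤ C * (‖Psi.Istar ψ‖ ^ 2 + ‖P.cL (W.gradL ψ) - W.sigmaL ψ‖ ^ 2) ∧
    ‖W.phiL ψ‖ ^ 2 ≤ C * (‖Psi.Istar ψ‖ ^ 2 + ‖P.cL (W.gradL ψ) - W.sigmaL ψ‖ ^ 2) := by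
  obtain ⟨C, hC, h⟩ := exists_energy_bound P
  refine ⟨C, hC, fun W ψ => ?_⟩
  obtain ⟨Φ, hΦ⟩ := Psi.exists_isAdjointState ψ
  exact (h _ _ _ _ _ hΦ.cont hΦ.zero hΦ.slice hΦ.grad hΦ.istar).2

/-- The norm of `Ψ` does not contain `φ`. When `σ`, `∇φ` and `I*(φ, σ)` vanish, so does the
right-hand side of the energy estimate, and `φ = 0` follows. -/
lemma embed_injective : Function.Injective W.embed := by
  refine (injective_iff_map_eq_zero _).2 fun ψ hψ => ?_
  have h0 := norm_sq_embed ψ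
  rw [hψ, norm_zero] at h0
  have h1 : ‖W.sigmaL ψ‖ = 0 := by
    nlinarith [sq_nonneg ‖mulL (memLp_inv_weight W.isWeight) (W.gradL ψ)‖,
      sq_nonneg ‖W.istarL ψ‖, sq_nonneg ‖W.sigmaL ψ‖]
  have h2 : ‖mulL (memLp_inv_weight W.isWeight) (W.gradL ψ)‖ = 0 := by
    nlinarith [sq_nonneg ‖mulL (memLp_inv_weight W.isWeight) (W.gradL ψ)‖,
      sq_nonneg ‖W.istarL ψ‖, sq_nonneg ‖W.sigmaL ψ‖]
  have h3 : ‖W.istarL ψ‖ = 0 := by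
    nlinarith [sq_nonneg ‖mulL (memLp_inv_weight W.isWeight) (W.gradL ψ)‖,
      sq_nonneg ‖W.istarL ψ‖, sq_nonneg ‖W.sigmaL ψ‖]
  rw [norm_eq_zero] at h1 h2 h3
  have h4 : W.gradL ψ = 0 := by rw [← mulL_inv_grad (W := W) (W.gradL ψ), h2, map_zero]
  have h5 : Psi.Istar ψ = 0 := by rw [← mulL_istarL, h3, map_zero]
  obtain ⟨C, -, hC⟩ := exists_energy_bound_Psi P
  have h6 := (hC W ψ).2
  rw [h4, h5, h1, map_zero, sub_zero, norm_zero, norm_zero] at h6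
  have h7 : W.phiL ψ = 0 := by
    rw [← norm_eq_zero]
    nlinarith [norm_nonneg (W.phiL ψ)]
  exact Subtype.ext (Prod.ext h7 h1)

/-- This is the completeness of `Ψ`. Boundedness of `ρ` turns convergence of `ρ⁻¹∇φ` into that of
`∇φ`; for `ρ₀`, possibly unbounded, boundedness of `ρ₀⁻¹` suffices. The limit `φ'` is then supplied
by `IsAdjointState.exists_limit`. -/
lemma isClosed_range_embed : IsClosed (LinearMap.range W.embed : Set W.L2sum) := by
  refine IsSeqClosed.isClosed fun x l hx hl => ?_
  choose ψ hψ using hx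
  have c1 : Tendsto (fun n => W.sigmaL (ψ n)) atTop (𝓝 l.fst) := by
    have := ((WithLp.prod_continuous_ofLp 2 _ _).fst.tendsto l).comp hl
    refine this.congr fun n => ?_
    rw [Function.comp_apply, ← hψ n]
    rfl
  have c0 : Tendsto (fun n => (x n).snd) atTop (𝓝 l.snd) :=
    ((WithLp.prod_continuous_ofLp 2 _ _).snd.tendsto l).comp hl
  have c2 : Tendsto (fun n => mulL (memLp_inv_weight W.isWeight) (W.gradL (ψ n))) atTop
      (𝓝 l.snd.fst) := by
    have := ((WithLp.prod_continuous_ofLp 2 _ _).fst.tendsto l.snd).comp c0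
    refine this.congr fun n => ?_
    rw [Function.comp_apply, ← hψ n]
    rfl
  have c3 : Tendsto (fun n => W.istarL (ψ n)) atTop (𝓝 l.snd.snd) := by
    have := ((WithLp.prod_continuous_ofLp 2 _ _).snd.tendsto l.snd).comp c0
    refine this.congr fun n => ?_
    rw [Function.comp_apply, ← hψ n]
    rfl
  have c4 : Tendsto (fun n => Psi.grad (ψ n)) atTop (𝓝 (mulL W.bounded l.snd.fst)) :=
    (((mulL W.bounded).continuous.tendsto _).comp c2).congr fun n => mulL_inv_grad _
  have c5 : Tendsto (fun n => Psi.Istar (ψ n)) atTop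
      (𝓝 (mulL (memLp_inv_weight W.isWeight₀) l.snd.snd)) :=
    (((mulL (memLp_inv_weight W.isWeight₀)).continuous.tendsto _).comp c3).congr
      fun n => mulL_istarL _
  choose Φ hΦ using fun n => Psi.exists_isAdjointState (ψ n)
  obtain ⟨φ', Φ', h'⟩ := ParabolicData.IsAdjointState.exists_limit hΦ c5 c1 c4
  have hw : (fun z => W.ρ₀ z * mulL (memLp_inv_weight W.isWeight₀) l.snd.snd z)
      =ᵐ[P.μQ] l.snd.snd := by
    filter_upwards [coeFn_mulL (memLp_inv_weight W.isWeight₀) l.snd.snd,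
      ae_Q (P := P) (p := fun z => z ∈ P.Q) fun _ h => h] with z k1 k2
    rw [k1, smul_eq_mul, mul_inv_cancel_left₀ (weight_pos W.isWeight₀ k2).ne']
  have hmem : (φ', l.fst) ∈ W.Psi := ⟨⟨Φ', h'.cont, h'.zero, h'.slice⟩, ⟨_, h'.grad⟩, _, h'.istar,
    (memLp_congr_ae hw).2 (Lp.memLp _)⟩
  set ψ' : W.Psi := ⟨(φ', l.fst), hmem⟩ with hψ'
  have g1 : Psi.grad ψ' = mulL W.bounded l.snd.fst := HasGradient.unique (Psi.hasGradient ψ') h'.grad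
  have g2 : Psi.Istar ψ' = mulL (memLp_inv_weight W.isWeight₀) l.snd.snd :=
    HasIstar.unique (Psi.hasIstar ψ') h'.istar
  have e2 : mulL (memLp_inv_weight W.isWeight) (W.gradL ψ') = l.snd.fst := by
    have : W.gradL ψ' = mulL W.bounded l.snd.fst := g1
    rw [this]
    exact mulL_mulL_eq _ _ (ae_Q fun _ hz => inv_mul_cancel₀ (weight_pos W.isWeight hz).ne') _
  have e3 : W.istarL ψ' = l.snd.snd := by
    refine Lp.ext ((coeFn_istarL ψ').trans ?_)
    rw [g2]
    exact hw
  refine ⟨ψ', ?_⟩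
  change WithLp.toLp 2 (l.fst, WithLp.toLp 2
    (mulL (memLp_inv_weight W.isWeight) (W.gradL ψ'), W.istarL ψ')) = l
  rw [e2, e3]
  rfl

end ObsData

/-! ### Abstract mixed problems -/

/-- A stabilized mixed problem, with coercive diagonal forms, has a solution. -/
theorem exists_mixed_solution {U R : Type*} [NormedAddCommGroup U] [InnerProductSpace ℝ U]
    [CompleteSpace U] [NormedAddCommGroup R] [InnerProductSpace ℝ R] [CompleteSpace R]
    (a : U →L[ℝ] U →L[ℝ] ℝ) (b : U →L[ℝ] R →L[ℝ] ℝ) (c : R →L[ℝ] R →L[ℝ] ℝ) {θ₁ θ₂ : ℝ}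
    (h₁ : 0 < θ₁) (h₂ : 0 < θ₂) (ha : ∀ u, θ₁ * ‖u‖ ^ 2 ≤ a u u) (hc : ∀ ψ, θ₂ * ‖ψ‖ ^ 2 ≤ c ψ ψ)
    (F : U →L[ℝ] ℝ) (G : R →L[ℝ] ℝ) :
    ∃ u ψ, (∀ v, a u v + b v ψ = F v) ∧ ∀ χ, b u χ - c ψ χ = G χ := by
  set p₁ := WithLp.fstL 2 ℝ U R
  set p₂ := WithLp.sndL 2 ℝ U R
  -- The second equation enters with the opposite sign, so that the two `b`-terms cancel on the
  -- diagonal.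
  set B : WithLp 2 (U × R) →L[ℝ] WithLp 2 (U × R) →L[ℝ] ℝ :=
    a.bilinearComp p₁ p₁ + b.flip.bilinearComp p₂ p₁ - b.bilinearComp p₁ p₂ + c.bilinearComp p₂ p₂
    with hB
  have hBapp : ∀ x y, B x y = a x.fst y.fst + b y.fst x.snd - b x.fst y.snd + c x.snd y.snd :=
    fun x y => rfl
  have hcoer : IsCoercive B := by
    refine ⟨min θ₁ θ₂, lt_min h₁ h₂, fun x => ?_⟩
    rw [hBapp, mul_assoc, ← sq, WithLp.prod_norm_sq_eq_of_L2]
    have k1 := mul_le_mul_of_nonneg_right (min_le_left θ₁ θ₂) (sq_nonneg ‖x.fst‖)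
    have k2 := mul_le_mul_of_nonneg_right (min_le_right θ₁ θ₂) (sq_nonneg ‖x.snd‖)
    linarith [ha x.fst, hc x.snd]
  set f := (InnerProductSpace.toDual ℝ (WithLp 2 (U × R))).symm (F ∘L p₁ - G ∘L p₂) with hf
  set x := hcoer.continuousLinearEquivOfBilin.symm f with hx
  have key : ∀ y, B x y = F y.fst - G y.snd := by
    intro y
    rw [← hcoer.continuousLinearEquivOfBilin_apply, hx,
      ContinuousLinearEquiv.apply_symm_apply, hf, InnerProductSpace.toDual_symm_apply]
    rfl
  refine ⟨x.fst, x.snd, fun v => ?_, fun χ => ?_⟩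
  · have := key (WithLp.toLp 2 (v, 0))
    rw [hBapp] at this
    simpa using this
  · have := key (WithLp.toLp 2 (0, χ))
    rw [hBapp] at this
    simp at this
    linarith

/-! ### The mixed formulation in `𝓤 × Ψ` -/

namespace ObsData

variable {N : ℕ} {P : ParabolicData N} {ρs : ℝ} (W : ObsData P ρs)

lemma norm_sq_U (u : W.U) :
    ‖u‖ ^ 2 = ‖W.obs u‖ ^ 2 + W.η₁ * ‖W.resJ u‖ ^ 2 + W.η₂ * ‖W.resI u‖ ^ 2 := by
  refine UniformSpace.Completion.induction_on u (isClosed_eq (by fun_prop) (by fun_prop)) fun v => ?_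
  obtain ⟨h1, h2, h3⟩ := W.extensions_coe v
  rw [UniformSpace.Completion.norm_coe, norm_sq_preU, h1, h2, h3]

lemma norm_obs_le (u : W.U) : ‖W.obs u‖ ≤ ‖u‖ := by
  refine le_of_sq_le_sq ?_ (norm_nonneg _)
  rw [W.norm_sq_U]
  have := mul_nonneg W.η₁_pos.le (sq_nonneg ‖W.resJ u‖)
  have := mul_nonneg W.η₂_pos.le (sq_nonneg ‖W.resI u‖)
  linarith

lemma ae_μq_pos : ∀ᵐ z ∂W.μq, 0 < W.ρ₀ z :=
  ae_mono W.μq_le (ae_Q fun _ hz => weight_pos W.isWeight₀ hz)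

lemma ae_μQ_pos {w : SpT N → ℝ} (hw : IsWeight P ρs w) : ∀ᵐ z ∂P.μQ, 0 < w z :=
  ae_Q fun _ hz => weight_pos hw hz

lemma memLp_inv_ρ₀ : MemLp (fun z => (W.ρ₀ z)⁻¹) ⊤ W.μq :=
  (memLp_inv_weight W.isWeight₀).mono_measure W.μq_le

lemma formA_eq (α₁ r₁ r₂ : ℝ) (u v : W.U) : W.formA α₁ r₁ r₂ u v
    = (1 - α₁) * inner ℝ (W.obs u) (W.obs v) + r₁ * inner ℝ (W.resJ u) (W.resJ v)
      + r₂ * inner ℝ (W.resI u) (W.resI v) := by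
  have e1 : ∫ z, (W.ρ₀ z ^ 2)⁻¹ * (W.y u z * W.y v z) ∂W.μq = inner ℝ (W.obs u) (W.obs v) := by
    rw [L2.inner_def]
    refine integral_congr_ae ?_
    filter_upwards [W.ae_μq_pos] with z hz
    simp only [y, Real.inner_apply]
    field_simp
  have e2 : ∫ z, (W.ρ₁ z ^ 2)⁻¹ * inner ℝ (W.J u z) (W.J v z) ∂P.μQ
      = inner ℝ (W.resJ u) (W.resJ v) := by
    rw [L2.inner_def]
    refine integral_congr_ae ?_
    filter_upwards [ae_μQ_pos W.isWeight₁] with z hz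
    simp only [J, inner_smul_left, inner_smul_right, RCLike.conj_to_real]
    field_simp
  have e3 : ∫ z, (W.ρ z ^ 2)⁻¹ * (W.I u z * W.I v z) ∂P.μQ = inner ℝ (W.resI u) (W.resI v) := by
    rw [L2.inner_def]
    refine integral_congr_ae ?_
    filter_upwards [ae_μQ_pos W.isWeight] with z hz
    simp only [I, Real.inner_apply]
    field_simp
  rw [formA, e1, e2, e3]

/-- Continuity of `b_α` becomes visible: `ρ` and `ρ₁` act as bounded multipliers, while in the last
term `ρ₀` is absorbed into `ρ₀ I*(φ, σ)`, so no bound on it is required. -/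
lemma formB_eq (α₁ : ℝ) (u : W.U) (ψ : W.Psi) : W.formB α₁ u ψ
    = inner ℝ (mulL W.bounded₁ (W.resJ u)) (W.sigmaL ψ)
      + inner ℝ (mulL W.bounded (W.resI u)) (W.phiL ψ)
      - α₁ * inner ℝ (W.obs u) (restrictL W.μq_le (W.istarL ψ)) := by
  have e1 : ∫ z, inner ℝ (W.J u z) (Psi.sigma ψ z) ∂P.μQ
      = inner ℝ (mulL W.bounded₁ (W.resJ u)) (W.sigmaL ψ) := by
    rw [L2.inner_def]
    refine integral_congr_ae ?_
    filter_upwards [coeFn_mulL W.bounded₁ (W.resJ u)] with z hz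
    rw [hz]
    rfl
  have e2 : ∫ z, W.I u z * Psi.phi ψ z ∂P.μQ
      = inner ℝ (mulL W.bounded (W.resI u)) (W.phiL ψ) := by
    rw [L2.inner_def]
    refine integral_congr_ae ?_
    filter_upwards [coeFn_mulL W.bounded (W.resI u)] with z hz
    rw [hz, Real.inner_apply]
    rfl
  have e3 : ∫ z, Psi.Istar ψ z * W.y u z ∂W.μq
      = inner ℝ (W.obs u) (restrictL W.μq_le (W.istarL ψ)) := by
    rw [L2.inner_def]
    refine integral_congr_ae ?_
    filter_upwards [coeFn_restrictL W.μq_le (W.istarL ψ), ae_mono W.μq_le (coeFn_istarL ψ)]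
      with z h1 h2
    rw [h1, h2, Real.inner_apply, y]
    ring
  rw [formB, e1, e2, e3]

lemma formC_eq (α₁ α₂ : ℝ) (ψ χ : W.Psi) : W.formC α₁ α₂ ψ χ
    = α₁ * inner ℝ (W.istarL ψ) (W.istarL χ)
      + α₂ * inner ℝ (P.cL (W.gradL ψ) - W.sigmaL ψ) (P.cL (W.gradL χ) - W.sigmaL χ) := by
  have e1 : ∫ z, W.ρ₀ z ^ 2 * (Psi.Istar ψ z * Psi.Istar χ z) ∂P.μQ
      = inner ℝ (W.istarL ψ) (W.istarL χ) := by
    rw [L2.inner_def]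
    refine integral_congr_ae ?_
    filter_upwards [coeFn_istarL ψ, coeFn_istarL χ] with z h1 h2
    rw [h1, h2, Real.inner_apply]
    ring
  have hJ : ∀ ψ : W.Psi, (P.cL (W.gradL ψ) - W.sigmaL ψ : P.L2v) =ᵐ[P.μQ] Psi.J ψ := by
    intro ψ
    filter_upwards [Lp.coeFn_sub (P.cL (W.gradL ψ)) (W.sigmaL ψ), P.coeFn_cL (W.gradL ψ)]
      with z h1 h2
    rw [h1, Pi.sub_apply, h2]
    rfl
  have e2 : ∫ z, inner ℝ (Psi.J ψ z) (Psi.J χ z) ∂P.μQ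
      = inner ℝ (P.cL (W.gradL ψ) - W.sigmaL ψ) (P.cL (W.gradL χ) - W.sigmaL χ) := by
    rw [L2.inner_def]
    refine integral_congr_ae ?_
    filter_upwards [hJ ψ, hJ χ] with z h1 h2
    rw [h1, h2]
  rw [formC, e1, e2]

lemma formL1_eq (α₁ : ℝ) (yobs : W.L2q) (u : W.U) : W.formL1 α₁ yobs u
    = (1 - α₁) * inner ℝ (mulL W.memLp_inv_ρ₀ yobs) (W.obs u) := by
  rw [formL1, L2.inner_def]
  congr 1
  refine integral_congr_ae ?_
  filter_upwards [W.ae_μq_pos, coeFn_mulL W.memLp_inv_ρ₀ yobs] with z h1 h2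
  rw [h2, Real.inner_apply, y, smul_eq_mul]
  field_simp

lemma formL2_eq (α₁ : ℝ) (yobs : W.L2q) (ψ : W.Psi) : W.formL2 α₁ yobs ψ
    = -α₁ * inner ℝ (mulL W.memLp_inv_ρ₀ yobs) (restrictL W.μq_le (W.istarL ψ)) := by
  rw [formL2, L2.inner_def]
  congr 1
  refine integral_congr_ae ?_
  filter_upwards [W.ae_μq_pos, coeFn_mulL W.memLp_inv_ρ₀ yobs,
    coeFn_restrictL W.μq_le (W.istarL ψ), ae_mono W.μq_le (coeFn_istarL ψ)] with z h1 h2 h3 h4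
  rw [h2, h3, h4, Real.inner_apply, smul_eq_mul]
  field_simp

lemma norm_sq_inv_mul (yobs : W.L2q) :
    ‖mulL W.memLp_inv_ρ₀ yobs‖ ^ 2 = ∫ z, (W.ρ₀ z ^ 2)⁻¹ * yobs z ^ 2 ∂W.μq := by
  rw [norm_sq_eq_integral]
  refine integral_congr_ae ?_
  filter_upwards [coeFn_mulL W.memLp_inv_ρ₀ yobs] with z h2
  rw [h2, norm_smul, mul_pow, Real.norm_eq_abs, Real.norm_eq_abs, sq_abs, sq_abs, inv_pow]

/-! ### Bounds by the norm of `Ψ` and coercivity of `c_α` -/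

lemma norm_istarL_le (ψ : W.Psi) : ‖W.istarL ψ‖ ≤ Psi.nrm ψ := by
  rw [nrm_eq]
  refine le_of_sq_le_sq ?_ (norm_nonneg _)
  rw [norm_sq_embed]
  nlinarith [sq_nonneg ‖W.sigmaL ψ‖,
    sq_nonneg ‖mulL (memLp_inv_weight W.isWeight) (W.gradL ψ)‖]

lemma norm_sigmaL_le (ψ : W.Psi) : ‖W.sigmaL ψ‖ ≤ Psi.nrm ψ := by
  rw [nrm_eq]
  refine le_of_sq_le_sq ?_ (norm_nonneg _)
  rw [norm_sq_embed]
  nlinarith [sq_nonneg ‖W.istarL ψ‖,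
    sq_nonneg ‖mulL (memLp_inv_weight W.isWeight) (W.gradL ψ)‖]

/-- The constant depends on the upper bound of `ρ`. This is harmless, since the lemma serves only
continuity and not the choice of `θ₂`. -/
lemma norm_gradL_le (ψ : W.Psi) :
    ‖W.gradL ψ‖ ≤ ‖(mulL W.bounded : P.L2v →L[ℝ] P.L2v)‖ * Psi.nrm ψ := by
  have h1 : ‖mulL (memLp_inv_weight W.isWeight) (W.gradL ψ)‖ ≤ Psi.nrm ψ := by
    rw [nrm_eq]
    refine le_of_sq_le_sq ?_ (norm_nonneg _)
    rw [norm_sq_embed]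
    nlinarith [sq_nonneg ‖W.istarL ψ‖, sq_nonneg ‖W.sigmaL ψ‖]
  have h2 := (mulL W.bounded : P.L2v →L[ℝ] P.L2v).le_opNorm
    (mulL (memLp_inv_weight W.isWeight) (W.gradL ψ))
  rw [mulL_inv_grad] at h2
  exact h2.trans (mul_le_mul_of_nonneg_left h1 (norm_nonneg _))

lemma norm_Istar_le (ψ : W.Psi) : ‖Psi.Istar ψ‖ ≤ ρs⁻¹ * ‖W.istarL ψ‖ := by
  rw [← mulL_istarL]
  exact norm_mulL_le _ (abs_inv_weight_le W.isWeight₀) _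

/-- `Ψ` is controlled by the diagonal form on `Ψ`, with a constant that depends on the weights
only through their lower bound. -/
theorem exists_coercive_formC (P : ParabolicData N) {α₁ α₂ ρs : ℝ} (h₁ : 0 < α₁) (h₂ : 0 < α₂)
    (hρs : 0 < ρs) : ∃ θ₂ : ℝ, 0 < θ₂ ∧ ∀ (W : ObsData P ρs) (ψ : W.Psi),
      θ₂ * Psi.nrm ψ ^ 2 ≤ W.formC α₁ α₂ ψ ψ := by
  obtain ⟨C, hC, hb⟩ := exists_energy_bound_Psi P
  -- With `X` as below, `‖ρ₀ I*‖² ≤ X`, `‖σ‖² ≤ 2X + 2‖c‖²‖∇φ‖²` and `‖ρ⁻¹∇φ‖² ≤ ρs⁻²‖∇φ‖²`, while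
  -- `‖∇φ‖² ≤ C(1 + ρs⁻²) X`; `κ` is the sum.
  set κ := 3 + (2 * ‖P.cL‖ ^ 2 + ρs⁻¹ ^ 2) * (C * (1 + ρs⁻¹ ^ 2)) with hκ
  have hκ0 : 0 < κ := by positivity
  have hm : 0 < min α₁ α₂ := lt_min h₁ h₂
  refine ⟨min α₁ α₂ / κ, by positivity, fun W ψ => ?_⟩
  set X := ‖W.istarL ψ‖ ^ 2 + ‖P.cL (W.gradL ψ) - W.sigmaL ψ‖ ^ 2 with hX
  have hX0 : 0 ≤ X := by positivity
  have k1 : min α₁ α₂ * X ≤ W.formC α₁ α₂ ψ ψ := by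
    rw [formC_eq, real_inner_self_eq_norm_sq, real_inner_self_eq_norm_sq, hX, mul_add]
    exact add_le_add (mul_le_mul_of_nonneg_right (min_le_left _ _) (sq_nonneg _))
      (mul_le_mul_of_nonneg_right (min_le_right _ _) (sq_nonneg _))
  have k2 : ‖W.gradL ψ‖ ^ 2 ≤ C * (1 + ρs⁻¹ ^ 2) * X := by
    refine (hb W ψ).1.trans ?_
    rw [mul_assoc]
    refine mul_le_mul_of_nonneg_left ?_ hC.le
    have h3 : ‖Psi.Istar ψ‖ ^ 2 ≤ ρs⁻¹ ^ 2 * ‖W.istarL ψ‖ ^ 2 := by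
      rw [← mul_pow]
      exact pow_le_pow_left₀ (norm_nonneg _) (W.norm_Istar_le ψ) 2
    have h4 : 0 ≤ ρs⁻¹ ^ 2 * ‖P.cL (W.gradL ψ) - W.sigmaL ψ‖ ^ 2 := by positivity
    have h5 : 0 ≤ ‖W.istarL ψ‖ ^ 2 := by positivity
    rw [hX]
    linarith
  have k3 : ‖W.sigmaL ψ‖ ^ 2 ≤ 2 * X + 2 * ‖P.cL‖ ^ 2 * ‖W.gradL ψ‖ ^ 2 := by
    have h3 : ‖W.sigmaL ψ‖ ≤ ‖P.cL‖ * ‖W.gradL ψ‖ + ‖P.cL (W.gradL ψ) - W.sigmaL ψ‖ := by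
      have h4 := norm_sub_le (P.cL (W.gradL ψ)) (P.cL (W.gradL ψ) - W.sigmaL ψ)
      rw [sub_sub_cancel] at h4
      exact h4.trans (add_le_add (P.cL.le_opNorm _) le_rfl)
    have h5 := pow_le_pow_left₀ (norm_nonneg _) h3 2
    have h6 := add_sq_le (a := ‖P.cL‖ * ‖W.gradL ψ‖) (b := ‖P.cL (W.gradL ψ) - W.sigmaL ψ‖)
    have h7 : 0 ≤ ‖W.istarL ψ‖ ^ 2 := by positivity
    rw [mul_pow] at h6
    rw [hX]
    linarith
  have k4 : ‖mulL (memLp_inv_weight W.isWeight) (W.gradL ψ)‖ ^ 2 ≤ ρs⁻¹ ^ 2 * ‖W.gradL ψ‖ ^ 2 := by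
    rw [← mul_pow]
    exact pow_le_pow_left₀ (norm_nonneg _) (norm_mulL_le _ (abs_inv_weight_le W.isWeight) _) 2
  have k5 : Psi.nrm ψ ^ 2 ≤ κ * X := by
    rw [nrm_eq, norm_sq_embed]
    have h8 := mul_le_mul_of_nonneg_left k2 (show 0 ≤ 2 * ‖P.cL‖ ^ 2 + ρs⁻¹ ^ 2 by positivity)
    have h9 : ‖W.istarL ψ‖ ^ 2 ≤ X := by
      rw [hX]
      exact le_add_of_nonneg_right (sq_nonneg _)
    rw [hκ]
    linarith
  rw [div_mul_eq_mul_div, div_le_iff₀ hκ0]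
  calc min α₁ α₂ * Psi.nrm ψ ^ 2 ≤ min α₁ α₂ * (κ * X) := mul_le_mul_of_nonneg_left k5 hm.le
    _ = min α₁ α₂ * X * κ := by ring
    _ ≤ W.formC α₁ α₂ ψ ψ * κ := mul_le_mul_of_nonneg_right k1 hκ0.le

end ObsData

/-- The real inner product composed with two operators, as a continuous bilinear form. -/
noncomputable def innerComp {X E F : Type*} [NormedAddCommGroup X] [InnerProductSpace ℝ X]
    [NormedAddCommGroup E] [NormedSpace ℝ E] [NormedAddCommGroup F] [NormedSpace ℝ F]
    (f : E →L[ℝ] X) (g : F →L[ℝ] X) : E →L[ℝ] F →L[ℝ] ℝ :=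
  (LinearMap.mkContinuous₂ (innerₗ X) 1 fun x y => by
    rw [one_mul]
    exact norm_inner_le_norm x y).bilinearComp f g

/-! ### Existence, uniqueness and a priori estimates -/

namespace ObsData

variable {N : ℕ} {P : ParabolicData N} {ρs : ℝ} (W : ObsData P ρs)

lemma nrm_nonneg (ψ : W.Psi) : 0 ≤ Psi.nrm ψ := Real.sqrt_nonneg _

lemma eq_zero_of_nrm {ψ : W.Psi} (h : Psi.nrm ψ = 0) : ψ = 0 := by
  rw [nrm_eq, norm_eq_zero] at h
  exact embed_injective (h.trans (map_zero _).symm)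

variable {W} in
/-- An operator on `Ψ`, bounded for the norm of `Ψ`, is an operator on any isometric copy. -/
lemma exists_clm_of_bound {R X : Type*} [NormedAddCommGroup R] [NormedSpace ℝ R]
    [NormedAddCommGroup X] [NormedSpace ℝ X] (e : W.Psi ≃ₗ[ℝ] R)
    (he : ∀ χ, Psi.nrm (e.symm χ) = ‖χ‖) (f : W.Psi →ₗ[ℝ] X) {C : ℝ}
    (hf : ∀ ψ, ‖f ψ‖ ≤ C * Psi.nrm ψ) : ∃ g : R →L[ℝ] X, ∀ χ, g χ = f (e.symm χ) :=
  ⟨(f ∘ₗ e.symm.toLinearMap).mkContinuous C fun χ => by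
    rw [← he]
    exact hf _, fun _ => rfl⟩

/-- The energy estimate bounds `φ` by `I*(φ, σ)` and `J(φ, σ)`, and the norm of `Ψ` controls both.
It is needed for the continuity of `∬ I(y, p) φ`. -/
lemma exists_norm_phiL_le : ∃ K : ℝ, ∀ ψ : W.Psi, ‖W.phiL ψ‖ ≤ K * Psi.nrm ψ := by
  obtain ⟨C, hC, h⟩ := exists_energy_bound_Psi P
  set m := ‖(mulL W.bounded : P.L2v →L[ℝ] P.L2v)‖
  refine ⟨√(C * (ρs⁻¹ ^ 2 + (‖P.cL‖ * m + 1) ^ 2)), fun ψ => ?_⟩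
  have hρ : 0 ≤ ρs⁻¹ := inv_nonneg.2 W.isWeight.2.1.1.le
  have h1 : ‖Psi.Istar ψ‖ ≤ ρs⁻¹ * Psi.nrm ψ :=
    (W.norm_Istar_le ψ).trans (mul_le_mul_of_nonneg_left (W.norm_istarL_le ψ) hρ)
  have h2 : ‖P.cL (W.gradL ψ) - W.sigmaL ψ‖ ≤ (‖P.cL‖ * m + 1) * Psi.nrm ψ := by
    refine (norm_sub_le _ _).trans ?_
    rw [add_mul, one_mul, mul_assoc]
    exact add_le_add ((P.cL.le_opNorm _).trans
      (mul_le_mul_of_nonneg_left (W.norm_gradL_le ψ) (norm_nonneg _))) (W.norm_sigmaL_le ψ)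
  have h3 := pow_le_pow_left₀ (norm_nonneg _) h1 2
  have h4 := pow_le_pow_left₀ (norm_nonneg _) h2 2
  rw [mul_pow] at h3 h4
  rw [← Real.sqrt_sq (W.nrm_nonneg ψ), ← Real.sqrt_mul (by positivity)]
  refine Real.le_sqrt_of_sq_le ((h W ψ).2.trans ?_)
  rw [mul_assoc, add_mul]
  exact mul_le_mul_of_nonneg_left (add_le_add h3 h4) hC.le

/-- Coercivity of `a_{r,α}`. -/
lemma le_formA {α₁ r₁ r₂ : ℝ} (u : W.U) :
    min (1 - α₁) (min (r₁ / W.η₁) (r₂ / W.η₂)) * ‖u‖ ^ 2 ≤ W.formA α₁ r₁ r₂ u u := by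
  set θ := min (1 - α₁) (min (r₁ / W.η₁) (r₂ / W.η₂)) with hθ
  have h1 : θ ≤ 1 - α₁ := min_le_left _ _
  have h2 : θ * W.η₁ ≤ r₁ :=
    (le_div_iff₀ W.η₁_pos).1 ((min_le_right _ _).trans (min_le_left _ _))
  have h3 : θ * W.η₂ ≤ r₂ :=
    (le_div_iff₀ W.η₂_pos).1 ((min_le_right _ _).trans (min_le_right _ _))
  rw [formA_eq, norm_sq_U, real_inner_self_eq_norm_sq, real_inner_self_eq_norm_sq,
    real_inner_self_eq_norm_sq]
  have k1 := mul_le_mul_of_nonneg_right h1 (sq_nonneg ‖W.obs u‖)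
  have k2 := mul_le_mul_of_nonneg_right h2 (sq_nonneg ‖W.resJ u‖)
  have k3 := mul_le_mul_of_nonneg_right h3 (sq_nonneg ‖W.resI u‖)
  linarith

variable {W}

/-- The solution is its own test element; subtracting the two equations removes `b_α`. -/
lemma IsMixedSol.energy_le {α₁ α₂ r₁ r₂ θ₁ θ₂ : ℝ}
    (ha : ∀ u, θ₁ * ‖u‖ ^ 2 ≤ W.formA α₁ r₁ r₂ u u)
    (hc : ∀ ψ, θ₂ * Psi.nrm ψ ^ 2 ≤ W.formC α₁ α₂ ψ ψ) {F : W.U → ℝ} {G : W.Psi → ℝ}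
    {x : W.U × W.Psi} (hx : W.IsMixedSol α₁ α₂ r₁ r₂ F G x) :
    θ₁ * ‖x.1‖ ^ 2 + θ₂ * Psi.nrm x.2 ^ 2 ≤ F x.1 - G x.2 := by
  linarith [ha x.1, hc x.2, hx.1 x.1, hx.2 x.2]

lemma IsMixedSol.sub {α₁ α₂ r₁ r₂ : ℝ} {F : W.U → ℝ} {G : W.Psi → ℝ} {x x' : W.U × W.Psi}
    (hx : W.IsMixedSol α₁ α₂ r₁ r₂ F G x) (hx' : W.IsMixedSol α₁ α₂ r₁ r₂ F G x') :
    W.IsMixedSol α₁ α₂ r₁ r₂ 0 0 (x - x') := by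
  refine ⟨fun v => ?_, fun χ => ?_⟩
  · have h := hx.1 v
    have h' := hx'.1 v
    rw [formA_eq, formB_eq] at h h' ⊢
    simp only [Prod.fst_sub, Prod.snd_sub, map_sub, inner_sub_left, inner_sub_right,
      Pi.zero_apply]
    linarith
  · have h := hx.2 χ
    have h' := hx'.2 χ
    rw [formC_eq, formB_eq] at h h' ⊢
    simp only [Prod.fst_sub, Prod.snd_sub, map_sub, inner_sub_left,
      Pi.zero_apply] at h h' ⊢
    linarith

lemma IsMixedSol.unique {α₁ α₂ r₁ r₂ θ₁ θ₂ : ℝ} (h₁ : 0 < θ₁) (h₂ : 0 < θ₂)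
    (ha : ∀ u, θ₁ * ‖u‖ ^ 2 ≤ W.formA α₁ r₁ r₂ u u)
    (hc : ∀ ψ, θ₂ * Psi.nrm ψ ^ 2 ≤ W.formC α₁ α₂ ψ ψ) {F : W.U → ℝ} {G : W.Psi → ℝ}
    {x x' : W.U × W.Psi} (hx : W.IsMixedSol α₁ α₂ r₁ r₂ F G x)
    (hx' : W.IsMixedSol α₁ α₂ r₁ r₂ F G x') : x = x' := by
  have h := (hx.sub hx').energy_le ha hc
  rw [Pi.zero_apply, Pi.zero_apply, sub_zero] at h
  have k1 := mul_nonneg h₁.le (sq_nonneg ‖(x - x').1‖)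
  have k2 := mul_nonneg h₂.le (sq_nonneg (Psi.nrm (x - x').2))
  have e1 : θ₁ * ‖(x - x').1‖ ^ 2 = 0 := by linarith
  have e2 : θ₂ * Psi.nrm (x - x').2 ^ 2 = 0 := by linarith
  rw [mul_eq_zero_iff_left h₁.ne', sq_eq_zero_iff, norm_eq_zero] at e1
  rw [mul_eq_zero_iff_left h₂.ne', sq_eq_zero_iff] at e2
  exact sub_eq_zero.1 (Prod.ext e1 (W.eq_zero_of_nrm e2))

/-- As a submodule, `W.Psi` inherits the norm of `L² × L²` and not that of `Ψ`. The forms are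
therefore transported to a Hilbert space `R` isometric to `Ψ`, where the abstract result applies. -/
lemma exists_isMixedSol_of_equiv {R : Type*} [NormedAddCommGroup R] [InnerProductSpace ℝ R]
    [CompleteSpace R] (e : W.Psi ≃ₗ[ℝ] R) (he : ∀ χ, Psi.nrm (e.symm χ) = ‖χ‖)
    {α₁ α₂ r₁ r₂ θ₁ θ₂ : ℝ} (h₁ : 0 < θ₁) (h₂ : 0 < θ₂)
    (ha : ∀ u, θ₁ * ‖u‖ ^ 2 ≤ W.formA α₁ r₁ r₂ u u)
    (hc : ∀ ψ, θ₂ * Psi.nrm ψ ^ 2 ≤ W.formC α₁ α₂ ψ ψ) (F : W.U →L[ℝ] ℝ) (G : W.Psi →ₗ[ℝ] ℝ)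
    {M : ℝ} (hG : ∀ χ, |G χ| ≤ M * Psi.nrm χ) :
    ∃ x : W.U × W.Psi, W.IsMixedSol α₁ α₂ r₁ r₂ F G x := by
  obtain ⟨K, hK⟩ := W.exists_norm_phiL_le
  obtain ⟨s, hs⟩ := exists_clm_of_bound e he W.sigmaL (C := 1)
    fun ψ => (W.norm_sigmaL_le ψ).trans_eq (one_mul _).symm
  obtain ⟨g, hg⟩ := exists_clm_of_bound e he W.gradL W.norm_gradL_le
  obtain ⟨f, hf⟩ := exists_clm_of_bound e he W.phiL hK
  obtain ⟨i, hi⟩ := exists_clm_of_bound e he W.istarL (C := 1)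
    fun ψ => (W.norm_istarL_le ψ).trans_eq (one_mul _).symm
  obtain ⟨G', hG'⟩ := exists_clm_of_bound e he G hG
  obtain ⟨a, ea⟩ : ∃ a : W.U →L[ℝ] W.U →L[ℝ] ℝ, ∀ u v, a u v = W.formA α₁ r₁ r₂ u v :=
    ⟨(1 - α₁) • innerComp W.obs W.obs + r₁ • innerComp W.resJ W.resJ
      + r₂ • innerComp W.resI W.resI, fun u v => (W.formA_eq α₁ r₁ r₂ u v).symm⟩
  obtain ⟨b, eb⟩ : ∃ b : W.U →L[ℝ] R →L[ℝ] ℝ, ∀ u χ, b u χ = W.formB α₁ u (e.symm χ) :=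
    ⟨innerComp (mulL W.bounded₁ ∘L W.resJ) s + innerComp (mulL W.bounded ∘L W.resI) f
      - α₁ • innerComp W.obs (restrictL W.μq_le ∘L i), fun u χ => by
        rw [formB_eq, ← hs, ← hf, ← hi]
        rfl⟩
  obtain ⟨c, ec⟩ : ∃ c : R →L[ℝ] R →L[ℝ] ℝ,
      ∀ ψ χ, c ψ χ = W.formC α₁ α₂ (e.symm ψ) (e.symm χ) :=
    ⟨α₁ • innerComp i i + α₂ • innerComp (P.cL ∘L g - s) (P.cL ∘L g - s), fun ψ χ => by
        change α₁ * inner ℝ (i ψ) (i χ) + α₂ * inner ℝ (P.cL (g ψ) - s ψ) (P.cL (g χ) - s χ) = _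
        rw [hs, hs, hi, hi, hg, hg, formC_eq]⟩
  obtain ⟨u, ψ, k1, k2⟩ := exists_mixed_solution a b c h₁ h₂ (fun u => (ha u).trans_eq (ea u u).symm)
    (fun ψ => by rw [ec, ← he]; exact hc _) F G'
  refine ⟨(u, e.symm ψ), fun v => ?_, fun χ => ?_⟩
  · rw [← ea, ← eb, k1]
  · have := k2 (e χ)
    rwa [eb, ec, hG', LinearEquiv.symm_apply_apply] at this

lemma exists_isMixedSol_of_embedding {H : Type*} [NormedAddCommGroup H] [InnerProductSpace ℝ H]
    [CompleteSpace H] (J : W.Psi →ₗ[ℝ] H) (hJ : Function.Injective J)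
    (hJc : IsClosed (LinearMap.range J : Set H)) (hn : ∀ ψ, Psi.nrm ψ = ‖J ψ‖)
    {α₁ α₂ r₁ r₂ θ₁ θ₂ : ℝ} (h₁ : 0 < θ₁) (h₂ : 0 < θ₂)
    (ha : ∀ u, θ₁ * ‖u‖ ^ 2 ≤ W.formA α₁ r₁ r₂ u u)
    (hc : ∀ ψ, θ₂ * Psi.nrm ψ ^ 2 ≤ W.formC α₁ α₂ ψ ψ) (F : W.U →L[ℝ] ℝ) (G : W.Psi →ₗ[ℝ] ℝ)
    {M : ℝ} (hG : ∀ χ, |G χ| ≤ M * Psi.nrm χ) :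
    ∃ x : W.U × W.Psi, W.IsMixedSol α₁ α₂ r₁ r₂ F G x := by
  have : CompleteSpace (LinearMap.range J) := hJc.completeSpace_coe
  refine exists_isMixedSol_of_equiv (LinearEquiv.ofInjective J hJ) (fun χ => ?_) h₁ h₂ ha hc F G hG
  obtain ⟨ψ, rfl⟩ := (LinearEquiv.ofInjective J hJ).surjective χ
  rw [LinearEquiv.symm_apply_apply, hn]
  rfl

/-- Existence for the mixed system with arbitrary continuous right-hand sides. -/
lemma exists_isMixedSol {α₁ α₂ r₁ r₂ θ₁ θ₂ : ℝ} (h₁ : 0 < θ₁) (h₂ : 0 < θ₂)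
    (ha : ∀ u, θ₁ * ‖u‖ ^ 2 ≤ W.formA α₁ r₁ r₂ u u)
    (hc : ∀ ψ, θ₂ * Psi.nrm ψ ^ 2 ≤ W.formC α₁ α₂ ψ ψ) (F : W.U →L[ℝ] ℝ) (G : W.Psi →ₗ[ℝ] ℝ)
    {M : ℝ} (hG : ∀ χ, |G χ| ≤ M * Psi.nrm χ) :
    ∃ x : W.U × W.Psi, W.IsMixedSol α₁ α₂ r₁ r₂ F G x :=
  exists_isMixedSol_of_embedding W.embed embed_injective isClosed_range_embed nrm_eq h₁ h₂ ha hc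
    F G hG

variable (W)

lemma wellPosed_of_coercive {α₁ α₂ r₁ r₂ θ₁ θ₂ : ℝ} (h₁ : 0 < θ₁) (h₂ : 0 < θ₂)
    (ha : ∀ u, θ₁ * ‖u‖ ^ 2 ≤ W.formA α₁ r₁ r₂ u u)
    (hc : ∀ ψ, θ₂ * Psi.nrm ψ ^ 2 ≤ W.formC α₁ α₂ ψ ψ) : W.WellPosed α₁ α₂ r₁ r₂ := by
  set θ := min θ₁ θ₂
  have hθ : 0 < θ := lt_min h₁ h₂
  -- With `n₁`, `n₂` the two norms of the solution, `θ(n₁² + n₂²) ≤ (‖F‖ + M)(n₁ + n₂)`. The factor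
  -- `2` comes from `(n₁ + n₂)² ≤ 2(n₁² + n₂²)`, before division by `n₁ + n₂`.
  refine ⟨2 / θ, fun F G M hM hG => ?_⟩
  obtain ⟨x, hx⟩ := exists_isMixedSol h₁ h₂ ha hc F G hG
  refine ⟨x, hx, fun x' hx' => IsMixedSol.unique h₁ h₂ ha hc hx' hx, ?_⟩
  have h := hx.energy_le ha hc
  have n1 := norm_nonneg x.1
  have n2 := W.nrm_nonneg x.2
  have k1 : F x.1 ≤ ‖F‖ * ‖x.1‖ := (le_abs_self _).trans (F.le_opNorm _)
  have k2 : -G x.2 ≤ M * Psi.nrm x.2 := (neg_le_abs _).trans (hG _)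
  have k3 := mul_le_mul_of_nonneg_right (min_le_left θ₁ θ₂) (sq_nonneg ‖x.1‖)
  have k4 := mul_le_mul_of_nonneg_right (min_le_right θ₁ θ₂) (sq_nonneg (Psi.nrm x.2))
  have k5 := mul_nonneg (norm_nonneg F) n2
  have k6 := mul_nonneg hM n1
  have k7 : θ * (‖x.1‖ + Psi.nrm x.2) ^ 2 ≤ 2 * (θ * (‖x.1‖ ^ 2 + Psi.nrm x.2 ^ 2)) := by
    have := mul_nonneg hθ.le (sq_nonneg (‖x.1‖ - Psi.nrm x.2))
    linarith
  rw [div_mul_eq_mul_div, le_div_iff₀ hθ]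
  rcases (add_nonneg n1 n2).eq_or_lt with h0 | h0
  · rw [← h0, zero_mul]
    positivity
  · refine le_of_mul_le_mul_right ?_ h0
    linarith

/-- Solvability and a priori estimate for the right-hand sides given by an observation. -/
lemma exists_solution_obs {α₁ α₂ r₁ r₂ θ₁ θ₂ : ℝ} (hα₁ : α₁ ∈ Ioo (0 : ℝ) 1) (h₁ : 0 < θ₁)
    (h₂ : 0 < θ₂) (ha : ∀ u, θ₁ * ‖u‖ ^ 2 ≤ W.formA α₁ r₁ r₂ u u)
    (hc : ∀ ψ, θ₂ * Psi.nrm ψ ^ 2 ≤ W.formC α₁ α₂ ψ ψ) (yobs : W.L2q) :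
    ∃ x : W.U × W.Psi, W.IsMixedSol α₁ α₂ r₁ r₂ (W.formL1 α₁ yobs) (W.formL2 α₁ yobs) x ∧
      (∀ x', W.IsMixedSol α₁ α₂ r₁ r₂ (W.formL1 α₁ yobs) (W.formL2 α₁ yobs) x' → x' = x) ∧
      θ₁ * ‖x.1‖ ^ 2 + θ₂ * Psi.nrm x.2 ^ 2 ≤ ((1 - α₁) ^ 2 / θ₁ + α₁ ^ 2 / θ₂) *
        ∫ z, (W.ρ₀ z ^ 2)⁻¹ * yobs z ^ 2 ∂W.μq := by
  set w := mulL W.memLp_inv_ρ₀ yobs with hw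
  have hα : 0 ≤ 1 - α₁ := by linarith [hα₁.2]
  have hL1 : ∀ u, |W.formL1 α₁ yobs u| ≤ (1 - α₁) * ‖w‖ * ‖u‖ := fun u => by
    rw [formL1_eq, abs_mul, abs_of_nonneg hα, mul_assoc]
    exact mul_le_mul_of_nonneg_left ((abs_real_inner_le_norm _ _).trans
      (mul_le_mul_of_nonneg_left (W.norm_obs_le u) (norm_nonneg _))) hα
  have hL2 : ∀ ψ, |W.formL2 α₁ yobs ψ| ≤ α₁ * ‖w‖ * Psi.nrm ψ := fun ψ => by
    rw [formL2_eq, abs_mul, abs_neg, abs_of_pos hα₁.1, mul_assoc]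
    exact mul_le_mul_of_nonneg_left ((abs_real_inner_le_norm _ _).trans
      (mul_le_mul_of_nonneg_left ((norm_restrictL_le _ _).trans (W.norm_istarL_le ψ))
        (norm_nonneg _))) hα₁.1.le
  obtain ⟨F, hF⟩ : ∃ F : W.U →L[ℝ] ℝ, ∀ u, W.formL1 α₁ yobs u = F u :=
    ⟨(1 - α₁) • (innerSL ℝ w ∘L W.obs), fun u => W.formL1_eq α₁ yobs u⟩
  obtain ⟨G, hG⟩ : ∃ G : W.Psi →ₗ[ℝ] ℝ, ∀ ψ, W.formL2 α₁ yobs ψ = G ψ :=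
    ⟨(-α₁) • (innerₗ (Lp ℝ 2 W.μq) w ∘ₗ (restrictL W.μq_le).toLinearMap ∘ₗ W.istarL),
      fun ψ => W.formL2_eq α₁ yobs ψ⟩
  obtain ⟨x, hx⟩ := exists_isMixedSol h₁ h₂ ha hc F G (M := α₁ * ‖w‖) (fun ψ => hG ψ ▸ hL2 ψ)
  rw [← funext hF, ← funext hG] at hx
  refine ⟨x, hx, fun x' hx' => IsMixedSol.unique h₁ h₂ ha hc hx' hx, ?_⟩
  have h := hx.energy_le ha hc
  have k1 := (le_abs_self _).trans (hL1 x.1)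
  have k2 := (neg_le_abs _).trans (hL2 x.2)
  -- Writing `E` for the left-hand side of the estimate, twice the energy inequality gives `2E ≤ 2(1
  -- - α₁)‖w‖‖x.1‖ + 2α₁‖w‖ Psi.nrm x.2`. These two Young inequalities bound the right-hand side by
  -- `E` plus exactly the claimed quantity.
  have young : ∀ {θ : ℝ} (_ : 0 < θ) (β n : ℝ),
      2 * (β * ‖w‖ * n) ≤ θ * n ^ 2 + β ^ 2 / θ * ‖w‖ ^ 2 := fun {θ} hθ β n => by
    have e : θ * n ^ 2 + β ^ 2 / θ * ‖w‖ ^ 2 - 2 * (β * ‖w‖ * n)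
        = θ * (n - β * ‖w‖ / θ) ^ 2 := by
      field_simp
      ring
    have := mul_nonneg hθ.le (sq_nonneg (n - β * ‖w‖ / θ))
    linarith
  have y1 := young h₁ (1 - α₁) ‖x.1‖
  have y2 := young h₂ α₁ (Psi.nrm x.2)
  rw [← norm_sq_inv_mul, ← hw]
  linarith

end ObsData

end MixedHeat

theorem mainTheorem8 {N : ℕ} (hN : 0 < N) (P : MixedHeat.ParabolicData N)
    (α₁ α₂ ρs : ℝ) (hα₁ : α₁ ∈ Set.Ioo (0 : ℝ) 1) (hα₂ : α₂ ∈ Set.Ioo (0 : ℝ) 1) (hρs : 0 < ρs) :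
    ∃ θ₂ : ℝ, 0 < θ₂ ∧
      ∀ (W : MixedHeat.ObsData P ρs) (r₁ r₂ θ₁ : ℝ), 0 < r₁ → 0 < r₂ →
        θ₁ = min (1 - α₁) (min (r₁ / W.η₁) (r₂ / W.η₂)) →
          W.WellPosed α₁ α₂ r₁ r₂ ∧
          ∀ yobs : W.L2q, ∃ x : W.U × W.Psi,
            W.IsMixedSol α₁ α₂ r₁ r₂ (W.formL1 α₁ yobs) (W.formL2 α₁ yobs) x ∧
            (∀ x', W.IsMixedSol α₁ α₂ r₁ r₂ (W.formL1 α₁ yobs) (W.formL2 α₁ yobs) x' → x' = x) ∧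
            θ₁ * ‖x.1‖ ^ 2 + θ₂ * MixedHeat.ObsData.Psi.nrm x.2 ^ 2 ≤
              ((1 - α₁) ^ 2 / θ₁ + α₁ ^ 2 / θ₂) *
                ∫ z, (W.ρ₀ z ^ 2)⁻¹ * yobs z ^ 2 ∂W.μq := by
  -- `θ₂` is fixed before the weights, `ω`, the parameters and the observation are introduced: the
  -- order of the quantifiers is the asserted independence.
  obtain ⟨θ₂, h₂, hc⟩ := MixedHeat.ObsData.exists_coercive_formC P hα₁.1 hα₂.1 hρs
  refine ⟨θ₂, h₂, fun W r₁ r₂ θ₁ hr₁ hr₂ hθ => ?_⟩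
  have h₁ : 0 < θ₁ := by
    rw [hθ]
    exact lt_min (sub_pos.2 hα₁.2) (lt_min (div_pos hr₁ W.η₁_pos) (div_pos hr₂ W.η₂_pos))
  have ha : ∀ u, θ₁ * ‖u‖ ^ 2 ≤ W.formA α₁ r₁ r₂ u u := hθ ▸ W.le_formA
  exact ⟨W.wellPosed_of_coercive h₁ h₂ ha (hc W),
    W.exists_solution_obs hα₁ h₁ h₂ ha (hc W)⟩
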